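/- Let $T>0$ and let all spaces consist of real-valued functions, or all of complex-valued functions. Consider, on $(0,T)\times(0,1)$, the system $$\begin{cases}\rho_t+\rho_x+u_x=0,\\ u_t-u_{xx}+u_x+\rho_x=0,\\ \rho(t,0)=\rho(t,1)+p(t),\quad u(t,0)=u(t,1)=0 & (t\in(0,T)),\\ \rho(0,x)=\rho_0(x),\quad u(0,x)=u_0(x) & (x\in(0,1)).\end{cases}\tag{1}$$ For $(f,g)\in L^2(0,T;L^2(0,1))^2$ let $(\sigma,v)\in L^2(0,T;L^2(0,1))\times L^2(0,T;H^1_0(0,1))$ denote the weak solution of the adjoint system $$\begin{cases}-\sigma_t-\sigma_x-v_x=f,\\ -v_t-v_{xx}-v_x-\sigma_x=g,\\ \sigma(t,0)=\sigma(t,1),\quad v(t,0)=v(t,1)=0,\\ \sigma(T,\cdot)=0,\quad v(T,\cdot)=0,\end{cases}$$ that is: for all $\xi\in C^\infty([0,1])$ with $\xi(0)=\xi(1)$, all $\eta\in C^\infty([0,1])$ with $\eta(0)=\eta(1)=0$, and almost every $t\in(0,T)$, $$\int_0^1\sigma(t)\xi\,dx=\int_t^T\!\!\int_0^1\big(f\xi+v_x\xi-\sigma\xi'\big)\,dx\,ds,\qquad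 \int_0^1 v(t)\eta\,dx=\int_t^T\!\!\int_0^1\big(g\eta+v_x\eta-\sigma\eta'-v_x\eta'\big)\,dx\,ds.$$ The values $\sigma(0,\cdot),v(0,\cdot)$ are those of the representatives of $\sigma,v$ in $C([0,T];L^2(0,1))$, and $\sigma(\cdot,1)\in L^2(0,T)$ is the trace of $\sigma$ at $x=1$, defined by integration by parts against the transport operator: for some $h\in L^2(0,T;L^2(0,1))$ (which is then $\sigma_t+\sigma_x$), $$\int_0^T\!\!\int_0^1\big(h\,\theta\chi+\sigma(\theta'\chi+\theta\chi')\big)\,dx\,dt=\int_0^T\sigma(t,1)\,\theta(t)\chi(1)\,dt$$ for all $\theta\in C_c^\infty(0,T)$ and all $\chi\in C^\infty([0,1])$ vanishing near $x=0$. Given $\rho_0,u_0\in L^2(0,1)$ and $p\in L^2(0,T)$, a pair $(\rho,u)\in L^2(0,T;L^2(0,1))^2$ is a solution of (1) in the sense of transposition if for all $f,g\in L^2(0,T;L^2(0,1))$ $$\int_0^T\!\!\int_0^1\rho f\,dx\,dt+\int_0^T\!\!\int_0^1 u g\,dx\,dt=\int_0^1\rho_0\,\sigma(0,\cdot)\,dx+\int_0^1u_0\,v(0,\cdot)\,dx+\int_0^T\sigma(t,1)p(t)\,dt.$$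 **Theorem.** For every $p\in L^2(0,T)$ and every $(\rho_0,u_0)\in L^2(0,1)\times L^2(0,1)$, the system (1) has a unique solution $(\rho,u)\in L^2(0,T;L^2(0,1))\times L^2(0,T;L^2(0,1))$ in the sense of transposition, and the map $((\rho_0,u_0),p)\mapsto(\rho,u)$ is linear and continuous from $(L^2(0,1)\times L^2(0,1))\times L^2(0,T)$ into $L^2(0,T;L^2(0,1))\times L^2(0,T;L^2(0,1))$. Moreover, the solution satisfies $$(\rho,u)\in C([0,T];L^2(0,1))\times\big[C([0,T];L^2(0,1))\cap L^2(0,T;H^1_0(0,1))\big],$$ and there is a constant $C>0$, independent of $\rho_0,u_0,p$, such that $$\|\rho\|_{C([0,T];L^2)}+\|u\|_{C([0,T];L^2)}+\|u\|_{L^2(0,T;H^1_0)}\le C\big(\|\rho_0\|_{L^2(0,1)}+\|u_0\|_{L^2(0,1)}+\|p\|_{L^2(0,T)}\big).$$ -/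

import Mathlib

open MeasureTheory Set
open scoped ContDiff

noncomputable section

/-- Lebesgue measure on the space interval `(0,1)`. -/
abbrev spaceMeasure : Measure ℝ := volume.restrict (Ioo (0 : ℝ) 1)

/-- Lebesgue measure on the time interval `(0,T)`. -/
abbrev timeMeasure (T : ℝ) : Measure ℝ := volume.restrict (Ioo (0 : ℝ) T)

/-- `L²(0,1)`, with scalars `𝕜 = ℝ` or `ℂ`. -/
abbrev SpaceL2 (𝕜 : Type*) [RCLike 𝕜] : Type _ := Lp 𝕜 2 spaceMeasure

/-- `L²(0,T;E)` in the sense of Bochner. -/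
abbrev TimeL2 (T : ℝ) (E : Type*) [NormedAddCommGroup E] : Type _ := Lp E 2 (timeMeasure T)

/-- `C([0,T];E)`, normed by the supremum norm. -/
abbrev TimeC (T : ℝ) (E : Type*) [NormedAddCommGroup E] : Type _ := C(Icc (0 : ℝ) T, E)

/-- The continuous function `R` on `[0,T]` is a representative of `r`, a function defined almost
everywhere on `(0,T)`. -/
def IsContRep {T : ℝ} {E : Type*} [NormedAddCommGroup E] (R : TimeC T E) (r : ℝ → E) : Prop :=
  ∀ᵐ t ∂(timeMeasure T), ∃ ht : t ∈ Icc (0 : ℝ) T, R ⟨t, ht⟩ = r t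

/-- `H¹₀(0,1)`: the closure of `C_c^∞(0,1)` for the norm `(‖φ‖² + ‖φ'‖²)^(1/2)`. An element `w` of
this space is recorded as the pair `(w, w')` of the function and its weak derivative. -/
def H10 (𝕜 : Type*) [RCLike 𝕜] : Submodule 𝕜 (WithLp 2 (SpaceL2 𝕜 × SpaceL2 𝕜)) :=
  (Submodule.span 𝕜
    {z | ∃ φ : ℝ → 𝕜, ContDiff ℝ ∞ φ ∧ HasCompactSupport φ ∧ tsupport φ ⊆ Ioo 0 1 ∧
      z.fst =ᵐ[spaceMeasure] φ ∧ z.snd =ᵐ[spaceMeasure] deriv φ}).topologicalClosure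

/-- The function in `L²(0,1)` underlying an element of `H¹₀(0,1)`. -/
def h10Val {𝕜 : Type*} [RCLike 𝕜] (w : H10 𝕜) : SpaceL2 𝕜 :=
  (w : WithLp 2 (SpaceL2 𝕜 × SpaceL2 𝕜)).fst

/-- The weak derivative of an element of `H¹₀(0,1)`. -/
def h10Deriv {𝕜 : Type*} [RCLike 𝕜] (w : H10 𝕜) : SpaceL2 𝕜 :=
  (w : WithLp 2 (SpaceL2 𝕜 × SpaceL2 𝕜)).snd

/-- `(σ, v) ∈ L²(0,T;L²(0,1)) × L²(0,T;H¹₀(0,1))` is a weak solution of the adjoint system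
`-σ_t - σ_x - v_x = f`, `-v_t - v_xx - v_x - σ_x = g` in `(0,T) × (0,1)`,
`σ(t,0) = σ(t,1)`, `v(t,0) = v(t,1) = 0`, `σ(T,·) = v(T,·) = 0`.

The equations are multiplied by test functions of `x` and integrated by parts in `x`; the resulting
scalar equations in `t` hold in integrated form, from `t` to `T`, and the final data are zero.
The periodicity of `σ` is expressed by testing with all smooth `ξ` such that `ξ(0) = ξ(1)`, the
Dirichlet condition on `v` by `v(t) ∈ H¹₀(0,1)`. -/
def IsAdjointWeakSolution {𝕜 : Type*} [RCLike 𝕜] {T : ℝ} (f g : TimeL2 T (SpaceL2 𝕜))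
    (σ : TimeL2 T (SpaceL2 𝕜)) (v : TimeL2 T (H10 𝕜)) : Prop :=
  (∀ ξ : ℝ → 𝕜, ContDiff ℝ ∞ ξ → ξ 0 = ξ 1 →
    ∀ᵐ t ∂(timeMeasure T),
      ∫ x in Ioo (0 : ℝ) 1, σ t x * ξ x =
        ∫ s in Ioo t T, ∫ x in Ioo (0 : ℝ) 1,
          (f s x * ξ x + h10Deriv (v s) x * ξ x - σ s x * deriv ξ x)) ∧
  (∀ η : ℝ → 𝕜, ContDiff ℝ ∞ η → η 0 = 0 → η 1 = 0 →
    ∀ᵐ t ∂(timeMeasure T),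
      ∫ x in Ioo (0 : ℝ) 1, h10Val (v t) x * η x =
        ∫ s in Ioo t T, ∫ x in Ioo (0 : ℝ) 1,
          (g s x * η x + h10Deriv (v s) x * η x - σ s x * deriv η x - h10Deriv (v s) x * deriv η x))

/-- `τ ∈ L²(0,T)` is the trace `σ(·,1)` at the end point `x = 1` of `σ ∈ L²(0,T;L²(0,1))`,
for `σ` such that the transport derivative `h = σ_t + σ_x` is in `L²(0,T;L²(0,1))`. The trace (and
`h`) are defined by integration by parts, with smooth test functions `θ(t) χ(x)`
where `θ` has compact support in `(0,T)` and `χ` vanishes near `x = 0` but not necessarily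
near `x = 1`. -/
def IsTraceAtOne {𝕜 : Type*} [RCLike 𝕜] {T : ℝ} (σ : TimeL2 T (SpaceL2 𝕜)) (τ : TimeL2 T 𝕜) :
    Prop :=
  ∃ h : TimeL2 T (SpaceL2 𝕜), ∀ θ χ : ℝ → 𝕜,
    ContDiff ℝ ∞ θ → HasCompactSupport θ → tsupport θ ⊆ Ioo 0 T →
    ContDiff ℝ ∞ χ → tsupport χ ⊆ Ioi 0 →
    ∫ t in Ioo (0 : ℝ) T, ∫ x in Ioo (0 : ℝ) 1,
        (h t x * (θ t * χ x) + σ t x * (deriv θ t * χ x + θ t * deriv χ x)) =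
      ∫ t in Ioo (0 : ℝ) T, τ t * (θ t * χ 1)

/-- `(ρ, u)` is a solution in the sense of transposition of the system
`ρ_t + ρ_x + u_x = 0`, `u_t - u_xx + u_x + ρ_x = 0` in `(0,T) × (0,1)`,
`ρ(t,0) = ρ(t,1) + p(t)`, `u(t,0) = u(t,1) = 0`, `ρ(0,·) = ρ₀`, `u(0,·) = u₀`.

Here `(σ, v)` is the weak solution of the adjoint system with right-hand side `(f, g)` and zero
final data, `S` and `V` are the representatives of `σ` and `v` in `C([0,T];L²(0,1))`, which give
`σ(0,·)` and `v(0,·)` a meaning, and `τ` is the trace `σ(·,1)`. -/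
def IsTranspositionSolution {𝕜 : Type*} [RCLike 𝕜] {T : ℝ} (hT : 0 < T)
    (ρ₀ u₀ : SpaceL2 𝕜) (p : TimeL2 T 𝕜)
    (U : TimeL2 T (SpaceL2 𝕜) × TimeL2 T (SpaceL2 𝕜)) : Prop :=
  ∀ (f g σ : TimeL2 T (SpaceL2 𝕜)) (v : TimeL2 T (H10 𝕜)) (S V : TimeC T (SpaceL2 𝕜))
    (τ : TimeL2 T 𝕜),
    IsAdjointWeakSolution f g σ v →
    IsContRep S σ → IsContRep V (fun t => h10Val (v t)) → IsTraceAtOne σ τ →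
    (∫ t in Ioo (0 : ℝ) T, ∫ x in Ioo (0 : ℝ) 1, U.1 t x * f t x) +
        (∫ t in Ioo (0 : ℝ) T, ∫ x in Ioo (0 : ℝ) 1, U.2 t x * g t x) =
      (∫ x in Ioo (0 : ℝ) 1, ρ₀ x * S ⟨0, le_rfl, hT.le⟩ x) +
        (∫ x in Ioo (0 : ℝ) 1, u₀ x * V ⟨0, le_rfl, hT.le⟩ x) +
        ∫ t in Ioo (0 : ℝ) T, τ t * p t

end

/-! The boundary datum enters only through pure transport. Let L = `lift p` solve L_t + L_x = 0 with
L(t,0) = L(t,1) + p(t) and L(0,·) = 0. With p extended by zero, L is the finite sum of the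
translates p(t - j - x), a continuous curve in L². Then r = ρ - L is periodic in x, and (r, w) with
w = u solves r_t + r_x + w_x = 0, w_t = -(L + r + w - w_x)_x, so that p is replaced by a source in
divergence form.

Up to reversal of time, this system and the adjoint system belong to one family. Tested with itself,
the first order part has zero real part (periodicity of the first component, zero boundary values of
the second), and diffusion controls the derivative of the second component. A weighted energy
estimate (`norm_evolutionTest_le`) and Lions' projection theorem (`exists_inner_eq_of_norm_le`) give
weak solutions in L²(0,T;L²) × L²(0,T;H¹₀) (`exists_backward`, `exists_forward`).

The transport component has no regularity in x, so continuity in time and duality are obtained mode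
by mode: Hartley functions for transport, sines for diffusion. Each mode is a primitive of an
integrable function. In transport, the unbounded coefficients ±2πk couple the modes k and -k
antisymmetrically and cancel in the sum of their energies. In diffusion, the factor (j+1)π times a
sine coefficient of w is a cosine coefficient of w_x, which is square summable. This yields
continuous representatives with bounds (`WeakTransport.exists_contRep`, `WeakFlux.exists_contRep`)
and product rules in time for two solutions (`WeakTransport.pairing_sub`, `WeakFlux.pairing_sub`).

The trace σ(·,1) is found by duality: it represents the functional p ↦ -∫∫ L (σ_t + σ_x). It is
unique, by test functions concentrating at x = 1. Adding the product rules for (r, w) against (σ, v)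
gives the transposition identity (`isTranspositionSolution_of_weak`). Conversely, the adjoint system
is solvable for all (f, g), which determines (ρ, u). Linearity follows from uniqueness, and the
bounds of the constructed solution hold for every solution. -/

open MeasureTheory Set
open scoped ContDiff

noncomputable section

/-! ### Product rule for absolutely continuous functions -/

section Primitive

variable {𝕜 : Type*} [RCLike 𝕜]

/-- Fubini on the square (0,t)²: the left side is the integral of f(z₁)g(z₂), and cutting the square
along its diagonal gives the two terms on the right. -/
theorem integral_Ioc_mul_integral_Ioc {f g : ℝ → 𝕜} {t : ℝ} (ht : 0 ≤ t)
    (hf : IntegrableOn f (Ioc 0 t)) (hg : IntegrableOn g (Ioc 0 t)) :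
    (∫ s in (0 : ℝ)..t, f s) * (∫ s in (0 : ℝ)..t, g s) =
      ∫ s in (0 : ℝ)..t, (f s * (∫ r in (0 : ℝ)..s, g r) + (∫ r in (0 : ℝ)..s, f r) * g s) := by
  set μ : Measure ℝ := volume.restrict (Ioc 0 t)
  have hprod : Integrable (fun z : ℝ × ℝ => f z.1 * g z.2) (μ.prod μ) := hf.mul_prod hg
  have hA : MeasurableSet {z : ℝ × ℝ | z.2 ≤ z.1} := measurableSet_le measurable_snd measurable_fst
  have h1 : Integrable ({z : ℝ × ℝ | z.2 ≤ z.1}.indicator fun z => f z.1 * g z.2) (μ.prod μ) :=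
    hprod.indicator hA
  have h2 : Integrable ({z : ℝ × ℝ | z.2 ≤ z.1}ᶜ.indicator fun z => f z.1 * g z.2) (μ.prod μ) :=
    hprod.indicator hA.compl
  have s1 : ∀ s ∈ Ioc 0 t, ∫ r, ({z : ℝ × ℝ | z.2 ≤ z.1}.indicator
      fun z => f z.1 * g z.2) (s, r) ∂μ = f s * (∫ r in (0 : ℝ)..s, g r) := fun s hs => by
    have : ∀ r, ({z : ℝ × ℝ | z.2 ≤ z.1}.indicator (fun z => f z.1 * g z.2)) (s, r) =
        (Iic s).indicator (fun r => f s * g r) r := fun r => by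
      simp [indicator]
    simp_rw [this]
    rw [integral_indicator measurableSet_Iic, Measure.restrict_restrict measurableSet_Iic,
      intervalIntegral.integral_of_le hs.1.le, ← integral_const_mul]
    congr 2
    ext r
    constructor
    · rintro ⟨h, h'⟩; exact ⟨h'.1, h⟩
    · rintro ⟨h, h'⟩; exact ⟨h', h, h'.trans hs.2⟩
  have s2 : ∀ r ∈ Ioc 0 t, ∫ s, ({z : ℝ × ℝ | z.2 ≤ z.1}ᶜ.indicator
      fun z => f z.1 * g z.2) (s, r) ∂μ = (∫ s in (0 : ℝ)..r, f s) * g r := fun r hr => by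
    have : ∀ s, ({z : ℝ × ℝ | z.2 ≤ z.1}ᶜ.indicator (fun z => f z.1 * g z.2)) (s, r) =
        (Iio r).indicator (fun s => f s * g r) s := fun s => by
      simp [indicator]
    simp_rw [this]
    rw [integral_indicator measurableSet_Iio, Measure.restrict_restrict measurableSet_Iio,
      intervalIntegral.integral_of_le hr.1.le, ← integral_mul_const, integral_Ioc_eq_integral_Ioo]
    congr 2
    ext s
    constructor
    · rintro ⟨h, h'⟩; exact ⟨h'.1, h⟩
    · rintro ⟨h, h'⟩; exact ⟨h', h, (le_of_lt h').trans hr.2⟩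
  have e1 : ∫ z, ({z : ℝ × ℝ | z.2 ≤ z.1}.indicator fun z => f z.1 * g z.2) z ∂(μ.prod μ) =
      ∫ s in Ioc 0 t, f s * (∫ r in (0 : ℝ)..s, g r) := by
    rw [integral_prod _ h1]
    exact setIntegral_congr_fun measurableSet_Ioc fun s hs => s1 s hs
  have e2 : ∫ z, ({z : ℝ × ℝ | z.2 ≤ z.1}ᶜ.indicator fun z => f z.1 * g z.2) z ∂(μ.prod μ) =
      ∫ r in Ioc 0 t, (∫ s in (0 : ℝ)..r, f s) * g r := by
    rw [integral_prod_symm _ h2]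
    exact setIntegral_congr_fun measurableSet_Ioc fun r hr => s2 r hr
  have e3 := integral_prod_mul (μ := μ) (ν := μ) f g
  have i1 : IntegrableOn (fun s => f s * (∫ r in (0 : ℝ)..s, g r)) (Ioc 0 t) := by
    refine h1.integral_prod_left.congr ?_
    filter_upwards [ae_restrict_mem measurableSet_Ioc] with s hs using s1 s hs
  have i2 : IntegrableOn (fun r => (∫ s in (0 : ℝ)..r, f s) * g r) (Ioc 0 t) := by
    refine h2.integral_prod_right.congr ?_
    filter_upwards [ae_restrict_mem measurableSet_Ioc] with r hr using s2 r hr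
  rw [intervalIntegral.integral_of_le ht, intervalIntegral.integral_of_le ht,
    intervalIntegral.integral_of_le ht, integral_add i1 i2, ← e1, ← e2, ← integral_add h1 h2, ← e3]
  refine integral_congr_ae (Filter.Eventually.of_forall fun z => ?_)
  simp only [indicator, mem_ofPred_eq, mem_compl_iff]
  split_ifs <;> simp_all

/-- Product rule for primitives of integrable functions. -/
theorem mul_primitive_eq {f g : ℝ → 𝕜} {T t : ℝ} (ht : t ∈ Icc 0 T)
    (hf : IntegrableOn f (Ioo 0 T)) (hg : IntegrableOn g (Ioo 0 T)) {F G : ℝ → 𝕜}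
    (hF : ∀ t ∈ Icc 0 T, F t = F 0 + ∫ s in (0 : ℝ)..t, f s)
    (hG : ∀ t ∈ Icc 0 T, G t = G 0 + ∫ s in (0 : ℝ)..t, g s) :
    F t * G t = F 0 * G 0 + ∫ s in (0 : ℝ)..t, (f s * G s + F s * g s) := by
  have hf' : IntegrableOn f (Ioc 0 t) :=
    ((integrableOn_Ioc_iff_integrableOn_Ioo).2 hf).mono_set (Ioc_subset_Ioc_right ht.2)
  have hg' : IntegrableOn g (Ioc 0 t) :=
    ((integrableOn_Ioc_iff_integrableOn_Ioo).2 hg).mono_set (Ioc_subset_Ioc_right ht.2)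
  have If := (intervalIntegrable_iff_integrableOn_Ioc_of_le ht.1).2 hf'
  have Ig := (intervalIntegrable_iff_integrableOn_Ioc_of_le ht.1).2 hg'
  have cF : ContinuousOn (fun s => ∫ r in (0 : ℝ)..s, f r) (uIcc 0 t) :=
    intervalIntegral.continuousOn_primitive_interval (by
      rw [uIcc_of_le ht.1]; exact (integrableOn_Icc_iff_integrableOn_Ioc).2 hf')
  have cG : ContinuousOn (fun s => ∫ r in (0 : ℝ)..s, g r) (uIcc 0 t) :=
    intervalIntegral.continuousOn_primitive_interval (by
      rw [uIcc_of_le ht.1]; exact (integrableOn_Icc_iff_integrableOn_Ioc).2 hg')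
  have key := integral_Ioc_mul_integral_Ioc ht.1 hf' hg'
  have e : ∫ s in (0 : ℝ)..t, (f s * G s + F s * g s) =
      ∫ s in (0 : ℝ)..t, ((f s * G 0 + F 0 * g s) +
        (f s * (∫ r in (0 : ℝ)..s, g r) + (∫ r in (0 : ℝ)..s, f r) * g s)) := by
    refine intervalIntegral.integral_congr fun s hs => ?_
    rw [uIcc_of_le ht.1] at hs
    have hs' : s ∈ Icc 0 T := ⟨hs.1, hs.2.trans ht.2⟩
    rw [hF s hs', hG s hs']
    ring
  rw [e, intervalIntegral.integral_add, ← key, intervalIntegral.integral_add,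
    intervalIntegral.integral_mul_const, intervalIntegral.integral_const_mul, hF t ht, hG t ht]
  · ring
  · exact If.mul_const _
  · exact Ig.const_mul _
  · exact (If.mul_const _).add (Ig.const_mul _)
  · exact (If.mul_continuousOn cG).add (Ig.continuousOn_mul cF)

end Primitive

/-! ### Bilinear pairings in L² -/

section Pairing

theorem norm_sq_Lp_two {α E : Type*} [MeasurableSpace α] {μ : Measure α} [NormedAddCommGroup E]
    (a : Lp E 2 μ) : ‖a‖ ^ 2 = ∫ t, ‖a t‖ ^ 2 ∂μ := by
  have h := Lp.norm_def a
  rw [h, eLpNorm_eq_lintegral_rpow_enorm_toReal (by simp) (by simp),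
    integral_eq_lintegral_of_nonneg_ae (Filter.Eventually.of_forall fun t => sq_nonneg ‖a t‖)
      (by exact (Lp.memLp a).1.norm.pow 2)]
  simp only [ENNReal.toReal_ofNat, ENNReal.rpow_ofNat, one_div]
  rw [← ENNReal.toReal_rpow, ← Real.rpow_natCast, ← Real.rpow_mul ENNReal.toReal_nonneg]
  simp only [Nat.cast_ofNat, ne_eq, OfNat.ofNat_ne_zero, not_false_eq_true, inv_mul_cancel₀,
    Real.rpow_one]
  congr 1
  refine lintegral_congr fun t => ?_
  rw [ENNReal.ofReal_pow (norm_nonneg _), ofReal_norm]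

variable {𝕜 : Type*} [RCLike 𝕜] {T : ℝ}

/-- The bilinear pairing `∫ a b` of `L²(0,1)`. -/
def pairing : SpaceL2 𝕜 →L[𝕜] SpaceL2 𝕜 →L[𝕜] 𝕜 :=
  (ContinuousLinearMap.mul 𝕜 𝕜).lpPairing spaceMeasure 2 2

theorem pairing_apply (a b : SpaceL2 𝕜) : pairing a b = ∫ x in Ioo (0 : ℝ) 1, a x * b x :=
  ContinuousLinearMap.lpPairing_eq_integral _ _ _

attribute [irreducible] pairing

theorem pairing_comm (a b : SpaceL2 𝕜) : pairing a b = pairing b a := by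
  simp only [pairing_apply, mul_comm]

/-- The weak formulations and the transposition formula contain no complex conjugate. Conjugating
one argument gives access to Hilbert space results for both scalar fields. -/
theorem pairing_eq_inner (a b : SpaceL2 𝕜) : pairing a b = inner 𝕜 (star a) b := by
  rw [pairing_apply, L2.inner_def]
  refine integral_congr_ae ?_
  filter_upwards [Lp.coeFn_star a] with x hx
  simp [hx, mul_comm]

theorem inner_eq_pairing (a b : SpaceL2 𝕜) : inner 𝕜 a b = pairing (star a) b := by
  rw [pairing_eq_inner, star_star]

theorem norm_star_L2 (a : SpaceL2 𝕜) : ‖star a‖ = ‖a‖ := by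
  rw [Lp.norm_def, Lp.norm_def]
  congr 1
  refine eLpNorm_congr_norm_ae ?_
  filter_upwards [Lp.coeFn_star a] with x hx
  simp [hx]

theorem star_sub_L2 (a b : SpaceL2 𝕜) : star (a - b) = star a - star b := by
  refine Lp.ext ?_
  filter_upwards [Lp.coeFn_star (a - b), Lp.coeFn_sub a b, Lp.coeFn_sub (star a) (star b),
    Lp.coeFn_star a, Lp.coeFn_star b] with x h1 h2 h3 h4 h5
  rw [h1, h3, Pi.star_apply, h2, Pi.sub_apply, Pi.sub_apply, h4, h5, star_sub]
  rfl

theorem continuous_star_L2 : Continuous fun z : SpaceL2 𝕜 => star z :=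
  (Isometry.of_dist_eq fun a b => by
    rw [dist_eq_norm, dist_eq_norm, ← star_sub_L2, norm_star_L2]).continuous

/-- The class in `L²(0,1)` of a function (zero if the function is not square integrable). -/
def toL2 (φ : ℝ → 𝕜) : SpaceL2 𝕜 :=
  open Classical in if h : MemLp φ 2 spaceMeasure then h.toLp φ else 0

theorem memLp_space_of_continuousOn {φ : ℝ → 𝕜} (h : ContinuousOn φ (Icc 0 1)) :
    MemLp φ 2 spaceMeasure := by
  obtain ⟨C, hC⟩ := isCompact_Icc.exists_bound_of_continuousOn h
  refine MemLp.of_bound ((h.mono Ioo_subset_Icc_self).aestronglyMeasurable measurableSet_Ioo) C ?_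
  filter_upwards [ae_restrict_mem measurableSet_Ioo] with x hx
  exact hC x (Ioo_subset_Icc_self hx)

theorem toL2_ae' {φ : ℝ → 𝕜} (h : MemLp φ 2 spaceMeasure) : toL2 φ =ᵐ[spaceMeasure] φ := by
  rw [toL2, dif_pos h]
  exact h.coeFn_toLp

theorem toL2_ae {φ : ℝ → 𝕜} (h : Continuous φ) : toL2 φ =ᵐ[spaceMeasure] φ :=
  toL2_ae' (memLp_space_of_continuousOn h.continuousOn)

theorem eq_toL2 {φ : ℝ → 𝕜} (h : Continuous φ) {a : SpaceL2 𝕜} (ha : a =ᵐ[spaceMeasure] φ) :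
    a = toL2 φ := Lp.ext (ha.trans (toL2_ae h).symm)

theorem pairing_toL2 (a : SpaceL2 𝕜) {φ : ℝ → 𝕜} (h : Continuous φ) :
    pairing a (toL2 φ) = ∫ x in Ioo (0 : ℝ) 1, a x * φ x := by
  rw [pairing_apply]
  refine integral_congr_ae ?_
  filter_upwards [toL2_ae h] with x hx
  rw [hx]

theorem integrable_mul_of_continuous (a : SpaceL2 𝕜) {φ : ℝ → 𝕜} (h : Continuous φ) :
    Integrable (fun x => a x * φ x) spaceMeasure :=
  (Lp.memLp a).integrable_mul (memLp_space_of_continuousOn h.continuousOn)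

theorem toL2_add {φ ψ : ℝ → 𝕜} (h : Continuous φ) (h' : Continuous ψ) :
    toL2 (φ + ψ) = toL2 φ + toL2 ψ := by
  refine (eq_toL2 (h.add h') ?_).symm
  filter_upwards [toL2_ae h, toL2_ae h', Lp.coeFn_add (toL2 φ) (toL2 ψ)] with x h1 h2 h3
  rw [h3, Pi.add_apply, h1, h2, Pi.add_apply]

theorem toL2_smul (c : 𝕜) {φ : ℝ → 𝕜} (h : Continuous φ) :
    toL2 (c • φ) = c • toL2 φ := by
  refine (eq_toL2 (h.const_smul c) ?_).symm
  filter_upwards [toL2_ae h, Lp.coeFn_smul c (toL2 φ)] with x h1 h2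
  simp [h1, h2]

theorem star_toL2 {φ : ℝ → 𝕜} (h : Continuous φ) : star (toL2 φ) = toL2 (fun x => star (φ x)) := by
  refine eq_toL2 (continuous_star.comp h) ?_
  filter_upwards [toL2_ae h, Lp.coeFn_star (toL2 φ)] with x h1 h2
  simp [h1, h2]

theorem inner_toL2 (a : SpaceL2 𝕜) {φ : ℝ → 𝕜} (h : Continuous φ) :
    inner 𝕜 (toL2 φ) a = pairing a (toL2 (fun x => star (φ x))) := by
  rw [inner_eq_pairing, pairing_comm, star_toL2 h]

theorem inner_toL2_toL2 {φ ψ : ℝ → 𝕜} (h : Continuous φ) (h' : Continuous ψ) :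
    inner 𝕜 (toL2 φ) (toL2 ψ) = ∫ x in (0 : ℝ)..1, star (φ x) * ψ x := by
  rw [L2.inner_def, intervalIntegral.integral_of_le zero_le_one, integral_Ioc_eq_integral_Ioo]
  refine integral_congr_ae ?_
  filter_upwards [toL2_ae h, toL2_ae h'] with x h1 h2
  simp [h1, h2, mul_comm]

/-- The bilinear pairing `∫∫ a b` of `L²(0,T;L²(0,1))`. -/
def timePairing : TimeL2 T (SpaceL2 𝕜) →L[𝕜] TimeL2 T (SpaceL2 𝕜) →L[𝕜] 𝕜 :=
  (pairing (𝕜 := 𝕜)).lpPairing (timeMeasure T) 2 2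

theorem timePairing_apply (a b : TimeL2 T (SpaceL2 𝕜)) :
    timePairing a b = ∫ t in Ioo (0 : ℝ) T, pairing (a t) (b t) :=
  ContinuousLinearMap.lpPairing_eq_integral _ _ _

theorem timePairing_comm (a b : TimeL2 T (SpaceL2 𝕜)) : timePairing a b = timePairing b a := by
  simp only [timePairing_apply, fun t => pairing_comm (a t) (b t)]

theorem integrable_pairing (a b : TimeL2 T (SpaceL2 𝕜)) :
    Integrable (fun t => pairing (a t) (b t)) (timeMeasure T) := by
  have h := (pairing (𝕜 := 𝕜)).memLp_of_bilin 1 (Lp.memLp a) (Lp.memLp b)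
  exact memLp_one_iff_integrable.1 h

theorem integrable_timeL2 {E : Type*} [NormedAddCommGroup E] (a : TimeL2 T E) :
    Integrable a (timeMeasure T) :=
  (Lp.memLp a).integrable one_le_two

theorem integrable_pairing_const (a : TimeL2 T (SpaceL2 𝕜)) (b : SpaceL2 𝕜) :
    Integrable (fun t => pairing (a t) b) (timeMeasure T) := by
  have h := ((pairing (𝕜 := 𝕜)).flip b).integrable_comp (integrable_timeL2 a)
  exact h

/-- Nondegeneracy: testing with the conjugate of a produces its squared norm. -/
theorem eq_zero_of_timePairing {a : TimeL2 T (SpaceL2 𝕜)} (h : ∀ b, timePairing a b = 0) : a = 0 := by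
  have hs : MemLp (fun t => star (a t)) 2 (timeMeasure T) := by
    refine (Lp.memLp a).congr_norm ?_ (Filter.Eventually.of_forall fun t => (norm_star_L2 _).symm)
    exact continuous_star_L2.comp_aestronglyMeasurable (Lp.memLp a).1
  have h1 := h (hs.toLp _)
  rw [← inner_self_eq_zero (𝕜 := 𝕜), L2.inner_def, ← h1, timePairing_apply]
  refine integral_congr_ae ?_
  filter_upwards [hs.coeFn_toLp] with t ht
  rw [ht, pairing_comm, ← inner_eq_pairing]

end Pairing

/-! ### Continuous representatives of curves -/

section TimeCurves

variable {T : ℝ} {E : Type*} [NormedAddCommGroup E]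

theorem memLp_time_of_continuousOn {φ : ℝ → E} (h : ContinuousOn φ (Icc 0 T)) :
    MemLp φ 2 (timeMeasure T) := by
  obtain ⟨C, hC⟩ := isCompact_Icc.exists_bound_of_continuousOn h
  refine MemLp.of_bound ((h.mono Ioo_subset_Icc_self).aestronglyMeasurable measurableSet_Ioo) C ?_
  filter_upwards [ae_restrict_mem measurableSet_Ioo] with x hx
  exact hC x (Ioo_subset_Icc_self hx)

/-- Lebesgue measure charges open sets and the interval is nonempty, so equality spreads from almost
every time to the open interval and then to its closure. This is what transfers weak identities to
the times 0 and T. -/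
theorem eq_on_Icc_of_ae {X : Type*} [TopologicalSpace X] [T2Space X] (hT : 0 < T) {f g : ℝ → X}
    (hf : ContinuousOn f (Icc 0 T)) (hg : ContinuousOn g (Icc 0 T))
    (h : ∀ᵐ t ∂(timeMeasure T), f t = g t) : EqOn f g (Icc 0 T) := by
  have h1 : EqOn f g (Ioo 0 T) :=
    Measure.eqOn_open_of_ae_eq h isOpen_Ioo (hf.mono Ioo_subset_Icc_self)
      (hg.mono Ioo_subset_Icc_self)
  refine h1.of_subset_closure hf hg Ioo_subset_Icc_self ?_
  rw [closure_Ioo hT.ne]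

theorem continuousOn_timeC (hT : 0 ≤ T) (R : TimeC T E) :
    Continuous fun t => R (projIcc 0 T hT t) := R.continuous.comp continuous_projIcc

theorem IsContRep.ae_eq (hT : 0 ≤ T) {R : TimeC T E} {r : ℝ → E} (h : IsContRep R r) :
    ∀ᵐ t ∂(timeMeasure T), R (projIcc 0 T hT t) = r t := by
  filter_upwards [h] with t ⟨ht, h'⟩
  rw [projIcc_of_mem hT ht, h']

theorem IsContRep.unique (hT : 0 < T) {R S : TimeC T E} {r : ℝ → E} (hR : IsContRep R r)
    (hS : IsContRep S r) : R = S := by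
  have := eq_on_Icc_of_ae hT (continuousOn_timeC hT.le R).continuousOn
    (continuousOn_timeC hT.le S).continuousOn (by
      filter_upwards [hR.ae_eq hT.le, hS.ae_eq hT.le] with t h1 h2
      rw [h1, h2])
  ext1 t
  simpa using this t.2

theorem integrable_norm_sq (a : TimeL2 T E) :
    Integrable (fun t => ‖a t‖ ^ 2) (timeMeasure T) :=
  (memLp_two_iff_integrable_sq_norm (Lp.memLp a).1).1 (Lp.memLp a)

end TimeCurves

/-! ### Dominated convergence in L²(0,1) -/

section LpTwo

variable {𝕜 : Type*} [RCLike 𝕜]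

theorem tendsto_toL2 {φ : ℕ → ℝ → 𝕜} {ψ : ℝ → 𝕜} (hφ : ∀ n, Continuous (φ n))
    (hψ : Continuous ψ) {C : ℝ} (hC : ∀ n, ∀ x ∈ Ioo (0 : ℝ) 1, ‖φ n x‖ ≤ C)
    (h : ∀ x ∈ Ioo (0 : ℝ) 1, Filter.Tendsto (fun n => φ n x) Filter.atTop (nhds (ψ x))) :
    Filter.Tendsto (fun n => toL2 (φ n)) Filter.atTop (nhds (toL2 ψ)) := by
  have key : Filter.Tendsto (fun n => ‖toL2 (φ n) - toL2 ψ‖ ^ 2) Filter.atTop (nhds 0) := by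
    have e : ∀ n, ‖toL2 (φ n) - toL2 ψ‖ ^ 2 = ∫ x in Ioo (0 : ℝ) 1, ‖φ n x - ψ x‖ ^ 2 := fun n => by
      rw [norm_sq_Lp_two]
      refine integral_congr_ae ?_
      filter_upwards [toL2_ae (hφ n), toL2_ae hψ, Lp.coeFn_sub (toL2 (φ n)) (toL2 ψ)]
        with x h1 h2 h3
      rw [h3, Pi.sub_apply, h1, h2]
    simp_rw [e]
    have hb : ∀ x ∈ Ioo (0 : ℝ) 1, ‖ψ x‖ ≤ C := fun x hx =>
      le_of_tendsto (h x hx).norm (Filter.Eventually.of_forall fun n => hC n x hx)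
    have := tendsto_integral_of_dominated_convergence (μ := spaceMeasure)
      (F := fun n x => ‖φ n x - ψ x‖ ^ 2) (f := fun _ => (0 : ℝ)) (fun _ => (2 * C) ^ 2)
      (fun n => (((hφ n).sub hψ).norm.pow 2).aestronglyMeasurable) (integrable_const _)
      (fun n => by
        filter_upwards [ae_restrict_mem measurableSet_Ioo] with x hx
        rw [Real.norm_eq_abs, abs_of_nonneg (sq_nonneg _)]
        refine pow_le_pow_left₀ (norm_nonneg _) ?_ 2
        linarith [norm_sub_le (φ n x) (ψ x), hC n x hx, hb x hx])
      (by
        filter_upwards [ae_restrict_mem measurableSet_Ioo] with x hx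
        have := (((h x hx).sub_const (ψ x)).norm).pow 2
        simpa using this)
    simpa using this
  rw [tendsto_iff_norm_sub_tendsto_zero]
  have := key.sqrt
  simpa [Real.sqrt_sq] using this

end LpTwo

/-! ### The space H¹₀(0,1) -/

section H10

variable {𝕜 : Type*} [RCLike 𝕜]

instance : CompleteSpace (H10 𝕜) :=
  (Submodule.isClosed_topologicalClosure _).completeSpace_coe

/-- The embedding of `H¹₀(0,1)` into `L²(0,1)`. -/
def h10ValL : H10 𝕜 →L[𝕜] SpaceL2 𝕜 := (WithLp.fstL 2 𝕜 _ _).comp (H10 𝕜).subtypeL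

/-- The weak derivative as a bounded operator on `H¹₀(0,1)`. -/
def h10DerivL : H10 𝕜 →L[𝕜] SpaceL2 𝕜 := (WithLp.sndL 2 𝕜 _ _).comp (H10 𝕜).subtypeL

@[simp] theorem h10ValL_apply (w : H10 𝕜) : h10ValL w = h10Val w := rfl

@[simp] theorem h10DerivL_apply (w : H10 𝕜) : h10DerivL w = h10Deriv w := rfl

theorem norm_sq_h10 (w : H10 𝕜) : ‖w‖ ^ 2 = ‖h10Val w‖ ^ 2 + ‖h10Deriv w‖ ^ 2 :=
  WithLp.prod_norm_sq_eq_of_L2 _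

theorem norm_h10Val_le (w : H10 𝕜) : ‖h10Val w‖ ≤ ‖w‖ := by
  refine abs_le_of_sq_le_sq' ?_ (norm_nonneg _) |>.2
  rw [norm_sq_h10]
  nlinarith [sq_nonneg ‖h10Deriv w‖]

theorem norm_h10Deriv_le (w : H10 𝕜) : ‖h10Deriv w‖ ≤ ‖w‖ := by
  refine abs_le_of_sq_le_sq' ?_ (norm_nonneg _) |>.2
  rw [norm_sq_h10]
  nlinarith [sq_nonneg ‖h10Val w‖]

theorem integral_deriv_mul_of_zero {φ ζ : ℝ → 𝕜} (hφ : ContDiff ℝ ∞ φ) (hζ : ContDiff ℝ ∞ ζ)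
    (h0 : φ 0 * ζ 0 = φ 1 * ζ 1) :
    ∫ x in Ioo (0 : ℝ) 1, deriv φ x * ζ x = -∫ x in Ioo (0 : ℝ) 1, φ x * deriv ζ x := by
  have h1 : (1 : WithTop ℕ∞) ≤ ∞ := by exact_mod_cast le_top
  have := intervalIntegral.integral_mul_deriv_eq_deriv_mul (a := 0) (b := 1) (u := φ) (v := ζ)
    (fun x _ => ((hφ.differentiable (by simp)) x).hasDerivAt)
    (fun x _ => ((hζ.differentiable (by simp)) x).hasDerivAt)
    ((hφ.continuous_deriv h1).intervalIntegrable _ _)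
    ((hζ.continuous_deriv h1).intervalIntegrable _ _)
  rw [← h0, sub_self, zero_sub, intervalIntegral.integral_of_le zero_le_one,
    intervalIntegral.integral_of_le zero_le_one, integral_Ioc_eq_integral_Ioo,
    integral_Ioc_eq_integral_Ioo] at this
  rw [this, neg_neg]

/-- Both sides are continuous in w, so generators suffice. They vanish at both end points, which is
why ζ needs no boundary condition. -/
theorem pairing_h10Deriv (w : H10 𝕜) {ζ : ℝ → 𝕜} (hζ : ContDiff ℝ ∞ ζ) :
    pairing (h10Deriv w) (toL2 ζ) = -pairing (h10Val w) (toL2 (deriv ζ)) := by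
  have h1 : (1 : WithTop ℕ∞) ≤ ∞ := by exact_mod_cast le_top
  let ℓ : WithLp 2 (SpaceL2 𝕜 × SpaceL2 𝕜) →L[𝕜] 𝕜 :=
    ((pairing (𝕜 := 𝕜)).flip (toL2 ζ)).comp (WithLp.sndL 2 𝕜 _ _) +
      ((pairing (𝕜 := 𝕜)).flip (toL2 (deriv ζ))).comp (WithLp.fstL 2 𝕜 _ _)
  have hle : H10 𝕜 ≤ ℓ.ker := by
    refine Submodule.topologicalClosure_minimal _ ?_ ℓ.isClosed_ker
    rw [Submodule.span_le]
    rintro z ⟨φ, hφ, -, hs, hz1, hz2⟩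
    have e1 := eq_toL2 hφ.continuous hz1
    have e2 := eq_toL2 (hφ.continuous_deriv h1) hz2
    change pairing z.snd (toL2 ζ) + pairing z.fst (toL2 (deriv ζ)) = 0
    have z0 : φ 0 = 0 := by
      by_contra h
      exact absurd (hs (subset_tsupport _ h)).1 (lt_irrefl _)
    have z1 : φ 1 = 0 := by
      by_contra h
      exact absurd (hs (subset_tsupport _ h)).2 (lt_irrefl _)
    rw [pairing_toL2 _ hζ.continuous, pairing_toL2 _ (hζ.continuous_deriv h1)]
    have c1 : ∫ x in Ioo (0 : ℝ) 1, z.snd x * ζ x = ∫ x in Ioo (0 : ℝ) 1, deriv φ x * ζ x :=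
      integral_congr_ae (by filter_upwards [hz2] with x hx; rw [hx])
    have c2 : ∫ x in Ioo (0 : ℝ) 1, z.fst x * deriv ζ x = ∫ x in Ioo (0 : ℝ) 1, φ x * deriv ζ x :=
      integral_congr_ae (by filter_upwards [hz1] with x hx; rw [hx])
    rw [c1, c2, integral_deriv_mul_of_zero hφ hζ (by rw [z0, z1, zero_mul, zero_mul])]
    simp
  have := hle w.2
  exact eq_neg_of_add_eq_zero_left this

theorem exists_smoothTransition_deriv_bound : ∃ K : ℝ, 0 ≤ K ∧
    (∀ x, |deriv Real.smoothTransition x| ≤ K) := by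
  have hc : Continuous (deriv Real.smoothTransition) :=
    Real.smoothTransition.contDiff (n := 1).continuous_deriv le_rfl
  obtain ⟨K, hK⟩ := (isCompact_Icc (a := (0 : ℝ)) (b := 1)).exists_bound_of_continuousOn
    hc.continuousOn
  refine ⟨max K 0, le_max_right _ _, fun x => ?_⟩
  by_cases hx : x ∈ Icc (0 : ℝ) 1
  · exact (hK x hx).trans (le_max_left _ _)
  · have : deriv Real.smoothTransition x = 0 := by
      rcases not_and_or.1 hx with h | h
      · have : Real.smoothTransition =ᶠ[nhds x] fun _ => 0 := by
          filter_upwards [Iio_mem_nhds (not_le.1 h)] with y hy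
          exact Real.smoothTransition.zero_of_nonpos (le_of_lt hy)
        rw [this.deriv_eq, deriv_const]
      · have : Real.smoothTransition =ᶠ[nhds x] fun _ => 1 := by
          filter_upwards [Ioi_mem_nhds (not_le.1 h)] with y hy
          exact Real.smoothTransition.one_of_one_le (le_of_lt hy)
        rw [this.deriv_eq, deriv_const]
    rw [this, abs_zero]
    exact le_max_right _ _

theorem deriv_smoothTransition_of_one_lt {x : ℝ} (h : 1 < x) :
    deriv Real.smoothTransition x = 0 := by
  have : Real.smoothTransition =ᶠ[nhds x] fun _ => 1 := by
    filter_upwards [Ioi_mem_nhds h] with y hy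
    exact Real.smoothTransition.one_of_one_le (le_of_lt hy)
  rw [this.deriv_eq, deriv_const]

theorem norm_le_of_deriv_bound {η : ℝ → 𝕜} (hη : ContDiff ℝ ∞ η) :
    ∃ L : ℝ, 0 ≤ L ∧ ∀ x ∈ Icc (0 : ℝ) 1, ∀ y ∈ Icc (0 : ℝ) 1, ‖η x - η y‖ ≤ L * |x - y| := by
  have h1 : (1 : WithTop ℕ∞) ≤ ∞ := by exact_mod_cast le_top
  obtain ⟨K, hK⟩ := (isCompact_Icc (a := (0 : ℝ)) (b := 1)).exists_bound_of_continuousOn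
    (hη.continuous_deriv h1).continuousOn
  refine ⟨max K 0, le_max_right _ _, fun x hx y hy => ?_⟩
  have := (convex_Icc (0 : ℝ) 1).norm_image_sub_le_of_norm_deriv_le (𝕜 := ℝ) (f := η)
    (C := max K 0) (fun z _ => hη.differentiable (by simp) z)
    (fun z hz => (hK z hz).trans (le_max_left _ _)) hy hx
  simpa using this

/-- A smooth function vanishing at `0` and `1` is in `H¹₀(0,1)`. -/
theorem mem_H10_of_contDiff {η : ℝ → 𝕜} (hη : ContDiff ℝ ∞ η) (h0 : η 0 = 0) (h1' : η 1 = 0) :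
    WithLp.toLp 2 (toL2 η, toL2 (deriv η)) ∈ H10 𝕜 := by
  have h1 : (1 : WithTop ℕ∞) ≤ ∞ := by exact_mod_cast le_top
  obtain ⟨K, hK0, hK⟩ := exists_smoothTransition_deriv_bound
  obtain ⟨L, hL0, hL⟩ := norm_le_of_deriv_bound hη
  set ψ := Real.smoothTransition with hψ
  have hψc : ContDiff ℝ ∞ ψ := Real.smoothTransition.contDiff
  have hψd : ∀ x, HasDerivAt ψ (deriv ψ x) x := fun x =>
    (hψc.differentiable (by simp) x).hasDerivAt
  -- The cutoff vanishes within 1/(n+3) of either end point and equals 1 at distance at least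
  -- 2/(n+3) from both.
  let χ : ℕ → ℝ → ℝ := fun n x => ψ ((n + 3) * x - 1) * ψ ((n + 3) * (1 - x) - 1)
  let χ' : ℕ → ℝ → ℝ := fun n x => (n + 3) * deriv ψ ((n + 3) * x - 1) * ψ ((n + 3) * (1 - x) - 1)
    - ψ ((n + 3) * x - 1) * ((n + 3) * deriv ψ ((n + 3) * (1 - x) - 1))
  have hχd : ∀ n x, HasDerivAt (χ n) (χ' n x) x := fun n x => by
    have a1 : HasDerivAt (fun x : ℝ => ((n : ℝ) + 3) * x - 1) (n + 3) x := by
      simpa using ((hasDerivAt_id x).const_mul ((n : ℝ) + 3)).sub_const 1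
    have a2 : HasDerivAt (fun x : ℝ => ((n : ℝ) + 3) * (1 - x) - 1) (-(n + 3)) x := by
      simpa using ((((hasDerivAt_id x).const_sub 1).const_mul ((n : ℝ) + 3)).sub_const 1)
    have := ((hψd _).comp x a1).mul ((hψd _).comp x a2)
    refine this.congr_deriv ?_
    simp only [χ', Function.comp]
    ring
  have hχc : ∀ n, ContDiff ℝ ∞ (χ n) := fun n => by
    refine (hψc.comp ?_).mul (hψc.comp ?_) <;> fun_prop
  let η' : ℕ → ℝ → 𝕜 := fun n x => χ n x • η x
  have hη'c : ∀ n, ContDiff ℝ ∞ (η' n) := fun n => (hχc n).smul hη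
  have hη'd : ∀ n x, deriv (η' n) x = χ n x • deriv η x + χ' n x • η x := fun n x =>
    ((hχd n x).smul (hη.differentiable (by simp) x).hasDerivAt).deriv
  have hψ01 : ∀ x, |ψ x| ≤ 1 := fun x => by
    rw [abs_of_nonneg (Real.smoothTransition.nonneg x)]; exact Real.smoothTransition.le_one x
  have hχ1 : ∀ n x, |χ n x| ≤ 1 := fun n x => by
    simp only [χ, abs_mul]
    exact mul_le_one₀ (hψ01 _) (abs_nonneg _) (hψ01 _)
  have hd0 : ∀ y, 1 < y → deriv ψ y = 0 := fun y => deriv_smoothTransition_of_one_lt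
  have ev : ∀ x ∈ Ioo (0 : ℝ) 1, ∀ᶠ n : ℕ in Filter.atTop,
      1 < ((n : ℝ) + 3) * x - 1 ∧ 1 < ((n : ℝ) + 3) * (1 - x) - 1 := fun x hx => by
    have e1 : ∀ y : ℝ, 0 < y → ∀ᶠ n : ℕ in Filter.atTop, 1 < ((n : ℝ) + 3) * y - 1 := fun y hy => by
      obtain ⟨N, hN⟩ := exists_nat_gt (2 / y)
      filter_upwards [Filter.eventually_ge_atTop N] with n hn
      have : (N : ℝ) ≤ n := by exact_mod_cast hn
      rw [div_lt_iff₀ hy] at hN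
      nlinarith
    exact (e1 x hx.1).and (e1 (1 - x) (by linarith [hx.2]))
  have evχ : ∀ x ∈ Ioo (0 : ℝ) 1, ∀ᶠ n : ℕ in Filter.atTop, χ n x = 1 ∧ χ' n x = 0 := fun x hx => by
    filter_upwards [ev x hx] with n hn
    simp only [χ, χ', hd0 _ hn.1, hd0 _ hn.2]
    rw [hψ, Real.smoothTransition.one_of_one_le hn.1.le,
      Real.smoothTransition.one_of_one_le hn.2.le]
    norm_num
  obtain ⟨B, hB⟩ := (isCompact_Icc (a := (0 : ℝ)) (b := 1)).exists_bound_of_continuousOn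
    hη.continuous.continuousOn
  obtain ⟨B', hB'⟩ := (isCompact_Icc (a := (0 : ℝ)) (b := 1)).exists_bound_of_continuousOn
    (hη.continuous_deriv h1).continuousOn
  -- The derivative of the cutoff is of order n, but it lives where the distance y to the end point
  -- is at most 2/(n+3), and there η is at most L y. The product is therefore bounded uniformly in
  -- n, which allows dominated convergence.
  have bnd : ∀ (n : ℕ) (y : ℝ) (z : 𝕜), 0 ≤ y → ‖z‖ ≤ L * y →
      ‖(((n : ℝ) + 3) * deriv ψ (((n : ℝ) + 3) * y - 1)) • z‖ ≤ 2 * K * L := fun n y z hy hz => by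
    have hn : (0 : ℝ) < n + 3 := by positivity
    rw [norm_smul, Real.norm_eq_abs, abs_mul, abs_of_pos hn]
    by_cases hy1 : 1 < ((n : ℝ) + 3) * y - 1
    · rw [hd0 _ hy1]; simp; positivity
    · calc (n + 3) * |deriv ψ ((n + 3) * y - 1)| * ‖z‖ ≤ (n + 3) * K * (L * y) := by
            gcongr; exact hK _
        _ = K * L * ((n + 3) * y) := by ring
        _ ≤ K * L * 2 := by
            gcongr; linarith
        _ = 2 * K * L := by ring
  have bχ' : ∀ n, ∀ x ∈ Ioo (0 : ℝ) 1, ‖χ' n x • η x‖ ≤ 2 * K * L + 2 * K * L := fun n x hx => by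
    have hx' := Ioo_subset_Icc_self hx
    have l0 : ‖η x‖ ≤ L * x := by
      have := hL x hx' 0 (by simp)
      rwa [h0, sub_zero, sub_zero, abs_of_pos hx.1] at this
    have l1 : ‖η x‖ ≤ L * (1 - x) := by
      have := hL x hx' 1 (by simp)
      rwa [h1', sub_zero, abs_sub_comm, abs_of_pos (by linarith [hx.2] : (0 : ℝ) < 1 - x)] at this
    simp only [χ', sub_smul]
    refine (norm_sub_le _ _).trans (add_le_add ?_ ?_)
    · rw [mul_comm, mul_smul, norm_smul]
      exact (mul_le_of_le_one_left (norm_nonneg _) (hψ01 _)).trans (bnd n x _ hx.1.le l0)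
    · rw [mul_smul, norm_smul]
      exact (mul_le_of_le_one_left (norm_nonneg _) (hψ01 _)).trans
        (bnd n (1 - x) _ (by linarith [hx.2]) l1)
  have t1 : Filter.Tendsto (fun n => toL2 (η' n)) Filter.atTop (nhds (toL2 η)) := by
    refine tendsto_toL2 (fun n => (hη'c n).continuous) hη.continuous (C := B) (fun n x hx => ?_)
      fun x hx => ?_
    · simp only [η', norm_smul]
      exact (mul_le_of_le_one_left (norm_nonneg _) (hχ1 _ _)).trans (hB x (Ioo_subset_Icc_self hx))
    · refine tendsto_const_nhds.congr' ?_
      filter_upwards [evχ x hx] with n hn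
      simp [η', hn.1]
  have t2 : Filter.Tendsto (fun n => toL2 (deriv (η' n))) Filter.atTop (nhds (toL2 (deriv η))) := by
    refine tendsto_toL2 (fun n => (hη'c n).continuous_deriv h1) (hη.continuous_deriv h1)
      (C := B' + (2 * K * L + 2 * K * L)) (fun n x hx => ?_) fun x hx => ?_
    · rw [hη'd]
      refine (norm_add_le _ _).trans (add_le_add ?_ (bχ' n x hx))
      rw [norm_smul]
      exact (mul_le_of_le_one_left (norm_nonneg _) (hχ1 _ _)).trans (hB' x (Ioo_subset_Icc_self hx))
    · refine tendsto_const_nhds.congr' ?_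
      filter_upwards [evχ x hx] with n hn
      rw [hη'd, hn.1, hn.2]
      simp
  have t3 : Filter.Tendsto (fun n => WithLp.toLp 2 (toL2 (η' n), toL2 (deriv (η' n))))
      Filter.atTop (nhds (WithLp.toLp 2 (toL2 η, toL2 (deriv η)))) :=
    ((WithLp.prod_continuous_toLp 2 _ _).tendsto _).comp (t1.prodMk_nhds t2)
  refine mem_closure_of_tendsto t3 (Filter.Eventually.of_forall fun n => Submodule.subset_span ?_)
  have hsub : tsupport (η' n) ⊆ Icc ((1 : ℝ) / (n + 3)) (1 - 1 / (n + 3)) := by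
    refine closure_minimal (fun x hx => ?_) isClosed_Icc
    have hn : (0 : ℝ) < n + 3 := by positivity
    have hx' : χ n x ≠ 0 := fun h => hx (by simp [η', h])
    have c1 : 0 < ((n : ℝ) + 3) * x - 1 := by
      by_contra h
      exact hx' (by simp only [χ, hψ, Real.smoothTransition.zero_of_nonpos (not_lt.1 h), zero_mul])
    have c2 : 0 < ((n : ℝ) + 3) * (1 - x) - 1 := by
      by_contra h
      exact hx' (by simp only [χ, hψ, Real.smoothTransition.zero_of_nonpos (not_lt.1 h), mul_zero])
    constructor
    · rw [div_le_iff₀ hn]; linarith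
    · have : 1 / ((n : ℝ) + 3) ≤ 1 - x := by rw [div_le_iff₀ hn]; linarith
      linarith
  have hn : (0 : ℝ) < 1 / (n + 3) := by positivity
  refine ⟨η' n, hη'c n, isCompact_Icc.of_isClosed_subset (isClosed_tsupport _) hsub,
    hsub.trans fun x hx => ⟨hn.trans_le hx.1, by linarith [hx.2]⟩, ?_, ?_⟩
  · exact toL2_ae (hη'c n).continuous
  · exact toL2_ae ((hη'c n).continuous_deriv h1)

end H10

/-! ### Trigonometric systems and their orthonormality -/

section TrigIntegrals

theorem integral_cos_int_mul_pi (m : ℤ) :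
    ∫ x in (0 : ℝ)..1, Real.cos (m * Real.pi * x) = if m = 0 then 1 else 0 := by
  split_ifs with h
  · simp [h]
  · have hc : (m : ℝ) * Real.pi ≠ 0 := mul_ne_zero (by exact_mod_cast h) Real.pi_ne_zero
    rw [intervalIntegral.integral_comp_mul_left (fun x => Real.cos x) hc, integral_cos]
    simp [Real.sin_int_mul_pi]

theorem integral_sin_int_mul_two_pi (m : ℤ) :
    ∫ x in (0 : ℝ)..1, Real.sin (m * (2 * Real.pi) * x) = 0 := by
  by_cases h : m = 0
  · simp [h]
  · have hc : (m : ℝ) * (2 * Real.pi) ≠ 0 :=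
      mul_ne_zero (by exact_mod_cast h) (by positivity)
    rw [intervalIntegral.integral_comp_mul_left (fun x => Real.sin x) hc, integral_sin]
    simp [Real.cos_int_mul_two_pi]

/-- The Hartley function `cos (2πkx) + sin (2πkx)`. -/
def hartley (k : ℤ) (x : ℝ) : ℝ :=
  Real.cos (k * (2 * Real.pi) * x) + Real.sin (k * (2 * Real.pi) * x)

/-- The Dirichlet eigenfunctions `√2 sin ((j+1)πx)`. -/
def sineFn (j : ℕ) (x : ℝ) : ℝ := √2 * Real.sin ((j + 1) * Real.pi * x)

/-- The Neumann eigenfunctions `1` and `√2 cos (jπx)`. -/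
def cosineFn (j : ℕ) (x : ℝ) : ℝ := (if j = 0 then 1 else √2) * Real.cos (j * Real.pi * x)

theorem contDiff_hartley (k : ℤ) : ContDiff ℝ ∞ (hartley k) := by
  unfold hartley; fun_prop

theorem contDiff_sineFn (j : ℕ) : ContDiff ℝ ∞ (sineFn j) := by
  unfold sineFn; fun_prop

theorem contDiff_cosineFn (j : ℕ) : ContDiff ℝ ∞ (cosineFn j) := by
  unfold cosineFn; fun_prop

/-- Differentiation exchanges the indices k and -k with opposite coefficients. This antisymmetry
within a real system is the reason for using Hartley functions. -/
theorem hasDerivAt_hartley (k : ℤ) (x : ℝ) :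
    HasDerivAt (hartley k) (2 * Real.pi * k * hartley (-k) x) x := by
  have h : HasDerivAt (fun x : ℝ => (k : ℝ) * (2 * Real.pi) * x) (k * (2 * Real.pi)) x := by
    simpa using (hasDerivAt_id x).const_mul ((k : ℝ) * (2 * Real.pi))
  refine (h.cos.add h.sin).congr_deriv ?_
  simp only [hartley, Int.cast_neg, neg_mul, Real.cos_neg, Real.sin_neg]
  ring

theorem hasDerivAt_sineFn (j : ℕ) (x : ℝ) :
    HasDerivAt (sineFn j) ((j + 1) * Real.pi * cosineFn (j + 1) x) x := by
  have h : HasDerivAt (fun x : ℝ => ((j : ℝ) + 1) * Real.pi * x) ((j + 1) * Real.pi) x := by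
    simpa using (hasDerivAt_id x).const_mul (((j : ℝ) + 1) * Real.pi)
  refine (h.sin.const_mul √2).congr_deriv ?_
  simp only [cosineFn, Nat.succ_ne_zero, if_false, Nat.cast_add, Nat.cast_one]
  ring

theorem hasDerivAt_cosineFn (j : ℕ) (x : ℝ) :
    HasDerivAt (cosineFn (j + 1)) (-((j + 1) * Real.pi) * sineFn j x) x := by
  have h : HasDerivAt (fun x : ℝ => ((j : ℝ) + 1) * Real.pi * x) ((j + 1) * Real.pi) x := by
    simpa using (hasDerivAt_id x).const_mul (((j : ℝ) + 1) * Real.pi)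
  have h2 := h.cos.const_mul √2
  have e : cosineFn (j + 1) = fun x => √2 * Real.cos (((j : ℝ) + 1) * Real.pi * x) := by
    ext x; simp [cosineFn]
  rw [e]
  refine h2.congr_deriv ?_
  simp only [sineFn]
  ring

theorem hartley_zero_eq_one (k : ℤ) : hartley k 0 = hartley k 1 := by
  have h : Real.sin (k * (2 * Real.pi)) = 0 := by
    have := Real.sin_int_mul_pi (k * 2)
    push_cast at this
    rwa [mul_assoc] at this
  simp [hartley, Real.cos_int_mul_two_pi, h]

theorem sineFn_zero (j : ℕ) : sineFn j 0 = 0 := by simp [sineFn]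

theorem sineFn_one (j : ℕ) : sineFn j 1 = 0 := by
  have := Real.sin_nat_mul_pi (j + 1)
  push_cast at this
  simp [sineFn, this]

/-- The product equals cos 2π(k-l)x + sin 2π(k+l)x, and the sine has mean zero for all k and l,
including l = -k. -/
theorem integral_hartley_mul (k l : ℤ) :
    ∫ x in (0 : ℝ)..1, hartley k x * hartley l x = if k = l then 1 else 0 := by
  have e : ∀ x, hartley k x * hartley l x = Real.cos (((2 * (k - l) : ℤ) : ℝ) * Real.pi * x) +
      Real.sin (((k + l : ℤ) : ℝ) * (2 * Real.pi) * x) := fun x => by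
    have h1 : ((2 * (k - l) : ℤ) : ℝ) * Real.pi * x =
        k * (2 * Real.pi) * x - l * (2 * Real.pi) * x := by push_cast; ring
    have h2 : ((k + l : ℤ) : ℝ) * (2 * Real.pi) * x =
        k * (2 * Real.pi) * x + l * (2 * Real.pi) * x := by push_cast; ring
    rw [h1, h2, Real.cos_sub, Real.sin_add, hartley, hartley]
    ring
  simp_rw [e]
  rw [intervalIntegral.integral_add (by apply Continuous.intervalIntegrable; fun_prop)
    (by apply Continuous.intervalIntegrable; fun_prop), integral_cos_int_mul_pi,
    integral_sin_int_mul_two_pi, add_zero]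
  congr 1
  simp [sub_eq_zero]

theorem integral_sineFn_mul (i j : ℕ) :
    ∫ x in (0 : ℝ)..1, sineFn i x * sineFn j x = if i = j then 1 else 0 := by
  have e : ∀ x, sineFn i x * sineFn j x = Real.cos ((((i : ℤ) - j : ℤ) : ℝ) * Real.pi * x) -
      Real.cos ((((i : ℤ) + j + 2 : ℤ) : ℝ) * Real.pi * x) := fun x => by
    have h1 : (((i : ℤ) - j : ℤ) : ℝ) * Real.pi * x =
        (i + 1) * Real.pi * x - (j + 1) * Real.pi * x := by push_cast; ring
    have h2 : (((i : ℤ) + j + 2 : ℤ) : ℝ) * Real.pi * x =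
        (i + 1) * Real.pi * x + (j + 1) * Real.pi * x := by push_cast; ring
    rw [h1, h2, Real.cos_sub, Real.cos_add, sineFn, sineFn]
    have h3 : √(2 : ℝ) * √2 = 2 := Real.mul_self_sqrt (by norm_num)
    linear_combination (Real.sin ((i + 1) * Real.pi * x) * Real.sin ((j + 1) * Real.pi * x)) * h3
  simp_rw [e]
  rw [intervalIntegral.integral_sub (by apply Continuous.intervalIntegrable; fun_prop)
    (by apply Continuous.intervalIntegrable; fun_prop), integral_cos_int_mul_pi,
    integral_cos_int_mul_pi, if_neg (by omega : ¬((i : ℤ) + j + 2 = 0)), sub_zero]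
  congr 1
  simp [sub_eq_zero]

theorem integral_cosineFn_mul (i j : ℕ) :
    ∫ x in (0 : ℝ)..1, cosineFn i x * cosineFn j x = if i = j then 1 else 0 := by
  have e : ∀ x, cosineFn i x * cosineFn j x =
      ((if i = 0 then 1 else √2) * (if j = 0 then 1 else √2) / 2) *
      (Real.cos ((((i : ℤ) - j : ℤ) : ℝ) * Real.pi * x) +
      Real.cos ((((i : ℤ) + j : ℤ) : ℝ) * Real.pi * x)) := fun x => by
    have h1 : (((i : ℤ) - j : ℤ) : ℝ) * Real.pi * x =
        i * Real.pi * x - j * Real.pi * x := by push_cast; ring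
    have h2 : (((i : ℤ) + j : ℤ) : ℝ) * Real.pi * x =
        i * Real.pi * x + j * Real.pi * x := by push_cast; ring
    rw [h1, h2, Real.cos_sub, Real.cos_add, cosineFn, cosineFn]
    ring
  simp_rw [e]
  rw [intervalIntegral.integral_const_mul, intervalIntegral.integral_add
    (by apply Continuous.intervalIntegrable; fun_prop)
    (by apply Continuous.intervalIntegrable; fun_prop), integral_cos_int_mul_pi,
    integral_cos_int_mul_pi]
  have h3 : √(2 : ℝ) * √2 = 2 := Real.mul_self_sqrt (by norm_num)
  rcases Nat.eq_zero_or_pos i with rfl | hi <;> rcases Nat.eq_zero_or_pos j with rfl | hj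
  · norm_num
  · simp [hj.ne', hj.ne]
  · simp [hi.ne']
  · rw [if_neg hi.ne', if_neg hj.ne', if_neg (by omega : ¬((i : ℤ) + j = 0)), h3]
    simp [sub_eq_zero]

end TrigIntegrals

/-! ### Completeness of the trigonometric systems -/

section Completeness

/-- The complex Fourier coefficients of f are combinations of the given integrals, hence zero, and
Parseval's identity makes the L² norm vanish. -/
theorem ae_zero_of_fourier {a b : ℝ} (hab : a < b) {f : ℝ → ℝ}
    (hf : MemLp f 2 (volume.restrict (Ioc a b)))
    (hc : ∀ n : ℤ, ∫ x in a..b, f x * Real.cos (2 * Real.pi * n * x / (b - a)) = 0)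
    (hs : ∀ n : ℤ, ∫ x in a..b, f x * Real.sin (2 * Real.pi * n * x / (b - a)) = 0) :
    f =ᵐ[volume.restrict (Ioc a b)] 0 := by
  have hf1 : IntervalIntegrable f volume a b :=
    (intervalIntegrable_iff_integrableOn_Ioc_of_le hab.le).2 (hf.integrable one_le_two)
  have hF : MemLp (fun x => (f x : ℂ)) 2 (volume.restrict (Ioc a b)) := hf.ofReal
  have hint : ∀ φ : ℝ → ℝ, Continuous φ →
      IntervalIntegrable (fun x => ((f x * φ x : ℝ) : ℂ)) volume a b := fun φ hφ =>
    (intervalIntegrable_iff_integrableOn_Ioc_of_le hab.le).2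
      (((intervalIntegrable_iff_integrableOn_Ioc_of_le hab.le).1
        (hf1.mul_continuousOn hφ.continuousOn)).ofReal)
  have h0 : ∀ n, fourierCoeffOn hab (fun x => (f x : ℂ)) n = 0 := fun n => by
    rw [fourierCoeffOn_eq_integral]
    have e : ∀ x : ℝ, fourier (-n) (x : AddCircle (b - a)) • (f x : ℂ) =
        ((f x * Real.cos (2 * Real.pi * n * x / (b - a)) : ℝ) : ℂ) -
        Complex.I * ((f x * Real.sin (2 * Real.pi * n * x / (b - a)) : ℝ) : ℂ) := fun x => by
      rw [fourier_coe_apply]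
      have : 2 * (Real.pi : ℂ) * Complex.I * ((-n : ℤ) : ℂ) * x / ((b - a : ℝ) : ℂ) =
          ((-(2 * Real.pi * n * x / (b - a)) : ℝ) : ℂ) * Complex.I := by
        push_cast; ring
      rw [this, Complex.exp_mul_I, ← Complex.ofReal_cos, ← Complex.ofReal_sin, Real.cos_neg,
        Real.sin_neg, smul_eq_mul]
      push_cast
      ring
    simp_rw [e]
    rw [intervalIntegral.integral_sub, intervalIntegral.integral_const_mul,
      intervalIntegral.integral_ofReal, intervalIntegral.integral_ofReal, hc, hs]
    · simp
    · exact hint _ (by fun_prop)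
    · exact (hint _ (by fun_prop)).const_mul _
  have h := hasSum_sq_fourierCoeffOn hab hF
  simp_rw [h0] at h
  have h2 := h.unique (by simp [hasSum_zero] : HasSum _ (0 : ℝ))
  have h3 : ∫ x in Ioc a b, ‖(f x : ℂ)‖ ^ 2 = 0 := by
    rw [← intervalIntegral.integral_of_le hab.le]
    have hba : (b - a)⁻¹ ≠ 0 := inv_ne_zero (by linarith)
    simpa [hba] using h2
  rw [integral_eq_zero_iff_of_nonneg (fun x => sq_nonneg _)
    ((memLp_two_iff_integrable_sq_norm hF.1).1 hF)] at h3
  filter_upwards [h3] with x hx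
  simpa using hx

theorem memLp_Ioc_of_Ioo {f : ℝ → ℝ} {a b : ℝ} (hf : MemLp f 2 (volume.restrict (Ioo a b))) :
    MemLp f 2 (volume.restrict (Ioc a b)) := by
  rwa [Measure.restrict_congr_set Ioo_ae_eq_Ioc] at hf

/-- Half the sum and half the difference of the conditions at k and -k are the cosine and sine
conditions, which reduces the claim to Fourier series of period 1. -/
theorem ae_zero_of_hartley {f : ℝ → ℝ} (hf : MemLp f 2 spaceMeasure)
    (h : ∀ k : ℤ, ∫ x in Ioo (0 : ℝ) 1, f x * hartley k x = 0) : f =ᵐ[spaceMeasure] 0 := by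
  have hf1 : Integrable f spaceMeasure := hf.integrable one_le_two
  have hf2 : IntervalIntegrable f volume 0 1 :=
    (intervalIntegrable_iff_integrableOn_Ioo_of_le zero_le_one).2 hf1
  have hk : ∀ k : ℤ, (∫ x in (0 : ℝ)..1, f x * Real.cos (k * (2 * Real.pi) * x)) +
      ∫ x in (0 : ℝ)..1, f x * Real.sin (k * (2 * Real.pi) * x) = 0 := fun k => by
    have h1 := h k
    rw [← integral_Ioc_eq_integral_Ioo, ← intervalIntegral.integral_of_le zero_le_one] at h1
    refine Eq.trans ?_ h1
    rw [← intervalIntegral.integral_add (hf2.mul_continuousOn (by fun_prop))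
        (hf2.mul_continuousOn (by fun_prop))]
    exact intervalIntegral.integral_congr fun x _ => by simp only [hartley]; ring
  have hk' : ∀ k : ℤ, (∫ x in (0 : ℝ)..1, f x * Real.cos (k * (2 * Real.pi) * x)) -
      ∫ x in (0 : ℝ)..1, f x * Real.sin (k * (2 * Real.pi) * x) = 0 := fun k => by
    have := hk (-k)
    simpa [neg_mul, sub_eq_add_neg] using this
  have hres := ae_zero_of_fourier zero_lt_one (memLp_Ioc_of_Ioo hf)
    (fun n => by
      have : ∀ x : ℝ, 2 * Real.pi * n * x / (1 - 0) = n * (2 * Real.pi) * x := fun x => by ring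
      simp_rw [this]
      linarith [hk n, hk' n])
    (fun n => by
      have : ∀ x : ℝ, 2 * Real.pi * n * x / (1 - 0) = n * (2 * Real.pi) * x := fun x => by ring
      simp_rw [this]
      linarith [hk n, hk' n])
  rwa [Measure.restrict_congr_set (Ioo_ae_eq_Ioc (a := (0 : ℝ)) (b := 1)).symm] at hres

/-- The even extension of f to (-1,1) has vanishing cosine coefficients by hypothesis and vanishing
sine coefficients by parity. Fourier series of period 2 then apply. -/
theorem ae_zero_of_cosine {f : ℝ → ℝ} (hf : MemLp f 2 spaceMeasure)
    (h : ∀ j : ℕ, ∫ x in Ioo (0 : ℝ) 1, f x * cosineFn j x = 0) : f =ᵐ[spaceMeasure] 0 := by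
  have hc : ∀ j : ℕ, ∫ x in (0 : ℝ)..1, f x * Real.cos (j * Real.pi * x) = 0 := fun j => by
    have h1 := h j
    have e : ∀ x, f x * cosineFn j x =
        (if j = 0 then 1 else √2) * (f x * Real.cos (j * Real.pi * x)) := fun x => by
      simp only [cosineFn]; ring
    simp_rw [e] at h1
    rw [integral_const_mul] at h1
    rw [intervalIntegral.integral_of_le zero_le_one, integral_Ioc_eq_integral_Ioo]
    refine (mul_eq_zero.1 h1).resolve_left ?_
    split_ifs <;> simp
  have hc' : ∀ n : ℤ, ∫ x in (0 : ℝ)..1, f x * Real.cos (n * Real.pi * x) = 0 := fun n => by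
    obtain ⟨j, rfl | rfl⟩ := n.eq_nat_or_neg
    · simpa using hc j
    · simpa using hc j
  let g : ℝ → ℝ := fun x => f |x|
  have hg : MemLp g 2 (volume.restrict (Ioc (-1) 1)) := by
    have h1 : MemLp g 2 (volume.restrict (Ioo 0 1)) := by
      refine hf.ae_eq ?_
      filter_upwards [ae_restrict_mem measurableSet_Ioo] with x hx
      simp [g, abs_of_pos hx.1]
    have h2 : MemLp g 2 (volume.restrict (Ioo (-1) 0)) := by
      have mp : MeasurePreserving (fun x : ℝ => -x) (volume.restrict (Ioo (-1) 0))
          (volume.restrict (Ioo 0 1)) := by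
        have := (Measure.measurePreserving_neg (volume : Measure ℝ)).restrict_preimage
          (measurableSet_Ioo (a := (0 : ℝ)) (b := 1))
        simpa using this
      refine (hf.comp_measurePreserving mp).ae_eq ?_
      filter_upwards [ae_restrict_mem measurableSet_Ioo] with x hx
      simp [g, abs_of_neg hx.2]
    have e : Ioc (-1 : ℝ) 1 =ᵐ[volume] (Ioo (-1 : ℝ) 0 ∪ Ioo 0 1 : Set ℝ) := by
      rw [← Ioc_union_Ioc_eq_Ioc (by norm_num : (-1 : ℝ) ≤ 0) (by norm_num : (0 : ℝ) ≤ 1)]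
      exact Ioo_ae_eq_Ioc.symm.union Ioo_ae_eq_Ioc.symm
    rw [Measure.restrict_congr_set e,
      memLp_two_iff_integrable_sq_norm (aestronglyMeasurable_union_iff.2 ⟨h2.1, h1.1⟩)]
    exact IntegrableOn.union ((memLp_two_iff_integrable_sq_norm h2.1).1 h2)
      ((memLp_two_iff_integrable_sq_norm h1.1).1 h1)
  have hg1 : Integrable g (volume.restrict (Ioc (-1) 1)) := hg.integrable one_le_two
  have hgi : ∀ a b : ℝ, -1 ≤ a → a ≤ b → b ≤ 1 → IntervalIntegrable g volume a b :=
    fun a b h1 h2 h3 => (intervalIntegrable_iff_integrableOn_Ioc_of_le h2).2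
      (IntegrableOn.mono_set hg1 (Ioc_subset_Ioc h1 h3))
  have half : ∀ φ : ℝ → ℝ, ∫ x in (0 : ℝ)..1, g x * φ x = ∫ x in (0 : ℝ)..1, f x * φ x :=
    fun φ => intervalIntegral.integral_congr fun x hx => by
      rw [uIcc_of_le zero_le_one] at hx
      simp [g, abs_of_nonneg hx.1]
  have half' : ∀ φ : ℝ → ℝ, ∫ x in (-1 : ℝ)..0, g x * φ x = ∫ x in (0 : ℝ)..1, f x * φ (-x) :=
    fun φ => by
      have h2 := intervalIntegral.integral_comp_neg (a := 0) (b := 1) (fun x => g x * φ x)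
      rw [neg_zero] at h2
      rw [← h2, ← half]
      simp [g]
  have hres := ae_zero_of_fourier (by norm_num : (-1 : ℝ) < 1) hg
    (fun n => by
      rw [← intervalIntegral.integral_add_adjacent_intervals (b := 0)
        ((hgi _ _ (by norm_num) (by norm_num) (by norm_num)).mul_continuousOn (by fun_prop))
        ((hgi _ _ (by norm_num) (by norm_num) (by norm_num)).mul_continuousOn (by fun_prop)),
        half', half]
      have e : ∀ x : ℝ, Real.cos (2 * Real.pi * n * -x / (1 - -1)) =
          Real.cos (n * Real.pi * x) := fun x => by
        rw [← Real.cos_neg]; congr 1; ring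
      have e' : ∀ x : ℝ, Real.cos (2 * Real.pi * n * x / (1 - -1)) =
          Real.cos (n * Real.pi * x) := fun x => by
        congr 1; ring
      simp_rw [e, e', hc', add_zero])
    (fun n => by
      rw [← intervalIntegral.integral_add_adjacent_intervals (b := 0)
        ((hgi _ _ (by norm_num) (by norm_num) (by norm_num)).mul_continuousOn (by fun_prop))
        ((hgi _ _ (by norm_num) (by norm_num) (by norm_num)).mul_continuousOn (by fun_prop)),
        half', half]
      have e : ∀ x : ℝ, Real.sin (2 * Real.pi * n * -x / (1 - -1)) =
          -Real.sin (2 * Real.pi * n * x / (1 - -1)) := fun x => by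
        rw [← Real.sin_neg]; congr 1; ring
      simp_rw [e, mul_neg]
      rw [intervalIntegral.integral_neg, neg_add_cancel])
  have hres2 := ae_restrict_of_ae_restrict_of_subset
    (t := Ioc (-1 : ℝ) 1) (s := Ioo (0 : ℝ) 1)
    (fun x hx => ⟨by linarith [hx.1], hx.2.le⟩) hres
  filter_upwards [hres2, ae_restrict_mem measurableSet_Ioo] with x hx hx'
  simpa [g, abs_of_pos hx'.1] using hx

/-- Since 2 sin(πx) cos(jπx) = sin((j+1)πx) - sin((j-1)πx), the function f(x) sin(πx) is orthogonal
to all cosines and so vanishes; sin(πx) is positive inside the interval. For j = 0 the frequency -1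
occurs, hence the integer version `hs'`. -/
theorem ae_zero_of_sine {f : ℝ → ℝ} (hf : MemLp f 2 spaceMeasure)
    (h : ∀ j : ℕ, ∫ x in Ioo (0 : ℝ) 1, f x * sineFn j x = 0) : f =ᵐ[spaceMeasure] 0 := by
  have hf1 : Integrable f spaceMeasure := hf.integrable one_le_two
  have hint : ∀ c : ℝ, Integrable (fun x => f x * Real.sin (c * x)) spaceMeasure := fun c => by
    refine hf1.mul_bdd (c := 1) (by fun_prop) (Filter.Eventually.of_forall fun x => ?_)
    simpa using Real.abs_sin_le_one _
  have hs : ∀ j : ℕ, ∫ x in Ioo (0 : ℝ) 1, f x * Real.sin (j * Real.pi * x) = 0 := fun j => by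
    rcases j with _ | j
    · simp
    · have h1 := h j
      have e : ∀ x, f x * sineFn j x =
          √2 * (f x * Real.sin ((j + 1) * Real.pi * x)) := fun x => by
        simp only [sineFn]; ring
      simp_rw [e] at h1
      rw [integral_const_mul] at h1
      push_cast
      exact (mul_eq_zero.1 h1).resolve_left (by simp)
  have hs' : ∀ n : ℤ, ∫ x in Ioo (0 : ℝ) 1, f x * Real.sin (n * Real.pi * x) = 0 := fun n => by
    obtain ⟨j, rfl | rfl⟩ := n.eq_nat_or_neg
    · simpa using hs j
    · have : ∀ x : ℝ, f x * Real.sin (((-(j : ℤ) : ℤ) : ℝ) * Real.pi * x) =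
          -(f x * Real.sin (j * Real.pi * x)) := fun x => by
        push_cast
        rw [neg_mul, neg_mul, Real.sin_neg, mul_neg]
      simp_rw [this]
      rw [integral_neg, hs, neg_zero]
  have hg : MemLp (fun x => f x * Real.sin (Real.pi * x)) 2 spaceMeasure := by
    refine hf.mono (hf.1.mul (by fun_prop)) (Filter.Eventually.of_forall fun x => ?_)
    rw [norm_mul]
    exact mul_le_of_le_one_right (norm_nonneg _) (by simpa using Real.abs_sin_le_one _)
  have hres := ae_zero_of_cosine hg (fun j => by
    have e : ∀ x, f x * Real.sin (Real.pi * x) * cosineFn j x = (if j = 0 then 1 else √2) / 2 *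
        (f x * Real.sin (((j + 1 : ℤ) : ℝ) * Real.pi * x) -
          f x * Real.sin (((j - 1 : ℤ) : ℝ) * Real.pi * x)) := fun x => by
      have h1 : ((j + 1 : ℤ) : ℝ) * Real.pi * x = j * Real.pi * x + Real.pi * x := by
        push_cast; ring
      have h2 : ((j - 1 : ℤ) : ℝ) * Real.pi * x = j * Real.pi * x - Real.pi * x := by
        push_cast; ring
      rw [h1, h2, Real.sin_add, Real.sin_sub, cosineFn]
      ring
    simp_rw [e]
    rw [integral_const_mul, integral_sub (hint _) (hint _), hs', hs', sub_zero, mul_zero])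
  filter_upwards [hres, ae_restrict_mem measurableSet_Ioo] with x hx hx'
  refine (mul_eq_zero.1 hx).resolve_right (Real.sin_pos_of_pos_of_lt_pi ?_ ?_).ne'
  · exact mul_pos Real.pi_pos hx'.1
  · nlinarith [hx'.2, Real.pi_pos]

end Completeness

/-! ### Hilbert bases of real functions -/

section Bases

variable {𝕜 : Type*} [RCLike 𝕜]

/-- The class in `L²(0,1)` of a real function. -/
def realL2 (𝕜 : Type*) [RCLike 𝕜] (c : ℝ → ℝ) : SpaceL2 𝕜 := toL2 fun x => (c x : 𝕜)

theorem continuous_ofReal_comp {c : ℝ → ℝ} (hc : Continuous c) :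
    Continuous fun x => (c x : 𝕜) := RCLike.continuous_ofReal.comp hc

theorem pairing_realL2 (a : SpaceL2 𝕜) {c : ℝ → ℝ} (hc : Continuous c) :
    pairing a (realL2 𝕜 c) = ∫ x in Ioo (0 : ℝ) 1, a x * (c x : 𝕜) :=
  pairing_toL2 a (continuous_ofReal_comp hc)

theorem inner_realL2 (a : SpaceL2 𝕜) {c : ℝ → ℝ} (hc : Continuous c) :
    inner 𝕜 (realL2 𝕜 c) a = pairing a (realL2 𝕜 c) := by
  rw [realL2, inner_toL2 _ (continuous_ofReal_comp hc)]
  simp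

theorem inner_realL2_realL2 {c d : ℝ → ℝ} (hc : Continuous c) (hd : Continuous d) :
    inner 𝕜 (realL2 𝕜 c) (realL2 𝕜 d) = ((∫ x in (0 : ℝ)..1, c x * d x : ℝ) : 𝕜) := by
  rw [realL2, realL2, inner_toL2_toL2 (continuous_ofReal_comp hc)
    (continuous_ofReal_comp hd), intervalIntegral.integral_of_le zero_le_one,
    intervalIntegral.integral_of_le zero_le_one, ← integral_ofReal]
  simp

/-- The test functions are real, so orthogonality passes to the real and imaginary parts of a
separately. Completeness over the reals then serves both scalar fields. -/
theorem eq_zero_of_real_system {ι : Type*} {c : ι → ℝ → ℝ} (hc : ∀ i, Continuous (c i))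
    (H : ∀ f : ℝ → ℝ, MemLp f 2 spaceMeasure →
      (∀ i, ∫ x in Ioo (0 : ℝ) 1, f x * c i x = 0) → f =ᵐ[spaceMeasure] 0)
    {a : SpaceL2 𝕜} (ha : ∀ i, pairing a (realL2 𝕜 (c i)) = 0) : a = 0 := by
  have hint : ∀ i, Integrable (fun x => a x * (c i x : 𝕜)) spaceMeasure := fun i =>
    integrable_mul_of_continuous a (continuous_ofReal_comp (hc i))
  have hre := H (fun x => RCLike.re (a x)) (Lp.memLp a).re fun i => by
    have h := congrArg RCLike.re (ha i)
    rw [pairing_realL2 _ (hc i), ← integral_re (hint i)] at h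
    simpa using h
  have him := H (fun x => RCLike.im (a x)) (Lp.memLp a).im fun i => by
    have h := congrArg RCLike.im (ha i)
    rw [pairing_realL2 _ (hc i), ← integral_im (hint i)] at h
    simpa using h
  rw [Lp.eq_zero_iff_ae_eq_zero]
  filter_upwards [hre, him] with x h1 h2
  exact RCLike.ext (by simpa using h1) (by simpa using h2)

/-- The Hilbert basis of `L²(0,1)` given by a complete orthonormal system of real functions. -/
def realBasis {ι : Type*} [DecidableEq ι] {c : ι → ℝ → ℝ} (hc : ∀ i, Continuous (c i))
    (ho : ∀ i j, ∫ x in (0 : ℝ)..1, c i x * c j x = if i = j then 1 else 0)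
    (H : ∀ f : ℝ → ℝ, MemLp f 2 spaceMeasure →
      (∀ i, ∫ x in Ioo (0 : ℝ) 1, f x * c i x = 0) → f =ᵐ[spaceMeasure] 0) :
    HilbertBasis ι 𝕜 (SpaceL2 𝕜) :=
  HilbertBasis.mkOfOrthogonalEqBot (v := fun i => realL2 𝕜 (c i))
    (orthonormal_iff_ite.2 fun i j => by
      rw [inner_realL2_realL2 (hc i) (hc j), ho]
      split_ifs <;> simp)
    ((Submodule.eq_bot_iff _).2 fun a ha => eq_zero_of_real_system hc H fun i => by
      rw [← inner_realL2 _ (hc i)]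
      exact ha _ (Submodule.subset_span ⟨i, rfl⟩))

/-- The Hilbert basis of Hartley functions. -/
def hartleyBasis : HilbertBasis ℤ 𝕜 (SpaceL2 𝕜) :=
  realBasis (fun k => (contDiff_hartley k).continuous) integral_hartley_mul
    fun _ => ae_zero_of_hartley

/-- The Hilbert basis of Dirichlet eigenfunctions. -/
def sineBasis : HilbertBasis ℕ 𝕜 (SpaceL2 𝕜) :=
  realBasis (fun k => (contDiff_sineFn k).continuous) integral_sineFn_mul
    fun _ => ae_zero_of_sine

/-- The Hilbert basis of Neumann eigenfunctions. -/
def cosineBasis : HilbertBasis ℕ 𝕜 (SpaceL2 𝕜) :=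
  realBasis (fun k => (contDiff_cosineFn k).continuous) integral_cosineFn_mul
    fun _ => ae_zero_of_cosine

theorem hartleyBasis_apply (k : ℤ) :
    (hartleyBasis : HilbertBasis ℤ 𝕜 (SpaceL2 𝕜)) k = realL2 𝕜 (hartley k) := by
  simp [hartleyBasis, realBasis]

theorem sineBasis_apply (k : ℕ) :
    (sineBasis : HilbertBasis ℕ 𝕜 (SpaceL2 𝕜)) k = realL2 𝕜 (sineFn k) := by
  simp [sineBasis, realBasis]

theorem cosineBasis_apply (k : ℕ) :
    (cosineBasis : HilbertBasis ℕ 𝕜 (SpaceL2 𝕜)) k = realL2 𝕜 (cosineFn k) := by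
  simp [cosineBasis, realBasis]

end Bases

/-! ### Continuity in time from summable bounds on modes -/

section Modal

variable {𝕜 : Type*} [RCLike 𝕜] {T : ℝ} {H : Type*} [NormedAddCommGroup H] [InnerProductSpace 𝕜 H]
  {ι : Type*}

theorem integrable_norm_inner_sq (e : H) (w : TimeL2 T H) :
    Integrable (fun t => ‖inner 𝕜 e (w t)‖ ^ 2) (timeMeasure T) := by
  refine ((integrable_norm_sq w).const_mul (‖e‖ ^ 2)).mono' ?_ ?_
  · exact ((innerSL 𝕜 e).continuous.comp_aestronglyMeasurable (Lp.memLp w).1).norm.pow 2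
  · refine Filter.Eventually.of_forall fun t => ?_
    rw [Real.norm_eq_abs, abs_of_nonneg (sq_nonneg _), ← mul_pow]
    exact pow_le_pow_left₀ (norm_nonneg _) (norm_inner_le_norm _ _) 2

theorem sum_integral_norm_inner_sq_le {e : ι → H} (he : Orthonormal 𝕜 e) (w : TimeL2 T H)
    (s : Finset ι) : ∑ i ∈ s, ∫ t in Ioo (0 : ℝ) T, ‖inner 𝕜 (e i) (w t)‖ ^ 2 ≤ ‖w‖ ^ 2 := by
  rw [← integral_finsetSum _ fun i _ => integrable_norm_inner_sq (e i) w, norm_sq_Lp_two]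
  refine integral_mono (integrable_finsetSum _ fun i _ => integrable_norm_inner_sq (e i) w)
    (integrable_norm_sq w) fun t => ?_
  exact he.sum_inner_products_le (w t)

theorem summable_integral_norm_inner_sq {e : ι → H} (he : Orthonormal 𝕜 e) (w : TimeL2 T H) :
    Summable fun i => ∫ t in Ioo (0 : ℝ) T, ‖inner 𝕜 (e i) (w t)‖ ^ 2 :=
  summable_of_sum_le (fun _ => integral_nonneg fun _ => sq_nonneg _)
    (sum_integral_norm_inner_sq_le he w)

theorem tsum_integral_norm_inner_sq_le {e : ι → H} (he : Orthonormal 𝕜 e) (w : TimeL2 T H) :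
    ∑' i, ∫ t in Ioo (0 : ℝ) T, ‖inner 𝕜 (e i) (w t)‖ ^ 2 ≤ ‖w‖ ^ 2 :=
  (summable_integral_norm_inner_sq he w).tsum_le_of_sum_le (sum_integral_norm_inner_sq_le he w)

/-- By orthogonality, a finite partial sum of the series of `W i t • b i` has squared norm at most
the corresponding sum of `M`, at every t. The series is thus Cauchy in the supremum norm. Its sum is
w for almost every t because countably many null sets are discarded. -/
theorem exists_contRep_of_modes [Countable ι] [CompleteSpace H] (hT : 0 < T)
    (b : HilbertBasis ι 𝕜 H)
    (w : TimeL2 T H) (W : ι → TimeC T 𝕜) {M : ι → ℝ} (hM : Summable M)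
    (hb : ∀ i t, ‖W i t‖ ^ 2 ≤ M i)
    (hw : ∀ i, IsContRep (W i) fun t => inner 𝕜 (b i) (w t)) :
    ∃ R : TimeC T H, IsContRep R w ∧ ‖R‖ ^ 2 ≤ ∑' i, M i := by
  have hM0 : ∀ i, 0 ≤ M i := fun i => (sq_nonneg _).trans (hb i ⟨0, le_rfl, hT.le⟩)
  let f : ι → TimeC T H := fun i => ⟨fun t => W i t • b i, by fun_prop⟩
  have hsq : ∀ (s : Finset ι) (t : Icc (0 : ℝ) T), ‖(∑ i ∈ s, f i) t‖ ^ 2 ≤ ∑ i ∈ s, M i :=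
    fun s t => by
      have e : (∑ i ∈ s, f i) t = ∑ i ∈ s, W i t • b i := by simp [f]
      have e2 : ‖∑ i ∈ s, W i t • b i‖ ^ 2 = ∑ i ∈ s, ‖W i t‖ ^ 2 := by
        have := b.orthonormal.inner_sum (fun i => W i t) (fun i => W i t) s
        rw [inner_self_eq_norm_sq_to_K] at this
        have h2 := congrArg RCLike.re this
        rw [map_sum] at h2
        have h3 : ∀ i, RCLike.re ((starRingEnd 𝕜) (W i t) * W i t) = ‖W i t‖ ^ 2 := fun i => by
          rw [RCLike.conj_mul]; norm_cast
        simp_rw [h3] at h2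
        rw [← h2]
        norm_cast
      rw [e, e2]
      exact Finset.sum_le_sum fun i _ => hb i t
  have hsum : Summable f := by
    rw [summable_iff_vanishing_norm]
    intro ε hε
    -- The tolerance for the squared norms is (ε/2)², leaving room for the strict inequality.
    obtain ⟨s, hs⟩ := summable_iff_vanishing_norm.1 hM (ε ^ 2 / 4) (by positivity)
    refine ⟨s, fun t ht => ?_⟩
    refine lt_of_le_of_lt ((ContinuousMap.norm_le _ (by positivity : (0 : ℝ) ≤ ε / 2)).2
      fun x => ?_) (by linarith)
    have h1 := (hsq t x).trans ((le_abs_self _).trans (hs t ht).le)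
    refine abs_le_of_sq_le_sq' ?_ (by positivity) |>.2
    calc _ ≤ _ := h1
      _ = (ε / 2) ^ 2 := by ring
  have hev : ∀ t, HasSum (fun i => W i t • b i) ((∑' i, f i) t) := fun t => by
    have h := ContinuousMap.hasSum_apply hsum.hasSum t
    exact h
  refine ⟨∑' i, f i, ?_, ?_⟩
  · have h1 : ∀ᵐ t ∂(timeMeasure T), ∀ i, ∃ ht : t ∈ Icc (0 : ℝ) T,
        W i ⟨t, ht⟩ = inner 𝕜 (b i) (w t) := ae_all_iff.2 hw
    filter_upwards [h1, ae_restrict_mem measurableSet_Ioo] with t ht ht'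
    have hmem := Ioo_subset_Icc_self ht'
    refine ⟨hmem, (hev ⟨t, hmem⟩).unique ?_⟩
    have e : (fun i => W i ⟨t, hmem⟩ • b i) = fun i => b.repr (w t) i • b i := by
      ext1 i
      obtain ⟨_, h⟩ := ht i
      rw [h, b.repr_apply_apply]
    rw [e]
    exact b.hasSum_repr (w t)
  · have hle : ‖∑' i, f i‖ ≤ √(∑' i, M i) := by
      refine (ContinuousMap.norm_le _ (Real.sqrt_nonneg _)).2 fun t => ?_
      have h2 : Filter.Tendsto (fun s : Finset ι => ‖(∑ i ∈ s, f i) t‖) Filter.atTop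
          (nhds ‖(∑' i, f i) t‖) := by
        have : Filter.Tendsto (fun s : Finset ι => (∑ i ∈ s, f i) t) Filter.atTop
            (nhds ((∑' i, f i) t)) :=
          ((continuous_eval_const t).tendsto _).comp hsum.hasSum
        exact this.norm
      refine le_of_tendsto' h2 fun s => Real.le_sqrt_of_sq_le ((hsq s t).trans ?_)
      exact hM.sum_le_tsum s fun i _ => hM0 i
    calc ‖∑' i, f i‖ ^ 2 ≤ √(∑' i, M i) ^ 2 := pow_le_pow_left₀ (norm_nonneg _) hle 2
      _ = _ := Real.sq_sqrt (tsum_nonneg hM0)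

/-- Averaging the hypothesis over s bounds a function at every time by its mean and its oscillation;
the mean of a modal energy is controlled by the L² norm of the curve. -/
theorem le_average_add (hT : 0 < T) {E : ℝ → ℝ} (hE : ContinuousOn E (Icc 0 T)) {A : ℝ}
    (h : ∀ t ∈ Icc 0 T, ∀ s ∈ Icc 0 T, E t ≤ E s + A) {t : ℝ} (ht : t ∈ Icc 0 T) :
    E t ≤ T⁻¹ * (∫ s in Ioo 0 T, E s) + A := by
  have hi : IntegrableOn E (Ioo 0 T) := hE.integrableOn_Icc.mono_set Ioo_subset_Icc_self
  have h1 : ∫ s in Ioo 0 T, E t ≤ ∫ s in Ioo 0 T, (E s + A) := by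
    refine setIntegral_mono_on (integrableOn_const (by simp)) (hi.add (integrableOn_const (by simp)))
      measurableSet_Ioo fun s hs => h t ht s (Ioo_subset_Icc_self hs)
  rw [integral_add hi (integrableOn_const (by simp))] at h1
  simp only [integral_const, measureReal_restrict_apply_univ, Real.volume_real_Ioo_of_le hT.le,
    sub_zero, smul_eq_mul] at h1
  have h2 : T * E t ≤ T * (T⁻¹ * (∫ s in Ioo 0 T, E s) + A) := by
    rw [mul_add, mul_inv_cancel_left₀ hT.ne']; exact h1
  exact le_of_mul_le_mul_left h2 hT

theorem continuousOn_primitive {E : Type*} [NormedAddCommGroup E] [NormedSpace ℝ E] {m : ℝ → E}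
    (hT : 0 ≤ T) (hm : IntegrableOn m (Ioo 0 T)) :
    ContinuousOn (fun t => ∫ s in (0 : ℝ)..t, m s) (Icc 0 T) := by
  have := intervalIntegral.continuousOn_primitive_interval (f := m) (μ := volume) (a := 0) (b := T)
    (by rw [uIcc_of_le hT]
        exact (integrableOn_Icc_iff_integrableOn_Ioc).2 ((integrableOn_Ioc_iff_integrableOn_Ioo).2 hm))
  rwa [uIcc_of_le hT] at this

theorem norm_intervalIntegral_sub_le {m : ℝ → 𝕜} {a : ℝ → ℝ}
    (hm : IntegrableOn m (Ioo 0 T)) (ha : IntegrableOn a (Ioo 0 T))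
    (h : ∀ᵐ t ∂(timeMeasure T), ‖m t‖ ≤ a t) {t s : ℝ} (ht : t ∈ Icc 0 T) (hs : s ∈ Icc 0 T) :
    ‖(∫ r in (0 : ℝ)..t, m r) - ∫ r in (0 : ℝ)..s, m r‖ ≤ ∫ r in Ioo 0 T, a r := by
  have hmi : ∀ x ∈ Icc 0 T, IntervalIntegrable m volume 0 x := fun x hx =>
    (intervalIntegrable_iff_integrableOn_Ioo_of_le hx.1).2
      (hm.mono_set (Ioo_subset_Ioo_right hx.2))
  rw [intervalIntegral.integral_interval_sub_left (hmi t ht) (hmi s hs)]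
  have h1 : ∫ r in Ioo 0 T, ‖m r‖ ≤ ∫ r in Ioo 0 T, a r := integral_mono_ae hm.norm ha h
  refine le_trans (intervalIntegral.norm_integral_le_integral_norm_uIoc) (le_trans ?_ h1)
  rw [← integral_Ioc_eq_integral_Ioo]
  refine setIntegral_mono_set ((integrableOn_Ioc_iff_integrableOn_Ioo).2 hm.norm)
    (Filter.Eventually.of_forall fun _ => norm_nonneg _) ?_
  refine (show uIoc s t ⊆ Ioc 0 T from ?_).eventuallyLE
  intro r hr
  rcases mem_uIoc.1 hr with hr | hr
  · exact ⟨hs.1.trans_lt hr.1, hr.2.trans ht.2⟩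
  · exact ⟨ht.1.trans_lt hr.1, hr.2.trans hs.2⟩

/-- A curve whose coordinates in a Hilbert basis are primitives, with a summable control of the
variation of the energies of the modes, has a continuous representative. -/
theorem exists_contRep_of_energy [Countable ι] [CompleteSpace H] (hT : 0 < T)
    (b : HilbertBasis ι 𝕜 H) (w : TimeL2 T H) (σ : Equiv.Perm ι) {c : ι → 𝕜} {m : ι → ℝ → 𝕜}
    {a : ι → ℝ → ℝ} (hm : ∀ i, IntegrableOn (m i) (Ioo 0 T))
    (hw : ∀ i, ∀ᵐ t ∂(timeMeasure T), inner 𝕜 (b i) (w t) = c i + ∫ s in (0 : ℝ)..t, m i s)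
    (ha : ∀ i, IntegrableOn (a i) (Ioo 0 T))
    (hma : ∀ i, ∀ᵐ t ∂(timeMeasure T),
      ‖star (m i t) * inner 𝕜 (b i) (w t) + star (inner 𝕜 (b i) (w t)) * m i t +
        (star (m (σ i) t) * inner 𝕜 (b (σ i)) (w t) +
          star (inner 𝕜 (b (σ i)) (w t)) * m (σ i) t)‖ ≤ a i t)
    (hsum : Summable fun i => ∫ t in Ioo 0 T, a i t) :
    ∃ R : TimeC T H, IsContRep R w ∧
      ‖R‖ ^ 2 ≤ 2 * T⁻¹ * ‖w‖ ^ 2 + ∑' i, ∫ t in Ioo 0 T, a i t := by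
  let W : ι → ℝ → 𝕜 := fun i t => c i + ∫ s in (0 : ℝ)..t, m i s
  have hWc : ∀ i, ContinuousOn (W i) (Icc 0 T) := fun i =>
    continuousOn_const.add (continuousOn_primitive hT.le (hm i))
  have hW : ∀ i, ∀ t ∈ Icc 0 T, W i t = W i 0 + ∫ s in (0 : ℝ)..t, m i s := fun i t _ => by
    simp [W]
  have hW' : ∀ i, ∀ t ∈ Icc 0 T, star (W i t) = star (W i 0) + ∫ s in (0 : ℝ)..t, star (m i s) :=
    fun i t ht => by
      rw [hW i t ht, star_add]
      congr 1
      rw [intervalIntegral.integral_of_le ht.1, intervalIntegral.integral_of_le ht.1]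
      exact integral_conj.symm
  have hms : ∀ i, IntegrableOn (fun t => star (m i t)) (Ioo 0 T) := fun i =>
    (RCLike.conjCLE (K := 𝕜)).toContinuousLinearMap.integrable_comp (hm i)
  have hprod : ∀ i, ∀ t ∈ Icc 0 T, ((‖W i t‖ ^ 2 : ℝ) : 𝕜) = star (W i 0) * W i 0 +
      ∫ s in (0 : ℝ)..t, (star (m i s) * W i s + star (W i s) * m i s) := fun i t ht => by
    rw [← mul_primitive_eq (F := fun t => star (W i t)) (G := W i) ht (hms i) (hm i)
      (hW' i) (hW i)]
    have := RCLike.conj_mul (W i t)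
    rw [RCLike.star_def, this]
    push_cast
    rfl
  have hint : ∀ i, IntegrableOn (fun s => star (m i s) * W i s + star (W i s) * m i s)
      (Ioo 0 T) := fun i => by
    obtain ⟨K, hK⟩ := isCompact_Icc.exists_bound_of_continuousOn (hWc i)
    have hmeas : AEStronglyMeasurable (W i) (timeMeasure T) :=
      ((hWc i).mono Ioo_subset_Icc_self).aestronglyMeasurable measurableSet_Ioo
    have hbd : ∀ᵐ t ∂(timeMeasure T), ‖W i t‖ ≤ K := by
      filter_upwards [ae_restrict_mem measurableSet_Ioo] with t ht
      exact hK t (Ioo_subset_Icc_self ht)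
    refine Integrable.add ((hms i).mul_bdd (c := K) hmeas hbd) ((hm i).bdd_mul (c := K) ?_ ?_)
    · exact RCLike.continuous_conj.comp_aestronglyMeasurable hmeas
    · simpa using hbd
  -- The energies of i and its partner `σ i` are added before anything is estimated, so that
  -- unbounded coupling terms between the two may cancel in the derivative.
  let E : ι → ℝ → ℝ := fun i t => ‖W i t‖ ^ 2 + ‖W (σ i) t‖ ^ 2
  have hEc : ∀ i, ContinuousOn (E i) (Icc 0 T) := fun i =>
    ((hWc i).norm.pow 2).add ((hWc (σ i)).norm.pow 2)
  have hwW : ∀ i, ∀ᵐ t ∂(timeMeasure T), inner 𝕜 (b i) (w t) = W i t := hw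
  have hEv : ∀ i, ∀ t ∈ Icc 0 T, ∀ s ∈ Icc 0 T, E i t ≤ E i s + ∫ r in Ioo 0 T, a i r := by
    intro i t ht s hs
    have key := norm_intervalIntegral_sub_le ((hint i).add (hint (σ i))) (ha i) (by
      filter_upwards [hma i, hwW i, hwW (σ i)] with r h1 h2 h3
      rw [h2, h3] at h1
      exact h1) ht hs
    have hii : ∀ j, ∀ x ∈ Icc 0 T, IntervalIntegrable
        (fun s => star (m j s) * W j s + star (W j s) * m j s) volume 0 x := fun j x hx =>
      (intervalIntegrable_iff_integrableOn_Ioo_of_le hx.1).2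
        ((hint j).mono_set (Ioo_subset_Ioo_right hx.2))
    have e : ∀ x ∈ Icc 0 T, ∫ r in (0 : ℝ)..x,
        ((fun s => star (m i s) * W i s + star (W i s) * m i s) +
          fun s => star (m (σ i) s) * W (σ i) s + star (W (σ i) s) * m (σ i) s) r =
        (((E i x : ℝ)) : 𝕜) - (star (W i 0) * W i 0 + star (W (σ i) 0) * W (σ i) 0) :=
      fun x hx => by
        simp only [Pi.add_apply]
        rw [intervalIntegral.integral_add (hii i x hx) (hii (σ i) x hx)]
        simp only [E]
        rw [RCLike.ofReal_add, hprod i x hx, hprod (σ i) x hx]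
        ring
    rw [e t ht, e s hs, sub_sub_sub_cancel_right, ← RCLike.ofReal_sub, RCLike.norm_ofReal] at key
    linarith [le_abs_self (E i t - E i s)]
  have hEint : ∀ i, ∫ s in Ioo 0 T, E i s =
      (∫ t in Ioo (0 : ℝ) T, ‖inner 𝕜 (b i) (w t)‖ ^ 2) +
        ∫ t in Ioo (0 : ℝ) T, ‖inner 𝕜 (b (σ i)) (w t)‖ ^ 2 := fun i => by
    rw [← integral_add (integrable_norm_inner_sq _ w) (integrable_norm_inner_sq _ w)]
    refine integral_congr_ae ?_
    filter_upwards [hwW i, hwW (σ i)] with t h1 h2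
    simp only [E]
    rw [h1, h2]
  let N : ι → ℝ := fun i => ∫ t in Ioo (0 : ℝ) T, ‖inner 𝕜 (b i) (w t)‖ ^ 2
  have hN : Summable N := summable_integral_norm_inner_sq b.orthonormal w
  have hNσ : Summable fun i => N (σ i) := σ.summable_iff.2 hN
  -- The mean of the pair energy plus its total variation. Summing over i counts every mode twice,
  -- which is the factor 2 in front of T⁻¹.
  let M : ι → ℝ := fun i => T⁻¹ * (N i + N (σ i)) + ∫ r in Ioo 0 T, a i r
  have hMs : Summable M := ((hN.add hNσ).mul_left _).add hsum
  let Wc : ι → TimeC T 𝕜 := fun i => ⟨fun t => W i t, (hWc i).comp_continuous continuous_subtype_val fun t => t.2⟩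
  obtain ⟨R, hR, hRn⟩ := exists_contRep_of_modes hT b w Wc hMs (fun i t => by
      have h1 := le_average_add hT (hEc i) (hEv i) t.2
      rw [hEint i] at h1
      refine le_trans ?_ h1
      exact le_add_of_nonneg_right (sq_nonneg ‖W (σ i) t‖)) (fun i => by
      filter_upwards [hwW i, ae_restrict_mem measurableSet_Ioo] with t h1 h2
      exact ⟨Ioo_subset_Icc_self h2, h1.symm⟩)
  refine ⟨R, hR, hRn.trans ?_⟩
  simp only [M]
  rw [((hN.add hNσ).mul_left _).tsum_add hsum, tsum_mul_left, hN.tsum_add hNσ, σ.tsum_eq N]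
  have h1 : ∑' i, N i ≤ ‖w‖ ^ 2 := tsum_integral_norm_inner_sq_le b.orthonormal w
  have h2 : T⁻¹ * (∑' i, N i + ∑' i, N i) ≤ T⁻¹ * (‖w‖ ^ 2 + ‖w‖ ^ 2) := by gcongr
  linarith

end Modal

/-! ### Product rule for the pairing of two curves -/

section BilinearModal

variable {𝕜 : Type*} [RCLike 𝕜] {T : ℝ} {ι : Type*}

theorem inner_eq_pairing_of_star {e : SpaceL2 𝕜} (he : star e = e) (a : SpaceL2 𝕜) :
    inner 𝕜 e a = pairing a e := by
  rw [inner_eq_pairing, he, pairing_comm]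

theorem integrable_norm_pairing_sq {e : SpaceL2 𝕜} (he : star e = e) (w : TimeL2 T (SpaceL2 𝕜)) :
    Integrable (fun t => ‖pairing (w t) e‖ ^ 2) (timeMeasure T) := by
  simp_rw [← inner_eq_pairing_of_star he]
  exact integrable_norm_inner_sq e w

theorem summable_integral_norm_pairing_sq (b : HilbertBasis ι 𝕜 (SpaceL2 𝕜))
    (hb : ∀ i, star (b i) = b i) (w : TimeL2 T (SpaceL2 𝕜)) :
    Summable fun i => ∫ t in Ioo (0 : ℝ) T, ‖pairing (w t) (b i)‖ ^ 2 := by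
  simp_rw [← fun i => inner_eq_pairing_of_star (hb i)]
  exact summable_integral_norm_inner_sq b.orthonormal w

theorem tsum_integral_norm_pairing_sq_le (b : HilbertBasis ι 𝕜 (SpaceL2 𝕜))
    (hb : ∀ i, star (b i) = b i) (w : TimeL2 T (SpaceL2 𝕜)) :
    ∑' i, ∫ t in Ioo (0 : ℝ) T, ‖pairing (w t) (b i)‖ ^ 2 ≤ ‖w‖ ^ 2 := by
  simp_rw [← fun i => inner_eq_pairing_of_star (hb i)]
  exact tsum_integral_norm_inner_sq_le b.orthonormal w

theorem hasSum_pairing_mul_pairing (b : HilbertBasis ι 𝕜 (SpaceL2 𝕜))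
    (hb : ∀ i, star (b i) = b i) (x y : SpaceL2 𝕜) :
    HasSum (fun i => pairing x (b i) * pairing y (b i)) (pairing x y) := by
  rw [pairing_eq_inner]
  refine (b.hasSum_inner_mul_inner (star x) y).congr_fun ?_
  intro i
  rw [← pairing_eq_inner, inner_eq_pairing_of_star (hb i)]

/-- Parseval at each time. Each product is dominated by the sum of two squares, whose integrals are
summable by Bessel's inequality, so sum and integral may be exchanged. -/
theorem hasSum_integral_pairing_mul_pairing [Countable ι] (b : HilbertBasis ι 𝕜 (SpaceL2 𝕜))
    (hb : ∀ i, star (b i) = b i) (x y : TimeL2 T (SpaceL2 𝕜)) :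
    HasSum (fun i => ∫ t in Ioo (0 : ℝ) T, pairing (x t) (b i) * pairing (y t) (b i))
      (timePairing x y) := by
  have hle : ∀ i t, ‖pairing (x t) (b i) * pairing (y t) (b i)‖ ≤
      ‖pairing (x t) (b i)‖ ^ 2 + ‖pairing (y t) (b i)‖ ^ 2 := fun i t => by
    rw [norm_mul]
    nlinarith [sq_nonneg (‖pairing (x t) (b i)‖ - ‖pairing (y t) (b i)‖),
      sq_nonneg ‖pairing (x t) (b i)‖, sq_nonneg ‖pairing (y t) (b i)‖]
  have hi : ∀ i, Integrable (fun t => ‖pairing (x t) (b i)‖ ^ 2 + ‖pairing (y t) (b i)‖ ^ 2)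
      (timeMeasure T) := fun i =>
    (integrable_norm_pairing_sq (hb i) x).add (integrable_norm_pairing_sq (hb i) y)
  have hint : ∀ i, Integrable (fun t => pairing (x t) (b i) * pairing (y t) (b i))
      (timeMeasure T) := fun i =>
    (hi i).mono' ((integrable_pairing_const x (b i)).1.mul (integrable_pairing_const y (b i)).1)
      (Filter.Eventually.of_forall (hle i))
  have hs : Summable fun i => ∫ t in Ioo (0 : ℝ) T, ‖pairing (x t) (b i) * pairing (y t) (b i)‖ := by
    refine Summable.of_nonneg_of_le (fun i => integral_nonneg fun t => norm_nonneg _)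
      (fun i => integral_mono (hint i).norm (hi i) (hle i)) ?_
    simp_rw [fun i => integral_add (integrable_norm_pairing_sq (hb i) x)
      (integrable_norm_pairing_sq (hb i) y)]
    exact (summable_integral_norm_pairing_sq b hb x).add
      (summable_integral_norm_pairing_sq b hb y)
  have h := hasSum_integral_of_summable_integral_norm hint hs
  have e : timePairing x y = ∫ t in Ioo (0 : ℝ) T,
      ∑' i, pairing (x t) (b i) * pairing (y t) (b i) := by
    rw [timePairing_apply]
    exact integral_congr_ae (Filter.Eventually.of_forall fun t =>
      (hasSum_pairing_mul_pairing b hb (x t) (y t)).tsum_eq.symm)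
  rw [e]
  exact h

/-- Both sides are continuous on [0,T], so the identity extends to every time, including the end
points where initial and final values are read off. -/
theorem IsContRep.pairing_eq (hT : 0 < T) {W : TimeC T (SpaceL2 𝕜)} {w : ℝ → SpaceL2 𝕜}
    (hW : IsContRep W w) {e : SpaceL2 𝕜} {c : 𝕜} {m : ℝ → 𝕜} (hm : IntegrableOn m (Ioo 0 T))
    (h : ∀ᵐ t ∂(timeMeasure T), pairing (w t) e = c + ∫ s in (0 : ℝ)..t, m s) {t : ℝ}
    (ht : t ∈ Icc 0 T) : pairing (W ⟨t, ht⟩) e = c + ∫ s in (0 : ℝ)..t, m s := by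
  have key := eq_on_Icc_of_ae hT (f := fun t => pairing (W (projIcc 0 T hT.le t)) e)
    (g := fun t => c + ∫ s in (0 : ℝ)..t, m s)
    ((((pairing (𝕜 := 𝕜)).flip e).continuous.comp (continuousOn_timeC hT.le W)).continuousOn)
    (continuousOn_const.add (continuousOn_primitive hT.le hm)) (by
      filter_upwards [h, hW.ae_eq hT.le] with t h1 h2
      rw [h2, h1]) ht
  simpa [projIcc_of_mem hT.le ht] using key

/-- Product rule for the pairing of two curves, from the product rules of their modes. -/
theorem pairing_sub_pairing_of_modes (hT : 0 < T) (b : HilbertBasis ι 𝕜 (SpaceL2 𝕜))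
    (hb : ∀ i, star (b i) = b i) (σ : Equiv.Perm ι) {w z : ℝ → SpaceL2 𝕜}
    {W Z : TimeC T (SpaceL2 𝕜)} (hW : IsContRep W w) (hZ : IsContRep Z z)
    {c d : ι → 𝕜} {m n β : ι → ℝ → 𝕜}
    (hm : ∀ i, IntegrableOn (m i) (Ioo 0 T)) (hn : ∀ i, IntegrableOn (n i) (Ioo 0 T))
    (hwm : ∀ i, ∀ᵐ t ∂(timeMeasure T), pairing (w t) (b i) = c i + ∫ s in (0 : ℝ)..t, m i s)
    (hzn : ∀ i, ∀ᵐ t ∂(timeMeasure T), pairing (z t) (b i) = d i + ∫ s in (0 : ℝ)..t, n i s)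
    (hβ : ∀ i, ∀ᵐ t ∂(timeMeasure T),
      m i t * pairing (z t) (b i) + pairing (w t) (b i) * n i t +
        (m (σ i) t * pairing (z t) (b (σ i)) + pairing (w t) (b (σ i)) * n (σ i) t) = β i t)
    {B : 𝕜} (hB : HasSum (fun i => ∫ t in Ioo 0 T, β i t) (2 * B)) :
    pairing (W ⟨T, hT.le, le_rfl⟩) (Z ⟨T, hT.le, le_rfl⟩) -
      pairing (W ⟨0, le_rfl, hT.le⟩) (Z ⟨0, le_rfl, hT.le⟩) = B := by
  let F : ι → ℝ → 𝕜 := fun i t => c i + ∫ s in (0 : ℝ)..t, m i s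
  let G : ι → ℝ → 𝕜 := fun i t => d i + ∫ s in (0 : ℝ)..t, n i s
  have hF : ∀ i t (ht : t ∈ Icc 0 T), pairing (W ⟨t, ht⟩) (b i) = F i t := fun i t ht =>
    hW.pairing_eq hT (hm i) (hwm i) ht
  have hG : ∀ i t (ht : t ∈ Icc 0 T), pairing (Z ⟨t, ht⟩) (b i) = G i t := fun i t ht =>
    hZ.pairing_eq hT (hn i) (hzn i) ht
  have hFc : ∀ i, ContinuousOn (F i) (Icc 0 T) := fun i =>
    continuousOn_const.add (continuousOn_primitive hT.le (hm i))
  have hGc : ∀ i, ContinuousOn (G i) (Icc 0 T) := fun i =>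
    continuousOn_const.add (continuousOn_primitive hT.le (hn i))
  have hint : ∀ i, IntegrableOn (fun s => m i s * G i s + F i s * n i s) (Ioo 0 T) := fun i => by
    have aux : ∀ f g : ℝ → 𝕜, ContinuousOn f (Icc 0 T) → IntegrableOn g (Ioo 0 T) →
        IntegrableOn (fun s => f s * g s) (Ioo 0 T) := fun f g hf hg => by
      obtain ⟨K, hK⟩ := isCompact_Icc.exists_bound_of_continuousOn hf
      refine Integrable.bdd_mul (c := K) hg
        ((hf.mono Ioo_subset_Icc_self).aestronglyMeasurable measurableSet_Ioo) ?_
      filter_upwards [ae_restrict_mem measurableSet_Ioo] with t ht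
      exact hK t (Ioo_subset_Icc_self ht)
    refine Integrable.add ?_ (aux _ _ (hFc i) (hn i))
    simp_rw [mul_comm (m i _)]
    exact aux _ _ (hGc i) (hm i)
  have hTm : T ∈ Icc 0 T := ⟨hT.le, le_rfl⟩
  have h0m : (0 : ℝ) ∈ Icc 0 T := ⟨le_rfl, hT.le⟩
  have hprod : ∀ i, F i T * G i T - F i 0 * G i 0 =
      ∫ s in Ioo 0 T, (m i s * G i s + F i s * n i s) := fun i => by
    rw [mul_primitive_eq hTm (hm i) (hn i) (fun t _ => by simp [F]) (fun t _ => by simp [G]),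
      add_sub_cancel_left, intervalIntegral.integral_of_le hT.le, integral_Ioc_eq_integral_Ioo]
  have hsT : HasSum (fun i => F i T * G i T)
      (pairing (W ⟨T, hTm⟩) (Z ⟨T, hTm⟩)) :=
    (hasSum_pairing_mul_pairing b hb _ _).congr_fun fun i => by rw [hF, hG]
  have hs0 : HasSum (fun i => F i 0 * G i 0)
      (pairing (W ⟨0, h0m⟩) (Z ⟨0, h0m⟩)) :=
    (hasSum_pairing_mul_pairing b hb _ _).congr_fun fun i => by rw [hF, hG]
  have hs := hsT.sub hs0
  -- Adding the series reindexed by σ places coupled modes in the same term. The total doubles,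
  -- which accounts for 2 * B in `hB`.
  have hsσ := σ.hasSum_iff.2 hs
  have h2 := hs.add hsσ
  have e : ∀ i, (F i T * G i T - F i 0 * G i 0) + (F (σ i) T * G (σ i) T - F (σ i) 0 * G (σ i) 0) =
      ∫ t in Ioo 0 T, β i t := fun i => by
    rw [hprod, hprod, ← integral_add (hint i) (hint (σ i))]
    refine integral_congr_ae ?_
    filter_upwards [hβ i, hwm i, hzn i, hwm (σ i), hzn (σ i)] with t h1 h2 h3 h4 h5
    rw [h2, h3, h4, h5] at h1
    exact h1
  have h3 := (h2.congr_fun fun i => (e i).symm).unique hB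
  have h4 : (2 : 𝕜) ≠ 0 := two_ne_zero
  apply mul_left_cancel₀ h4
  rw [← h3]
  ring

end BilinearModal

/-! ### Weak transport and diffusion equations, mode by mode -/

section WeakEquations

variable {𝕜 : Type*} [RCLike 𝕜] {T : ℝ}

/-- The weak form of the periodic transport equation `w_t + w_x = l`; the value at time `0` is
given by the functional `c`. -/
def WeakTransport (w l : TimeL2 T (SpaceL2 𝕜)) (c : (ℝ → 𝕜) → 𝕜) : Prop :=
  ∀ ξ : ℝ → 𝕜, ContDiff ℝ ∞ ξ → ξ 0 = ξ 1 → ∀ᵐ t ∂(timeMeasure T),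
    pairing (w t) (toL2 ξ) =
      c ξ + ∫ s in (0 : ℝ)..t, (pairing (w s) (toL2 (deriv ξ)) + pairing (l s) (toL2 ξ))

/-- The weak form of the equation `w_t = l - k_x` for a curve in `H¹₀(0,1)`; the value at time `0` is
given by the functional `c`. -/
def WeakFlux (w : TimeL2 T (H10 𝕜)) (l k : TimeL2 T (SpaceL2 𝕜)) (c : (ℝ → 𝕜) → 𝕜) : Prop :=
  ∀ η : ℝ → 𝕜, ContDiff ℝ ∞ η → η 0 = 0 → η 1 = 0 → ∀ᵐ t ∂(timeMeasure T),
    pairing (h10Val (w t)) (toL2 η) =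
      c η + ∫ s in (0 : ℝ)..t, (pairing (l s) (toL2 η) + pairing (k s) (toL2 (deriv η)))

/-- The underlying `L²` curve of a curve in `H¹₀(0,1)`. -/
def valCurve (w : TimeL2 T (H10 𝕜)) : TimeL2 T (SpaceL2 𝕜) :=
  (h10ValL (𝕜 := 𝕜)).compLp w

/-- The weak derivative of a curve in `H¹₀(0,1)`. -/
def derivCurve (w : TimeL2 T (H10 𝕜)) : TimeL2 T (SpaceL2 𝕜) :=
  (h10DerivL (𝕜 := 𝕜)).compLp w

theorem valCurve_ae (w : TimeL2 T (H10 𝕜)) :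
    ∀ᵐ t ∂(timeMeasure T), valCurve w t = h10Val (w t) :=
  (h10ValL (𝕜 := 𝕜)).coeFn_compLp w

theorem derivCurve_ae (w : TimeL2 T (H10 𝕜)) :
    ∀ᵐ t ∂(timeMeasure T), derivCurve w t = h10Deriv (w t) :=
  (h10DerivL (𝕜 := 𝕜)).coeFn_compLp w

theorem norm_valCurve_le (w : TimeL2 T (H10 𝕜)) : ‖valCurve w‖ ≤ ‖w‖ := by
  refine Lp.norm_le_norm_of_ae_le ?_
  filter_upwards [valCurve_ae w] with t ht
  rw [ht]
  exact norm_h10Val_le _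

theorem norm_derivCurve_le (w : TimeL2 T (H10 𝕜)) : ‖derivCurve w‖ ≤ ‖w‖ := by
  refine Lp.norm_le_norm_of_ae_le ?_
  filter_upwards [derivCurve_ae w] with t ht
  rw [ht]
  exact norm_h10Deriv_le _

theorem IsContRep.congr {E : Type*} [NormedAddCommGroup E] {R : TimeC T E} {r r' : ℝ → E}
    (h : IsContRep R r) (h' : ∀ᵐ t ∂(timeMeasure T), r t = r' t) : IsContRep R r' := by
  filter_upwards [h, h'] with t ⟨ht, h1⟩ h2
  exact ⟨ht, h1.trans h2⟩

theorem contDiff_ofReal_comp {c : ℝ → ℝ} (hc : ContDiff ℝ ∞ c) :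
    ContDiff ℝ ∞ fun x => (c x : 𝕜) :=
  (RCLike.ofRealCLM (K := 𝕜)).contDiff.comp hc

theorem deriv_ofReal_comp {c c' : ℝ → ℝ} (h : ∀ x, HasDerivAt c (c' x) x) :
    deriv (fun x => (c x : 𝕜)) = fun x => (c' x : 𝕜) := by
  ext1 x
  exact ((RCLike.ofRealCLM (K := 𝕜)).hasFDerivAt.comp_hasDerivAt x (h x)).deriv

theorem star_realL2 {c : ℝ → ℝ} (hc : Continuous c) : star (realL2 𝕜 c) = realL2 𝕜 c := by
  rw [realL2, star_toL2 (continuous_ofReal_comp hc)]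
  simp

theorem toL2_const_mul (r : ℝ) {c : ℝ → ℝ} (hc : Continuous c) :
    toL2 (fun x => ((r * c x : ℝ) : 𝕜)) = (r : 𝕜) • realL2 𝕜 c := by
  rw [realL2, ← toL2_smul _ (continuous_ofReal_comp hc)]
  congr 1
  ext x
  simp

theorem integral_add_add {E : Type*} [NormedAddCommGroup E] [NormedSpace ℝ E]
    {f₁ f₂ f₃ f₄ : ℝ → E} {μ : Measure ℝ} (h₁ : Integrable f₁ μ) (h₂ : Integrable f₂ μ)
    (h₃ : Integrable f₃ μ) (h₄ : Integrable f₄ μ) :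
    ∫ t, ((f₁ t + f₂ t) + (f₃ t + f₄ t)) ∂μ =
      (∫ t, f₁ t ∂μ + ∫ t, f₂ t ∂μ) + (∫ t, f₃ t ∂μ + ∫ t, f₄ t ∂μ) := by
  rw [← integral_add h₁ h₂, ← integral_add h₃ h₄]
  exact integral_add (h₁.add h₂) (h₃.add h₄)

theorem integrable_pairing_mul_pairing {e : SpaceL2 𝕜} (he : star e = e)
    (x y : TimeL2 T (SpaceL2 𝕜)) :
    Integrable (fun t => pairing (x t) e * pairing (y t) e) (timeMeasure T) := by
  refine ((integrable_norm_pairing_sq he x).add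
    (integrable_norm_pairing_sq he y)).mono'
    ((integrable_pairing_const x e).1.mul (integrable_pairing_const y e).1)
    (Filter.Eventually.of_forall fun t => ?_)
  simp only [Pi.add_apply, norm_mul]
  nlinarith [sq_nonneg (‖pairing (x t) e‖ - ‖pairing (y t) e‖),
    sq_nonneg ‖pairing (x t) e‖, sq_nonneg ‖pairing (y t) e‖]

/-- The derivative of the `k`-th mode of a solution of the transport equation. -/
def transportMode (w l : TimeL2 T (SpaceL2 𝕜)) (k : ℤ) (s : ℝ) : 𝕜 :=
  ((2 * Real.pi * k : ℝ) : 𝕜) * pairing (w s) (realL2 𝕜 (hartley (-k))) +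
    pairing (l s) (realL2 𝕜 (hartley k))

theorem integrableOn_transportMode (w l : TimeL2 T (SpaceL2 𝕜)) (k : ℤ) :
    IntegrableOn (transportMode w l k) (Ioo 0 T) :=
  ((integrable_pairing_const w _).const_mul _).add (integrable_pairing_const l _)

theorem WeakTransport.mode {w l : TimeL2 T (SpaceL2 𝕜)} {c : (ℝ → 𝕜) → 𝕜}
    (h : WeakTransport w l c) (k : ℤ) : ∀ᵐ t ∂(timeMeasure T),
      pairing (w t) (hartleyBasis k) = c (fun x => (hartley k x : 𝕜)) +
        ∫ s in (0 : ℝ)..t, transportMode w l k s := by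
  have h1 := h (fun x => (hartley k x : 𝕜)) (contDiff_ofReal_comp (contDiff_hartley k))
    (by simp only [hartley_zero_eq_one k])
  rw [deriv_ofReal_comp (hasDerivAt_hartley k),
    toL2_const_mul (𝕜 := 𝕜) (2 * Real.pi * k) (contDiff_hartley (-k)).continuous] at h1
  filter_upwards [h1] with t ht
  rw [hartleyBasis_apply]
  refine ht.trans ?_
  simp only [transportMode, map_smul, smul_eq_mul]
  rfl

theorem star_hartleyBasis (k : ℤ) :
    star ((hartleyBasis : HilbertBasis ℤ 𝕜 (SpaceL2 𝕜)) k) = hartleyBasis k := by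
  rw [hartleyBasis_apply, star_realL2 (contDiff_hartley k).continuous]

theorem star_sineBasis (k : ℕ) :
    star ((sineBasis : HilbertBasis ℕ 𝕜 (SpaceL2 𝕜)) k) = sineBasis k := by
  rw [sineBasis_apply, star_realL2 (contDiff_sineFn k).continuous]

theorem star_cosineBasis (k : ℕ) :
    star ((cosineBasis : HilbertBasis ℕ 𝕜 (SpaceL2 𝕜)) k) = cosineBasis k := by
  rw [cosineBasis_apply, star_realL2 (contDiff_cosineFn k).continuous]

theorem norm_cross_le (x y : 𝕜) : ‖star x * y + star y * x‖ ≤ ‖x‖ ^ 2 + ‖y‖ ^ 2 := by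
  refine (norm_add_le _ _).trans ?_
  rw [norm_mul, norm_mul, norm_star, norm_star]
  nlinarith [sq_nonneg (‖x‖ - ‖y‖)]

/-- In the derivative of the energy of the pair (k, -k) the terms with coefficients ±2πk cancel.
What remains involves only coefficients of l and w, summable by Bessel, so no derivative of w in x
is needed. -/
theorem WeakTransport.exists_contRep (hT : 0 < T) {w l : TimeL2 T (SpaceL2 𝕜)}
    {c : (ℝ → 𝕜) → 𝕜} (h : WeakTransport w l c) :
    ∃ R : TimeC T (SpaceL2 𝕜), IsContRep R w ∧
      ‖R‖ ^ 2 ≤ 2 * (T⁻¹ + 1) * (‖w‖ ^ 2 + ‖l‖ ^ 2) := by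
  let b : HilbertBasis ℤ 𝕜 (SpaceL2 𝕜) := hartleyBasis
  have bs : ∀ k, star (b k) = b k := star_hartleyBasis
  let N : TimeL2 T (SpaceL2 𝕜) → ℤ → ℝ := fun x k => ∫ t in Ioo (0 : ℝ) T, ‖pairing (x t) (b k)‖ ^ 2
  have hN : ∀ x, Summable (N x) := fun x => summable_integral_norm_pairing_sq b bs x
  have hN' : ∀ x, ∑' k, N x k ≤ ‖x‖ ^ 2 := fun x => tsum_integral_norm_pairing_sq_le b bs x
  have hi : ∀ x : TimeL2 T (SpaceL2 𝕜), ∀ k,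
      Integrable (fun t => ‖pairing (x t) (b k)‖ ^ 2) (timeMeasure T) := fun x k =>
    integrable_norm_pairing_sq (bs k) x
  let a : ℤ → ℝ → ℝ := fun k t =>
    (‖pairing (l t) (b k)‖ ^ 2 + ‖pairing (w t) (b k)‖ ^ 2) +
      (‖pairing (l t) (b (-k))‖ ^ 2 + ‖pairing (w t) (b (-k))‖ ^ 2)
  have ha : ∀ k, IntegrableOn (a k) (Ioo 0 T) := fun k =>
    ((hi l k).add (hi w k)).add ((hi l (-k)).add (hi w (-k)))
  have ea : ∀ k, ∫ t in Ioo 0 T, a k t = (N l k + N w k) + (N l (-k) + N w (-k)) := fun k => by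
    exact integral_add_add (hi l k) (hi w k) (hi l (-k)) (hi w (-k))
  have hs1 : Summable fun k => N l k + N w k := (hN l).add (hN w)
  have hs2 : Summable fun k => N l (-k) + N w (-k) := (Equiv.neg ℤ).summable_iff.2 hs1
  obtain ⟨R, hR, hn⟩ := exists_contRep_of_energy hT b w (Equiv.neg ℤ)
    (c := fun k => c (fun x => (hartley k x : 𝕜))) (m := transportMode w l) (a := a)
    (integrableOn_transportMode w l)
    (fun k => by
      filter_upwards [h.mode k] with t ht
      rw [inner_eq_pairing_of_star (bs k)]
      exact ht)
    ha (fun k => by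
      refine Filter.Eventually.of_forall fun t => ?_
      rw [Equiv.neg_apply, inner_eq_pairing_of_star (bs k), inner_eq_pairing_of_star (bs (-k))]
      have e : star (transportMode w l k t) * pairing (w t) (b k) +
          star (pairing (w t) (b k)) * transportMode w l k t +
          (star (transportMode w l (-k) t) * pairing (w t) (b (-k)) +
            star (pairing (w t) (b (-k))) * transportMode w l (-k) t) =
          (star (pairing (l t) (b k)) * pairing (w t) (b k) +
            star (pairing (w t) (b k)) * pairing (l t) (b k)) +
          (star (pairing (l t) (b (-k))) * pairing (w t) (b (-k)) +
            star (pairing (w t) (b (-k))) * pairing (l t) (b (-k))) := by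
        simp only [transportMode, b, hartleyBasis_apply, neg_neg, star_add, star_mul',
          RCLike.star_def, RCLike.conj_ofReal, Int.cast_neg, mul_neg, map_neg]
        ring
      rw [e]
      exact (norm_add_le _ _).trans (add_le_add (norm_cross_le _ _) (norm_cross_le _ _)))
    (by simp_rw [ea]; exact hs1.add hs2)
  refine ⟨R, hR, hn.trans ?_⟩
  simp_rw [ea]
  have e2 : ∑' k, (N l (-k) + N w (-k)) = ∑' k, (N l k + N w k) :=
    (Equiv.neg ℤ).tsum_eq fun k => N l k + N w k
  rw [hs1.tsum_add hs2, e2, (hN l).tsum_add (hN w)]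
  have h1 := hN' l
  have h2 := hN' w
  have h3 : 0 ≤ T⁻¹ * ‖l‖ ^ 2 := by positivity
  nlinarith

/-- Formally the derivative of ∫ w z is ∫ (l z + w l') - ∫ (w z)_x, and the last term vanishes by
periodicity. Neither function is differentiable in x, so the cancellation is carried out between the
modes k and -k. -/
theorem WeakTransport.pairing_sub (hT : 0 < T) {w l z l' : TimeL2 T (SpaceL2 𝕜)}
    {c d : (ℝ → 𝕜) → 𝕜} (hw : WeakTransport w l c) (hz : WeakTransport z l' d)
    {W Z : TimeC T (SpaceL2 𝕜)} (hW : IsContRep W w) (hZ : IsContRep Z z) :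
    pairing (W ⟨T, hT.le, le_rfl⟩) (Z ⟨T, hT.le, le_rfl⟩) -
      pairing (W ⟨0, le_rfl, hT.le⟩) (Z ⟨0, le_rfl, hT.le⟩) =
      timePairing l z + timePairing w l' := by
  let b : HilbertBasis ℤ 𝕜 (SpaceL2 𝕜) := hartleyBasis
  have bs : ∀ k, star (b k) = b k := star_hartleyBasis
  let P : TimeL2 T (SpaceL2 𝕜) → TimeL2 T (SpaceL2 𝕜) → ℤ → ℝ → 𝕜 := fun x y k t =>
    pairing (x t) (b k) * pairing (y t) (b k)
  have hP : ∀ x y k, IntegrableOn (P x y k) (Ioo 0 T) := fun x y k =>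
    integrable_pairing_mul_pairing (bs k) x y
  have hS : ∀ x y, HasSum (fun k => ∫ t in Ioo 0 T, P x y k t) (timePairing x y) := fun x y =>
    hasSum_integral_pairing_mul_pairing b bs x y
  have hs1 := (hS l z).add (hS w l')
  have hs2 := hs1.add ((Equiv.neg ℤ).hasSum_iff.2 hs1)
  refine pairing_sub_pairing_of_modes hT b bs (Equiv.neg ℤ) hW hZ
    (m := transportMode w l) (n := transportMode z l')
    (β := fun k t => (P l z k t + P w l' k t) + (P l z (-k) t + P w l' (-k) t))
    (integrableOn_transportMode w l) (integrableOn_transportMode z l') hw.mode hz.mode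
    (fun k => Filter.Eventually.of_forall fun t => ?_) ?_
  · simp only [transportMode, P, b, hartleyBasis_apply, neg_neg, Int.cast_neg, mul_neg,
      RCLike.ofReal_neg, Equiv.neg_apply]
    ring
  · rw [two_mul]
    refine hs2.congr_fun fun k => ?_
    exact integral_add_add (hP l z k) (hP w l' k) (hP l z (-k)) (hP w l' (-k))

/-- This absorbs the unbounded factor of the diffusion modes: (j+1)π times a sine coefficient of w
is a coefficient of the L² function w'. -/
theorem pairing_h10Deriv_cosine (w : H10 𝕜) (j : ℕ) :
    pairing (h10Deriv w) (cosineBasis (j + 1)) =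
      (((j + 1) * Real.pi : ℝ) : 𝕜) * pairing (h10Val w) (sineBasis j) := by
  rw [cosineBasis_apply, realL2,
    pairing_h10Deriv w (contDiff_ofReal_comp (contDiff_cosineFn (j + 1))),
    deriv_ofReal_comp (hasDerivAt_cosineFn j),
    toL2_const_mul _ (contDiff_sineFn j).continuous, map_smul, sineBasis_apply]
  simp

/-- The derivative of an element of H¹₀ has mean zero. The constant function, which has no partner
among the sines, therefore contributes nothing. -/
theorem pairing_h10Deriv_cosine_zero (w : H10 𝕜) :
    pairing (h10Deriv w) (cosineBasis 0) = 0 := by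
  have e : (fun x => (cosineFn 0 x : 𝕜)) = fun _ => 1 := by ext; simp [cosineFn]
  have e0 : toL2 (fun _ : ℝ => (0 : 𝕜)) = 0 := by
    have h0 := toL2_smul (0 : 𝕜) (φ := fun _ : ℝ => (0 : 𝕜)) continuous_const
    rw [zero_smul, zero_smul] at h0
    exact h0
  rw [cosineBasis_apply, realL2, e, pairing_h10Deriv w contDiff_const]
  simp [e0]

/-- The derivative of the `j`-th mode of a solution of `w_t = l - k_x`. -/
def fluxMode (l k : TimeL2 T (SpaceL2 𝕜)) (j : ℕ) (s : ℝ) : 𝕜 :=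
  pairing (l s) (sineBasis j) +
    (((j + 1) * Real.pi : ℝ) : 𝕜) * pairing (k s) (cosineBasis (j + 1))

theorem integrableOn_fluxMode (l k : TimeL2 T (SpaceL2 𝕜)) (j : ℕ) :
    IntegrableOn (fluxMode l k j) (Ioo 0 T) :=
  (integrable_pairing_const l _).add ((integrable_pairing_const k _).const_mul _)

theorem WeakFlux.mode {w : TimeL2 T (H10 𝕜)} {l k : TimeL2 T (SpaceL2 𝕜)} {c : (ℝ → 𝕜) → 𝕜}
    (h : WeakFlux w l k c) (j : ℕ) : ∀ᵐ t ∂(timeMeasure T),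
      pairing (valCurve w t) (sineBasis j) = c (fun x => (sineFn j x : 𝕜)) +
        ∫ s in (0 : ℝ)..t, fluxMode l k j s := by
  have h1 := h (fun x => (sineFn j x : 𝕜)) (contDiff_ofReal_comp (contDiff_sineFn j))
    (by simp [sineFn_zero]) (by simp [sineFn_one])
  rw [deriv_ofReal_comp (hasDerivAt_sineFn j),
    toL2_const_mul (𝕜 := 𝕜) ((j + 1) * Real.pi) (contDiff_cosineFn (j + 1)).continuous] at h1
  filter_upwards [h1, valCurve_ae w] with t ht hv
  rw [sineBasis_apply, hv]
  refine ht.trans ?_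
  simp only [fluxMode, map_smul, smul_eq_mul, sineBasis_apply, cosineBasis_apply]
  rfl

/-- In the energy of mode j the factor (j+1)π of the flux coefficient is moved onto w, where it
yields a cosine coefficient of w_x. Everything left is a product of square summable coefficients. -/
theorem WeakFlux.exists_contRep (hT : 0 < T) {w : TimeL2 T (H10 𝕜)} {l k : TimeL2 T (SpaceL2 𝕜)}
    {c : (ℝ → 𝕜) → 𝕜} (h : WeakFlux w l k c) :
    ∃ R : TimeC T (SpaceL2 𝕜), IsContRep R (fun t => h10Val (w t)) ∧
      ‖R‖ ^ 2 ≤ (2 * T⁻¹ + 4) * (‖w‖ ^ 2 + ‖l‖ ^ 2 + ‖k‖ ^ 2) := by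
  have bs := star_sineBasis (𝕜 := 𝕜)
  have bc := star_cosineBasis (𝕜 := 𝕜)
  let N : TimeL2 T (SpaceL2 𝕜) → ℕ → ℝ := fun x j =>
    ∫ t in Ioo (0 : ℝ) T, ‖pairing (x t) (sineBasis j)‖ ^ 2
  let K : TimeL2 T (SpaceL2 𝕜) → ℕ → ℝ := fun x j =>
    ∫ t in Ioo (0 : ℝ) T, ‖pairing (x t) (cosineBasis j)‖ ^ 2
  have hN : ∀ x, Summable (N x) := fun x => summable_integral_norm_pairing_sq sineBasis bs x
  have hN' : ∀ x, ∑' j, N x j ≤ ‖x‖ ^ 2 := fun x =>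
    tsum_integral_norm_pairing_sq_le sineBasis bs x
  have hK1 : ∀ x, Summable (K x) := fun x => summable_integral_norm_pairing_sq cosineBasis bc x
  have hK : ∀ x, Summable fun j => K x (j + 1) := fun x => (summable_nat_add_iff 1).2 (hK1 x)
  have hK' : ∀ x, ∑' j, K x (j + 1) ≤ ‖x‖ ^ 2 := fun x => by
    refine le_trans ?_ (tsum_integral_norm_pairing_sq_le cosineBasis bc x)
    rw [(hK1 x).tsum_eq_zero_add]
    exact le_add_of_nonneg_left (integral_nonneg fun _ => sq_nonneg _)
  have hi : ∀ x : TimeL2 T (SpaceL2 𝕜), ∀ j,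
      Integrable (fun t => ‖pairing (x t) (sineBasis j)‖ ^ 2) (timeMeasure T) := fun x j =>
    integrable_norm_pairing_sq (bs j) x
  have hi' : ∀ x : TimeL2 T (SpaceL2 𝕜), ∀ j,
      Integrable (fun t => ‖pairing (x t) (cosineBasis j)‖ ^ 2) (timeMeasure T) := fun x j =>
    integrable_norm_pairing_sq (bc j) x
  let v := valCurve w
  let q := derivCurve w
  -- The sine modes are not coupled to one another, so the permutation is the identity and each mode
  -- is its own partner; this is the factor 2.
  let a : ℕ → ℝ → ℝ := fun j t =>
    2 * ((‖pairing (l t) (sineBasis j)‖ ^ 2 + ‖pairing (v t) (sineBasis j)‖ ^ 2) +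
      (‖pairing (k t) (cosineBasis (j + 1))‖ ^ 2 + ‖pairing (q t) (cosineBasis (j + 1))‖ ^ 2))
  have ha : ∀ j, IntegrableOn (a j) (Ioo 0 T) := fun j =>
    (((hi l j).add (hi v j)).add ((hi' k (j + 1)).add (hi' q (j + 1)))).const_mul 2
  have ea : ∀ j, ∫ t in Ioo 0 T, a j t =
      2 * ((N l j + N v j) + (K k (j + 1) + K q (j + 1))) := fun j => by
    simp only [a]
    rw [integral_const_mul]
    exact congrArg _ (integral_add_add (hi l j) (hi v j) (hi' k (j + 1)) (hi' q (j + 1)))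
  have hs1 : Summable fun j => N l j + N v j := (hN l).add (hN v)
  have hs2 : Summable fun j => K k (j + 1) + K q (j + 1) := (hK k).add (hK q)
  obtain ⟨R, hR, hn⟩ := exists_contRep_of_energy hT sineBasis v (Equiv.refl ℕ)
    (c := fun j => c (fun x => (sineFn j x : 𝕜))) (m := fluxMode l k) (a := a)
    (integrableOn_fluxMode l k)
    (fun j => by simpa only [inner_eq_pairing_of_star (bs j)] using h.mode j)
    ha (fun j => by
      filter_upwards [valCurve_ae w, derivCurve_ae w] with t h1 h2
      have h3 := pairing_h10Deriv_cosine (w t) j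
      rw [← h1, ← h2] at h3
      simp only [Equiv.refl_apply, inner_eq_pairing_of_star (bs _), a]
      have e : star (fluxMode l k j t) * pairing (v t) (sineBasis j) +
          star (pairing (v t) (sineBasis j)) * fluxMode l k j t =
          (star (pairing (l t) (sineBasis j)) * pairing (v t) (sineBasis j) +
            star (pairing (v t) (sineBasis j)) * pairing (l t) (sineBasis j)) +
          (star (pairing (k t) (cosineBasis (j + 1))) * pairing (q t) (cosineBasis (j + 1)) +
            star (pairing (q t) (cosineBasis (j + 1))) * pairing (k t) (cosineBasis (j + 1))) := by
        simp only [q, h3, fluxMode, star_add, star_mul', RCLike.star_def, RCLike.conj_ofReal, v]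
        ring
      rw [e, ← two_mul, norm_mul, RCLike.norm_ofNat]
      exact mul_le_mul_of_nonneg_left ((norm_add_le _ _).trans
        (add_le_add (norm_cross_le _ _) (norm_cross_le _ _))) zero_le_two)
    (by simp_rw [ea]; exact (hs1.add hs2).mul_left 2)
  refine ⟨R, hR.congr (valCurve_ae w), hn.trans ?_⟩
  simp_rw [ea]
  rw [tsum_mul_left, hs1.tsum_add hs2, (hN l).tsum_add (hN v), (hK k).tsum_add (hK q)]
  have h1 := hN' l
  have h2 := hN' v
  have h3 := hK' k
  have h4 := hK' q
  have h5 : ‖v‖ ^ 2 ≤ ‖w‖ ^ 2 := pow_le_pow_left₀ (norm_nonneg _) (norm_valCurve_le w) 2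
  have h6 : ‖q‖ ^ 2 ≤ ‖w‖ ^ 2 := pow_le_pow_left₀ (norm_nonneg _) (norm_derivCurve_le w) 2
  have hT' : 0 < T⁻¹ := inv_pos.2 hT
  have h7 : 2 * T⁻¹ * ‖v‖ ^ 2 ≤ 2 * T⁻¹ * (‖w‖ ^ 2 + ‖l‖ ^ 2 + ‖k‖ ^ 2) := by
    gcongr
    nlinarith [sq_nonneg ‖l‖, sq_nonneg ‖k‖]
  nlinarith [sq_nonneg ‖l‖, sq_nonneg ‖k‖]

/-- The formal identity is d/dt ∫ w z = ∫ (l z + w l') + ∫ (k z_x + w_x k'), integrated by parts in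
x with zero boundary values. The sources act on sine coefficients and the fluxes on cosine
coefficients of positive index. -/
theorem WeakFlux.pairing_sub (hT : 0 < T) {w z : TimeL2 T (H10 𝕜)}
    {l k l' k' : TimeL2 T (SpaceL2 𝕜)} {c d : (ℝ → 𝕜) → 𝕜} (hw : WeakFlux w l k c)
    (hz : WeakFlux z l' k' d) {W Z : TimeC T (SpaceL2 𝕜)}
    (hW : IsContRep W fun t => h10Val (w t)) (hZ : IsContRep Z fun t => h10Val (z t)) :
    pairing (W ⟨T, hT.le, le_rfl⟩) (Z ⟨T, hT.le, le_rfl⟩) -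
      pairing (W ⟨0, le_rfl, hT.le⟩) (Z ⟨0, le_rfl, hT.le⟩) =
      (timePairing l (valCurve z) + timePairing (valCurve w) l') +
        (timePairing k (derivCurve z) + timePairing (derivCurve w) k') := by
  have bs := star_sineBasis (𝕜 := 𝕜)
  have bc := star_cosineBasis (𝕜 := 𝕜)
  let P : TimeL2 T (SpaceL2 𝕜) → TimeL2 T (SpaceL2 𝕜) → ℕ → ℝ → 𝕜 := fun x y j t =>
    pairing (x t) (sineBasis j) * pairing (y t) (sineBasis j)
  let Q : TimeL2 T (SpaceL2 𝕜) → TimeL2 T (SpaceL2 𝕜) → ℕ → ℝ → 𝕜 := fun x y j t =>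
    pairing (x t) (cosineBasis j) * pairing (y t) (cosineBasis j)
  have hP : ∀ x y j, IntegrableOn (P x y j) (Ioo 0 T) := fun x y j =>
    integrable_pairing_mul_pairing (bs j) x y
  have hQ : ∀ x y j, IntegrableOn (Q x y j) (Ioo 0 T) := fun x y j =>
    integrable_pairing_mul_pairing (bc j) x y
  have hS : ∀ x y, HasSum (fun j => ∫ t in Ioo 0 T, P x y j t) (timePairing x y) := fun x y =>
    hasSum_integral_pairing_mul_pairing sineBasis bs x y
  have hC : ∀ (x : TimeL2 T (SpaceL2 𝕜)) (y : TimeL2 T (H10 𝕜)),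
      HasSum (fun j => ∫ t in Ioo 0 T, Q x (derivCurve y) (j + 1) t)
        (timePairing x (derivCurve y)) := fun x y => by
    have h1 := hasSum_integral_pairing_mul_pairing cosineBasis bc x (derivCurve y)
    have h2 := (hasSum_nat_add_iff' 1).2 h1
    have h0 : ∫ t in Ioo (0 : ℝ) T, pairing (x t) (cosineBasis 0) *
        pairing (derivCurve y t) (cosineBasis 0) = 0 := by
      rw [← integral_zero ℝ 𝕜 (μ := timeMeasure T)]
      refine integral_congr_ae ?_
      filter_upwards [derivCurve_ae y] with t ht
      rw [ht, pairing_h10Deriv_cosine_zero, mul_zero]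
    simpa [h0] using h2
  have hC' : HasSum (fun j => ∫ t in Ioo 0 T, Q (derivCurve w) k' (j + 1) t)
      (timePairing (derivCurve w) k') := by
    have h1 := hC k' w
    rw [timePairing_comm] at h1
    exact h1.congr_fun fun j => integral_congr_ae (Filter.Eventually.of_forall fun t => mul_comm _ _)
  have hs := ((hS l (valCurve z)).add (hS (valCurve w) l')).add ((hC k z).add hC')
  refine pairing_sub_pairing_of_modes hT sineBasis bs (Equiv.refl ℕ)
    (hW.congr (by filter_upwards [valCurve_ae w] with t ht using ht.symm))
    (hZ.congr (by filter_upwards [valCurve_ae z] with t ht using ht.symm))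
    (m := fluxMode l k) (n := fluxMode l' k')
    (β := fun j t => 2 * ((P l (valCurve z) j t + P (valCurve w) l' j t) +
      (Q k (derivCurve z) (j + 1) t + Q (derivCurve w) k' (j + 1) t)))
    (integrableOn_fluxMode l k) (integrableOn_fluxMode l' k') hw.mode hz.mode (fun j => ?_) ?_
  · filter_upwards [valCurve_ae w, derivCurve_ae w, valCurve_ae z, derivCurve_ae z]
      with t h1 h2 h3 h4
    have h5 := pairing_h10Deriv_cosine (w t) j
    have h6 := pairing_h10Deriv_cosine (z t) j
    rw [← h1, ← h2] at h5
    rw [← h3, ← h4] at h6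
    simp only [Equiv.refl_apply, fluxMode, P, Q, h5, h6]
    ring
  · refine (hs.mul_left 2).congr_fun fun j => ?_
    rw [integral_const_mul]
    exact congrArg _ (integral_add_add (hP l _ j) (hP _ l' j) (hQ k _ _) (hQ _ k' _))

end WeakEquations

/-! ### Lions' projection theorem -/

section Projection

/-- Lions' projection theorem. -/
theorem exists_inner_eq_of_norm_le {𝕜 Φ E F : Type*} [RCLike 𝕜] [AddCommGroup Φ] [Module 𝕜 Φ]
    [NormedAddCommGroup E] [InnerProductSpace 𝕜 E] [CompleteSpace E]
    [NormedAddCommGroup F] [InnerProductSpace 𝕜 F] (S : Φ →ₗ[𝕜] E) (N : Φ →ₗ[𝕜] F) {C : ℝ}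
    (hC : 0 ≤ C) (h : ∀ φ, ‖N φ‖ ≤ C * ‖S φ‖) (y : F) :
    ∃ u : E, ‖u‖ ≤ C * ‖y‖ ∧ ∀ φ, inner 𝕜 (S φ) u = inner 𝕜 (N φ) y := by
  let g : Φ →ₗ[𝕜] 𝕜 := (innerSL 𝕜 y).toLinearMap ∘ₗ N
  -- The estimate forces N φ = 0 whenever S φ = 0, so the functional descends to the range of S.
  have hg : S.ker ≤ g.ker := fun φ hφ => by
    have h1 := h φ
    rw [LinearMap.mem_ker.1 hφ, norm_zero, mul_zero] at h1
    have h2 : N φ = 0 := norm_le_zero_iff.1 h1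
    simp [g, h2]
  let f₀ : S.range →ₗ[𝕜] 𝕜 := (S.ker.liftQ g hg) ∘ₗ S.quotKerEquivRange.symm.toLinearMap
  have hf₀ : ∀ φ, f₀ ⟨S φ, φ, rfl⟩ = g φ := fun φ => by
    have e : S.quotKerEquivRange (Submodule.Quotient.mk φ) = ⟨S φ, φ, rfl⟩ :=
      Subtype.ext (S.quotKerEquivRange_apply_mk φ)
    simp only [f₀, LinearMap.comp_apply, LinearEquiv.coe_coe]
    rw [← e, LinearEquiv.symm_apply_apply]
    rfl
  let f : S.range →L[𝕜] 𝕜 := f₀.mkContinuous (C * ‖y‖) (by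
    rintro ⟨_, φ, rfl⟩
    rw [hf₀]
    calc ‖g φ‖ ≤ ‖y‖ * ‖N φ‖ := norm_inner_le_norm _ _
      _ ≤ ‖y‖ * (C * ‖S φ‖) := by gcongr; exact h φ
      _ = C * ‖y‖ * ‖S φ‖ := by ring)
  -- The range need not be closed: the functional is extended with the same norm by Hahn–Banach and
  -- then represented by Riesz.
  obtain ⟨f', hf', hn⟩ := exists_extension_norm_eq S.range f
  refine ⟨(InnerProductSpace.toDual 𝕜 E).symm f', ?_, fun φ => ?_⟩
  · rw [LinearIsometryEquiv.norm_map, hn]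
    exact LinearMap.mkContinuous_norm_le _ (by positivity) _
  · rw [← inner_conj_symm, InnerProductSpace.toDual_symm_apply, ← inner_conj_symm (N φ)]
    congr 1
    have := hf' ⟨S φ, φ, rfl⟩
    rw [this]
    exact hf₀ φ

end Projection

/-! ### Abstract backward evolution equations -/

section Evolution

variable {T : ℝ}

/-- The class in `L²(0,T;E)` of a function (zero if the function is not square integrable). -/
def toTimeL2 (T : ℝ) {E : Type*} [NormedAddCommGroup E] (φ : ℝ → E) : TimeL2 T E :=
  open Classical in if h : MemLp φ 2 (timeMeasure T) then h.toLp φ else 0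

theorem toTimeL2_ae' {E : Type*} [NormedAddCommGroup E] {φ : ℝ → E}
    (h : MemLp φ 2 (timeMeasure T)) : toTimeL2 T φ =ᵐ[timeMeasure T] φ := by
  rw [toTimeL2, dif_pos h]
  exact h.coeFn_toLp

theorem toTimeL2_ae {E : Type*} [NormedAddCommGroup E] {φ : ℝ → E} (h : Continuous φ) :
    toTimeL2 T φ =ᵐ[timeMeasure T] φ :=
  toTimeL2_ae' (memLp_time_of_continuousOn h.continuousOn)

theorem toTimeL2_add {E : Type*} [NormedAddCommGroup E] {φ ψ : ℝ → E} (h : Continuous φ)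
    (h' : Continuous ψ) : toTimeL2 T (φ + ψ) = toTimeL2 T φ + toTimeL2 T ψ := by
  refine Lp.ext ?_
  filter_upwards [toTimeL2_ae (T := T) h, toTimeL2_ae (T := T) h', toTimeL2_ae (T := T) (h.add h'),
    Lp.coeFn_add (toTimeL2 T φ) (toTimeL2 T ψ)] with x h1 h2 h3 h4
  rw [h3, h4, Pi.add_apply, Pi.add_apply, h1, h2]

theorem toTimeL2_smul {𝕜 E : Type*} [RCLike 𝕜] [NormedAddCommGroup E] [NormedSpace 𝕜 E]
    {φ : ℝ → E} (c : 𝕜) (h : Continuous φ) : toTimeL2 T (c • φ) = c • toTimeL2 T φ := by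
  refine Lp.ext ?_
  filter_upwards [toTimeL2_ae (T := T) h, toTimeL2_ae (T := T) (h.const_smul c),
    Lp.coeFn_smul c (toTimeL2 T φ)] with x h1 h3 h4
  rw [h4, Pi.smul_apply, h1]
  exact h3

variable {𝕜 W H D : Type*} [RCLike 𝕜]
  [NormedAddCommGroup W] [InnerProductSpace 𝕜 W] [CompleteSpace W]
  [NormedAddCommGroup H] [InnerProductSpace 𝕜 H] [CompleteSpace H] [NormedSpace ℝ H]
  [IsScalarTower ℝ 𝕜 H]
  [AddCommGroup D] [Module 𝕜 D]

/-- Regular test curves with values in a space of test functions, vanishing at time `0`, with their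
derivatives. -/
def testCurves (i a : D →ₗ[𝕜] W) (j : D →ₗ[𝕜] H) : Submodule 𝕜 ((ℝ → D) × (ℝ → D)) where
  carrier := {ψ | (Continuous fun t => i (ψ.1 t)) ∧ (Continuous fun t => a (ψ.1 t)) ∧
    (Continuous fun t => j (ψ.2 t)) ∧ (∀ t, HasDerivAt (fun t => j (ψ.1 t)) (j (ψ.2 t)) t) ∧
    ψ.1 0 = 0}
  add_mem' := by
    rintro ψ φ ⟨h1, h2, h3, h4, h5⟩ ⟨h1', h2', h3', h4', h5'⟩
    refine ⟨?_, ?_, ?_, fun t => ?_, ?_⟩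
    · simp only [Prod.fst_add, Pi.add_apply, map_add]
      exact h1.add h1'
    · simp only [Prod.fst_add, Pi.add_apply, map_add]
      exact h2.add h2'
    · simp only [Prod.snd_add, Pi.add_apply, map_add]
      exact h3.add h3'
    · simp only [Prod.fst_add, Prod.snd_add, Pi.add_apply, map_add]
      exact (h4 t).add (h4' t)
    · simp [h5, h5']
  zero_mem' := by
    refine ⟨?_, ?_, ?_, fun t => ?_, ?_⟩
    · simpa using continuous_const
    · simpa using continuous_const
    · simpa using continuous_const
    · simpa using hasDerivAt_const t (0 : H)
    · simp
  smul_mem' := by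
    rintro c ψ ⟨h1, h2, h3, h4, h5⟩
    refine ⟨?_, ?_, ?_, fun t => ?_, ?_⟩
    · simp only [Prod.smul_fst, Pi.smul_apply, map_smul]
      exact h1.const_smul c
    · simp only [Prod.smul_fst, Pi.smul_apply, map_smul]
      exact h2.const_smul c
    · simp only [Prod.smul_snd, Pi.smul_apply, map_smul]
      exact h3.const_smul c
    · simp only [Prod.smul_fst, Prod.smul_snd, Pi.smul_apply, map_smul]
      exact (h4 t).const_smul c
    · simp [h5]

theorem continuous_evolutionOp {i a : D →ₗ[𝕜] W} {j : D →ₗ[𝕜] H} (K : W →L[𝕜] H)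
    (ψ : testCurves i a j) :
    Continuous ((fun t => K.adjoint (j (ψ.1.2 t))) + fun t => a (ψ.1.1 t)) :=
  (K.adjoint.continuous.comp ψ.2.2.2.1).add ψ.2.2.1

/-- The adjoint evolution operator acting on test curves. -/
def evolutionOp (T : ℝ) (i a : D →ₗ[𝕜] W) (j : D →ₗ[𝕜] H) (K : W →L[𝕜] H) :
    testCurves i a j →ₗ[𝕜] TimeL2 T W where
  toFun ψ := toTimeL2 T ((fun t => K.adjoint (j (ψ.1.2 t))) + fun t => a (ψ.1.1 t))
  map_add' ψ φ := by
    rw [← toTimeL2_add (continuous_evolutionOp K ψ) (continuous_evolutionOp K φ)]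
    congr 1
    ext t
    simp
    abel
  map_smul' c ψ := by
    rw [RingHom.id_apply, ← toTimeL2_smul c (continuous_evolutionOp K ψ)]
    congr 1
    ext t
    simp

/-- The values of a test curve and its final value. -/
def evolutionTest (T : ℝ) (i a : D →ₗ[𝕜] W) (j : D →ₗ[𝕜] H) :
    testCurves i a j →ₗ[𝕜] WithLp 2 (TimeL2 T W × H) where
  toFun ψ := WithLp.toLp 2 (toTimeL2 T (fun t => i (ψ.1.1 t)), j (ψ.1.1 T))
  map_add' ψ φ := by
    rw [← WithLp.toLp_add, Prod.mk_add_mk, ← toTimeL2_add ψ.2.1 φ.2.1, ← map_add]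
    congr 3
    ext t
    simp
  map_smul' c ψ := by
    rw [RingHom.id_apply, ← WithLp.toLp_smul, Prod.smul_mk, ← toTimeL2_smul c ψ.2.1, ← map_smul]
    congr 3
    ext t
    simp

/-- The form controls only the difference of the two squared norms. Pairing the operator with (1 + T
- t) times the test curve supplies the rest: the slope of the weight produces half the integral of
‖j ψ‖², and its value 1 at T produces half of the final energy. Altogether half of ‖N‖² is bounded
by (1+T)‖N‖‖S‖. -/
theorem norm_evolutionTest_le (hT : 0 < T) (i a : D →ₗ[𝕜] W) (j : D →ₗ[𝕜] H) (K : W →L[𝕜] H)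
    (hK : ∀ d, K (i d) = j d) (hij : ∀ d, ‖j d‖ ≤ ‖i d‖)
    (ha : ∀ d, ‖i d‖ ^ 2 - ‖j d‖ ^ 2 ≤ RCLike.re (inner 𝕜 (i d) (a d)))
    (ψ : testCurves i a j) :
    ‖evolutionTest T i a j ψ‖ ≤ 2 * (1 + T) * ‖evolutionOp T i a j K ψ‖ := by
  obtain ⟨ψ, hi, hac, hj', hd, h0⟩ := ψ
  set N := evolutionTest T i a j ⟨ψ, hi, hac, hj', hd, h0⟩ with hN
  set S := evolutionOp T i a j K ⟨ψ, hi, hac, hj', hd, h0⟩ with hS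
  -- Decreasing with slope -1 and at least 1 on [0,T]; the lower bound lets the dissipation be kept
  -- with coefficient 1.
  let n : ℝ → ℝ := fun t => 1 + T - t
  let I : TimeL2 T W := toTimeL2 T fun t => i (ψ.1 t)
  have hjc : Continuous fun t => j (ψ.1 t) := by
    simp_rw [← hK]; exact K.continuous.comp hi
  have hIae : I =ᵐ[timeMeasure T] fun t => i (ψ.1 t) := toTimeL2_ae hi
  have hnic : Continuous fun t => ((n t : ℝ) : 𝕜) • i (ψ.1 t) :=
    Continuous.smul (RCLike.continuous_ofReal.comp (by fun_prop)) hi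
  let I' : TimeL2 T W := toTimeL2 T fun t => ((n t : ℝ) : 𝕜) • i (ψ.1 t)
  have hI'ae : I' =ᵐ[timeMeasure T] fun t => ((n t : ℝ) : 𝕜) • i (ψ.1 t) := toTimeL2_ae hnic
  have hSae : S =ᵐ[timeMeasure T] fun t => K.adjoint (j (ψ.2 t)) + a (ψ.1 t) :=
    toTimeL2_ae ((K.adjoint.continuous.comp hj').add hac)
  have hI'n : ‖I'‖ ≤ (1 + T) * ‖I‖ := by
    refine Lp.norm_le_mul_norm_of_ae_le_mul ?_
    filter_upwards [hIae, hI'ae, ae_restrict_mem measurableSet_Ioo] with t h1 h2 h3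
    rw [h1, h2, norm_smul, RCLike.norm_ofReal]
    gcongr
    rw [abs_of_nonneg (by simp only [n]; linarith [h3.2])]
    simp only [n]
    linarith [h3.1]
  have hNsq : ‖N‖ ^ 2 = ‖I‖ ^ 2 + ‖j (ψ.1 T)‖ ^ 2 := WithLp.prod_norm_sq_eq_of_L2 _
  have hIN : ‖I‖ ≤ ‖N‖ := by
    refine abs_le_of_sq_le_sq' ?_ (norm_nonneg _) |>.2
    rw [hNsq]; nlinarith [sq_nonneg ‖j (ψ.1 T)‖]
  let e : ℝ → ℝ := fun t => ‖j (ψ.1 t)‖ ^ 2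
  let e' : ℝ → ℝ := fun t => 2 * RCLike.re (inner 𝕜 (j (ψ.1 t)) (j (ψ.2 t)))
  have hee : ∀ t, HasDerivAt e (e' t) t := fun t => by
    have h1 := (hd t).inner 𝕜 (hd t)
    have h2 := (RCLike.reCLM (K := 𝕜)).hasFDerivAt.comp_hasDerivAt t h1
    refine (h2.congr_deriv ?_).congr_of_eventuallyEq (Filter.Eventually.of_forall fun s => ?_)
    · simp only [RCLike.reCLM_apply, map_add, e']
      rw [← inner_conj_symm (j (ψ.2 t)) (j (ψ.1 t)), RCLike.conj_re]
      ring
    · simp only [e, Function.comp, RCLike.reCLM_apply]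
      rw [inner_self_eq_norm_sq]
  have hec : Continuous e := hjc.norm.pow 2
  have he'c : Continuous e' := by
    have : Continuous fun t => inner 𝕜 (j (ψ.1 t)) (j (ψ.2 t)) := hjc.inner hj'
    exact (RCLike.continuous_re.comp this).const_mul 2 |>.congr fun t => rfl
  have he0 : e 0 = 0 := by simp [e, h0]
  have hparts : ∫ t in (0 : ℝ)..T, n t * e' t = e T + ∫ t in (0 : ℝ)..T, e t := by
    have h1 := intervalIntegral.integral_mul_deriv_eq_deriv_mul (a := 0) (b := T) (u := n)
      (v := e) (u' := fun _ => -1) (v' := e')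
      (fun t _ => by simpa [n] using (hasDerivAt_id t).const_sub (1 + T)) (fun t _ => hee t)
      (by simp) (he'c.intervalIntegrable _ _)
    rw [h1, he0]
    simp [n]
  have hre : RCLike.re (inner 𝕜 I' S) = ∫ t in (0 : ℝ)..T,
      (n t * e' t / 2 + n t * RCLike.re (inner 𝕜 (i (ψ.1 t)) (a (ψ.1 t)))) := by
    rw [L2.inner_def, ← integral_re (L2.integrable_inner I' S), intervalIntegral.integral_of_le hT.le,
      integral_Ioc_eq_integral_Ioo]
    refine integral_congr_ae ?_
    filter_upwards [hI'ae, hSae] with t h1 h2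
    rw [h1, h2, inner_smul_left, RCLike.conj_ofReal, RCLike.re_ofReal_mul, inner_add_right,
      ContinuousLinearMap.adjoint_inner_right, hK, map_add]
    simp only [e']
    ring
  have hac' : Continuous fun t => RCLike.re (inner 𝕜 (i (ψ.1 t)) (a (ψ.1 t))) :=
    RCLike.continuous_re.comp (hi.inner hac)
  have hnc : Continuous n := by fun_prop
  have hlow : ∫ t in (0 : ℝ)..T, (n t * e' t / 2 + (‖i (ψ.1 t)‖ ^ 2 - e t)) ≤
      RCLike.re (inner 𝕜 I' S) := by
    rw [hre]
    refine intervalIntegral.integral_mono_on hT.le ?_ ?_ fun t ht => ?_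
    · exact (((hnc.mul he'c).div_const 2).add ((hi.norm.pow 2).sub hec)).intervalIntegrable _ _
    · exact (((hnc.mul he'c).div_const 2).add (hnc.mul hac')).intervalIntegrable _ _
    · have h1 : 1 ≤ n t := by simp only [n]; linarith [ht.2]
      have h2 := ha (ψ.1 t)
      have h3 : 0 ≤ ‖i (ψ.1 t)‖ ^ 2 - ‖j (ψ.1 t)‖ ^ 2 :=
        sub_nonneg.2 (pow_le_pow_left₀ (norm_nonneg _) (hij _) 2)
      simp only [e]
      nlinarith
  have hcalc : ∫ t in (0 : ℝ)..T, (n t * e' t / 2 + (‖i (ψ.1 t)‖ ^ 2 - e t)) =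
      (e T - ∫ t in (0 : ℝ)..T, e t) / 2 + ‖I‖ ^ 2 := by
    have hI2 : ‖I‖ ^ 2 = ∫ t in (0 : ℝ)..T, ‖i (ψ.1 t)‖ ^ 2 := by
      rw [norm_sq_Lp_two, intervalIntegral.integral_of_le hT.le, integral_Ioc_eq_integral_Ioo]
      refine integral_congr_ae ?_
      filter_upwards [hIae] with t h1
      rw [h1]
    have c1 : Continuous fun t => n t * e' t / 2 := (hnc.mul he'c).div_const 2
    have c3 : Continuous fun t => ‖i (ψ.1 t)‖ ^ 2 := hi.norm.pow 2
    have c2 : Continuous fun t => ‖i (ψ.1 t)‖ ^ 2 - e t := (hi.norm.pow 2).sub hec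
    rw [intervalIntegral.integral_add (c1.intervalIntegrable _ _)
      (c2.intervalIntegrable _ _), intervalIntegral.integral_div, hparts,
      intervalIntegral.integral_sub (c3.intervalIntegrable _ _)
      (hec.intervalIntegrable _ _), hI2]
    ring
  have heI : ∫ t in (0 : ℝ)..T, e t ≤ ‖I‖ ^ 2 := by
    rw [norm_sq_Lp_two, ← integral_Ioc_eq_integral_Ioo, ← intervalIntegral.integral_of_le hT.le]
    have h1 : ∫ t in (0 : ℝ)..T, ‖I t‖ ^ 2 = ∫ t in (0 : ℝ)..T, ‖i (ψ.1 t)‖ ^ 2 := by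
      rw [intervalIntegral.integral_of_le hT.le, intervalIntegral.integral_of_le hT.le,
        integral_Ioc_eq_integral_Ioo, integral_Ioc_eq_integral_Ioo]
      refine integral_congr_ae ?_
      filter_upwards [hIae] with t h1
      rw [h1]
    rw [h1]
    refine intervalIntegral.integral_mono_on hT.le (hec.intervalIntegrable _ _)
      ((hi.norm.pow 2).intervalIntegrable _ _) fun t _ => ?_
    exact pow_le_pow_left₀ (norm_nonneg _) (hij _) 2
  have hup : RCLike.re (inner 𝕜 I' S) ≤ (1 + T) * ‖N‖ * ‖S‖ := by
    refine (RCLike.re_le_norm _).trans ((norm_inner_le_norm _ _).trans ?_)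
    gcongr
    exact hI'n.trans (by gcongr)
  have heT : e T = ‖j (ψ.1 T)‖ ^ 2 := rfl
  have hfin : ‖N‖ * ‖N‖ ≤ ‖N‖ * (2 * (1 + T) * ‖S‖) := by nlinarith
  rcases (norm_nonneg N).eq_or_lt with h | h
  · rw [← h]; positivity
  · exact le_of_mul_le_mul_left hfin h

/-- Existence of a weak solution of a backward evolution equation with prescribed final value. -/
theorem exists_backward_evolution (hT : 0 < T) (i a : D →ₗ[𝕜] W) (j : D →ₗ[𝕜] H)
    (K : W →L[𝕜] H) (hK : ∀ d, K (i d) = j d) (hij : ∀ d, ‖j d‖ ≤ ‖i d‖)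
    (ha : ∀ d, ‖i d‖ ^ 2 - ‖j d‖ ^ 2 ≤ RCLike.re (inner 𝕜 (i d) (a d)))
    (F : TimeL2 T W) (u : H) :
    ∃ U : TimeL2 T W, ‖U‖ ≤ 2 * (1 + T) * (‖F‖ + ‖u‖) ∧ ∀ d, ∀ᵐ t ∂(timeMeasure T),
      inner 𝕜 (j d) (K (U t)) = inner 𝕜 (j d) u +
        ∫ s in t..T, (inner 𝕜 (i d) (F s) - inner 𝕜 (a d) (U s)) := by
  obtain ⟨U, hU, hUe⟩ := exists_inner_eq_of_norm_le (evolutionOp T i a j K) (evolutionTest T i a j)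
    (C := 2 * (1 + T)) (by positivity) (norm_evolutionTest_le hT i a j K hK hij ha)
    (WithLp.toLp 2 (F, u))
  refine ⟨U, hU.trans ?_, fun d => ?_⟩
  · gcongr
    refine abs_le_of_sq_le_sq' ?_ (by positivity) |>.2
    rw [WithLp.prod_norm_sq_eq_of_L2]
    change ‖F‖ ^ 2 + ‖u‖ ^ 2 ≤ _
    nlinarith [norm_nonneg F, norm_nonneg u]
  let G : ℝ → 𝕜 := fun s => inner 𝕜 (i d) (F s) - inner 𝕜 (a d) (U s)
  have hGi : IntegrableOn G (Ioo 0 T) :=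
    ((innerSL 𝕜 (i d)).integrable_comp (integrable_timeL2 F)).sub
      ((innerSL 𝕜 (a d)).integrable_comp (integrable_timeL2 U))
  have hUi : IntegrableOn (fun t => inner 𝕜 (j d) (K (U t))) (Ioo 0 T) :=
    ((innerSL 𝕜 (j d)).comp K).integrable_comp (integrable_timeL2 U)
  let Γ : ℝ → 𝕜 := fun t => ∫ s in (0 : ℝ)..t, G s
  have hΓc : ContinuousOn Γ (Icc 0 T) := continuousOn_primitive hT.le hGi
  -- The defect of the claimed identity, to be annihilated by all smooth q with compact support in
  -- (0,T).
  let R : ℝ → 𝕜 := fun t => inner 𝕜 (j d) (K (U t)) - inner 𝕜 (j d) u - (Γ T - Γ t)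
  have hRi : IntegrableOn R (Ioo 0 T) :=
    (hUi.sub (integrableOn_const (by simp))).sub
      ((integrableOn_const (by simp)).sub (hΓc.integrableOn_Icc.mono_set Ioo_subset_Icc_self))
  have hR : ∀ᵐ t ∂volume, t ∈ Ioo 0 T → R t = 0 := by
    refine isOpen_Ioo.ae_eq_zero_of_integral_contDiff_smul_eq_zero hRi.locallyIntegrableOn
      fun q hq hqc hqs => ?_
    -- The primitive vanishes at 0, as required of test curves, but not necessarily at T. The value
    -- θ(T) is what brings in the final datum u.
    let θ : ℝ → ℝ := fun t => ∫ s in (0 : ℝ)..t, q s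
    have hθd : ∀ t, HasDerivAt θ (q t) t := fun t =>
      intervalIntegral.integral_hasDerivAt_right (hq.continuous.intervalIntegrable _ _)
        hq.continuous.aestronglyMeasurable.stronglyMeasurableAtFilter hq.continuous.continuousAt
    have hθc : Continuous θ := continuous_iff_continuousAt.2 fun t => (hθd t).continuousAt
    have hθ0 : θ 0 = 0 := by simp [θ]
    have hmem : ((fun t => ((θ t : ℝ) : 𝕜) • d), (fun t => ((q t : ℝ) : 𝕜) • d)) ∈
        testCurves i a j := by
      refine ⟨?_, ?_, ?_, fun t => ?_, ?_⟩
      · simp only [map_smul]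
        exact (RCLike.continuous_ofReal.comp hθc).smul continuous_const
      · simp only [map_smul]
        exact (RCLike.continuous_ofReal.comp hθc).smul continuous_const
      · simp only [map_smul]
        exact (RCLike.continuous_ofReal.comp hq.continuous).smul continuous_const
      · simp only [map_smul]
        simp_rw [← RCLike.real_smul_eq_coe_smul (K := 𝕜)]
        exact (hθd t).smul_const (j d)
      · simp [hθ0]
    have key := hUe ⟨_, hmem⟩
    have e1 : inner 𝕜 (evolutionOp T i a j K ⟨_, hmem⟩) U = ∫ t in Ioo 0 T,
        (((q t : ℝ) : 𝕜) * inner 𝕜 (j d) (K (U t)) + ((θ t : ℝ) : 𝕜) * inner 𝕜 (a d) (U t)) := by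
      rw [L2.inner_def]
      refine integral_congr_ae ?_
      have hS : evolutionOp T i a j K ⟨_, hmem⟩ =ᵐ[timeMeasure T] fun t =>
          K.adjoint (j (((q t : ℝ) : 𝕜) • d)) + a (((θ t : ℝ) : 𝕜) • d) :=
        toTimeL2_ae ((K.adjoint.continuous.comp hmem.2.2.1).add hmem.2.1)
      filter_upwards [hS] with t ht
      rw [ht, inner_add_left, ContinuousLinearMap.adjoint_inner_left, map_smul, map_smul,
        inner_smul_left, inner_smul_left, RCLike.conj_ofReal, RCLike.conj_ofReal]
    have e2 : inner 𝕜 (evolutionTest T i a j ⟨_, hmem⟩) (WithLp.toLp 2 (F, u)) =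
        (∫ t in Ioo 0 T, ((θ t : ℝ) : 𝕜) * inner 𝕜 (i d) (F t)) +
          ((θ T : ℝ) : 𝕜) * inner 𝕜 (j d) u := by
      rw [WithLp.prod_inner_apply]
      congr 1
      · rw [L2.inner_def]
        refine integral_congr_ae ?_
        have hI : toTimeL2 T (fun t => i (((θ t : ℝ) : 𝕜) • d)) =ᵐ[timeMeasure T] fun t =>
          i (((θ t : ℝ) : 𝕜) • d) := toTimeL2_ae hmem.1
        filter_upwards [hI] with t ht
        refine (congrArg (fun z => inner 𝕜 z (F t)) ht).trans ?_
        rw [map_smul, inner_smul_left, RCLike.conj_ofReal]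
      · change inner 𝕜 (j (((θ T : ℝ) : 𝕜) • d)) u = _
        rw [map_smul, inner_smul_left, RCLike.conj_ofReal]
    rw [e1, e2] at key
    have hqi : ∀ f : ℝ → 𝕜, IntegrableOn f (Ioo 0 T) → ∀ p : ℝ → ℝ, Continuous p →
        IntegrableOn (fun t => ((p t : ℝ) : 𝕜) * f t) (Ioo 0 T) := fun f hf p hp => by
      obtain ⟨C, hC⟩ := (isCompact_Icc (a := (0 : ℝ)) (b := T)).exists_bound_of_continuousOn
        hp.continuousOn
      refine Integrable.bdd_mul (c := C) hf
        (RCLike.continuous_ofReal.comp hp).aestronglyMeasurable ?_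
      filter_upwards [ae_restrict_mem measurableSet_Ioo] with t ht
      rw [RCLike.norm_ofReal]
      exact hC t (Ioo_subset_Icc_self ht)
    have hFi : IntegrableOn (fun t => inner 𝕜 (i d) (F t)) (Ioo 0 T) :=
      (innerSL 𝕜 (i d)).integrable_comp (integrable_timeL2 F)
    have hUai : IntegrableOn (fun t => inner 𝕜 (a d) (U t)) (Ioo 0 T) :=
      (innerSL 𝕜 (a d)).integrable_comp (integrable_timeL2 U)
    rw [integral_add (hqi _ hUi _ hq.continuous) (hqi _ hUai _ hθc)] at key
    have hθT : ((θ T : ℝ) : 𝕜) = ∫ t in Ioo 0 T, ((q t : ℝ) : 𝕜) := by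
      simp only [θ]
      rw [intervalIntegral.integral_of_le hT.le, integral_Ioc_eq_integral_Ioo, ← integral_ofReal]
    have hparts := mul_primitive_eq (F := fun t => ((θ t : ℝ) : 𝕜)) (G := Γ) (T := T) (t := T)
      (f := fun t => ((q t : ℝ) : 𝕜)) (g := G)
      ⟨hT.le, le_rfl⟩ ((RCLike.continuous_ofReal.comp hq.continuous).integrableOn_Icc.mono_set
        Ioo_subset_Icc_self) hGi
      (fun t ht => by
        simp only [θ, intervalIntegral.integral_same, RCLike.ofReal_zero, zero_add]
        rw [intervalIntegral.integral_of_le ht.1, intervalIntegral.integral_of_le ht.1,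
          integral_ofReal])
      (fun t _ => by simp [Γ])
    have hΓ0 : Γ 0 = 0 := by simp [Γ]
    have hqΓ : IntegrableOn (fun t => ((q t : ℝ) : 𝕜) * Γ t) (Ioo 0 T) :=
      hqi _ (hΓc.integrableOn_Icc.mono_set Ioo_subset_Icc_self) _ hq.continuous
    rw [hΓ0, mul_zero, zero_add, intervalIntegral.integral_of_le hT.le,
      integral_Ioc_eq_integral_Ioo, integral_add hqΓ (hqi _ hGi _ hθc)] at hparts
    have hG2 : ∫ t in Ioo 0 T, ((θ t : ℝ) : 𝕜) * G t =
        (∫ t in Ioo 0 T, ((θ t : ℝ) : 𝕜) * inner 𝕜 (i d) (F t)) -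
          ∫ t in Ioo 0 T, ((θ t : ℝ) : 𝕜) * inner 𝕜 (a d) (U t) := by
      rw [← integral_sub (hqi _ hFi _ hθc) (hqi _ hUai _ hθc)]
      refine integral_congr_ae (Filter.Eventually.of_forall fun t => ?_)
      simp only [G, mul_sub]
    have hsupp : ∫ t, q t • R t = ∫ t in Ioo 0 T, q t • R t := by
      rw [setIntegral_eq_integral_of_forall_compl_eq_zero]
      intro t ht
      rw [image_eq_zero_of_notMem_tsupport fun h => ht (hqs h), zero_smul]
    have hq1 : IntegrableOn (fun t => ((q t : ℝ) : 𝕜)) (Ioo 0 T) :=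
      (RCLike.continuous_ofReal.comp hq.continuous).integrableOn_Icc.mono_set Ioo_subset_Icc_self
    have hRR : ∫ t in Ioo 0 T, q t • R t =
        (∫ t in Ioo 0 T, ((q t : ℝ) : 𝕜) * inner 𝕜 (j d) (K (U t))) -
          (∫ t in Ioo 0 T, ((q t : ℝ) : 𝕜)) * (inner 𝕜 (j d) u + Γ T) +
          ∫ t in Ioo 0 T, ((q t : ℝ) : 𝕜) * Γ t := by
      have hsub : IntegrableOn (fun t => ((q t : ℝ) : 𝕜) * inner 𝕜 (j d) (K (U t)) -
          ((q t : ℝ) : 𝕜) * (inner 𝕜 (j d) u + Γ T)) (Ioo 0 T) :=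
        (hqi _ hUi _ hq.continuous).sub (hq1.mul_const _)
      rw [← integral_mul_const, ← integral_sub (hqi _ hUi _ hq.continuous) (hq1.mul_const _),
        ← integral_add hsub hqΓ]
      refine integral_congr_ae (Filter.Eventually.of_forall fun t => ?_)
      simp only [R, RCLike.real_smul_eq_coe_mul]
      ring
    rw [hsupp, hRR, ← hθT]
    rw [hG2] at hparts
    linear_combination key - hparts
  rw [← ae_restrict_iff' measurableSet_Ioo] at hR
  filter_upwards [hR, ae_restrict_mem measurableSet_Ioo] with t h1 h2
  have hii : ∀ x ∈ Icc 0 T, IntervalIntegrable G volume 0 x := fun x hx =>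
    (intervalIntegrable_iff_integrableOn_Ioo_of_le hx.1).2
      (hGi.mono_set (Ioo_subset_Ioo_right hx.2))
  have h3 := intervalIntegral.integral_interval_sub_left (hii T ⟨hT.le, le_rfl⟩)
    (hii t (Ioo_subset_Icc_self h2))
  change _ = _ + ∫ s in t..T, G s
  rw [← h3]
  simp only [R, Γ] at h1
  linear_combination h1

end Evolution

/-! ### Evolution equations in product spaces -/

section Product

theorem exists_pairCurve (𝕜 : Type*) {X Y : Type*} [RCLike 𝕜] {T : ℝ} [NormedAddCommGroup X]
    [InnerProductSpace 𝕜 X] [NormedAddCommGroup Y] [InnerProductSpace 𝕜 Y]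
    (x : TimeL2 T X) (y : TimeL2 T Y) :
    ∃ F : TimeL2 T (WithLp 2 (X × Y)), ‖F‖ ≤ ‖x‖ + ‖y‖ ∧
      ∀ᵐ t ∂(timeMeasure T), F t = WithLp.toLp 2 (x t, y t) := by
  let A : X →L[𝕜] WithLp 2 (X × Y) :=
    (WithLp.prodContinuousLinearEquiv 2 𝕜 _ _).symm.toContinuousLinearMap ∘L
      ContinuousLinearMap.inl 𝕜 _ _
  let B : Y →L[𝕜] WithLp 2 (X × Y) :=
    (WithLp.prodContinuousLinearEquiv 2 𝕜 _ _).symm.toContinuousLinearMap ∘L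
      ContinuousLinearMap.inr 𝕜 _ _
  have hA : ∀ x, ‖A x‖ ≤ ‖x‖ := fun x => (WithLp.norm_toLp_fst 2 _ _ x).le
  have hB : ∀ y, ‖B y‖ ≤ ‖y‖ := fun y => (WithLp.norm_toLp_snd 2 _ _ y).le
  refine ⟨A.compLp x + B.compLp y, (norm_add_le _ _).trans (add_le_add ?_ ?_), ?_⟩
  · refine Lp.norm_le_norm_of_ae_le ?_
    filter_upwards [A.coeFn_compLp x] with t ht
    rw [ht]
    exact hA _
  · refine Lp.norm_le_norm_of_ae_le ?_
    filter_upwards [B.coeFn_compLp y] with t ht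
    rw [ht]
    exact hB _
  · filter_upwards [Lp.coeFn_add (A.compLp x) (B.compLp y), A.coeFn_compLp x, B.coeFn_compLp y]
      with t h1 h2 h3
    rw [h1, Pi.add_apply, h2, h3]
    change WithLp.toLp 2 (x t, 0) + WithLp.toLp 2 (0, y t) = _
    rw [← WithLp.toLp_add, Prod.mk_add_mk, add_zero, zero_add]

theorem exists_curve_components (𝕜 : Type*) {X Y : Type*} [RCLike 𝕜] {T : ℝ} [NormedAddCommGroup X]
    [InnerProductSpace 𝕜 X] [NormedAddCommGroup Y] [InnerProductSpace 𝕜 Y]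
    (U : TimeL2 T (WithLp 2 (X × Y))) :
    ∃ (x : TimeL2 T X) (y : TimeL2 T Y), (‖x‖ ≤ ‖U‖ ∧ ‖y‖ ≤ ‖U‖) ∧
      ∀ᵐ t ∂(timeMeasure T), U t = WithLp.toLp 2 (x t, y t) := by
  have hr := (WithLp.fstL 2 𝕜 X Y).coeFn_compLp U
  have hw := (WithLp.sndL 2 𝕜 X Y).coeFn_compLp U
  have hsq : ∀ z : WithLp 2 (X × Y), ‖z.fst‖ ≤ ‖z‖ ∧ ‖z.snd‖ ≤ ‖z‖ := fun z => by
    have := WithLp.prod_norm_sq_eq_of_L2 z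
    constructor <;>
    · refine abs_le_of_sq_le_sq' ?_ (norm_nonneg _) |>.2
      rw [this]
      nlinarith [sq_nonneg ‖z.fst‖, sq_nonneg ‖z.snd‖]
  refine ⟨(WithLp.fstL 2 𝕜 X Y).compLp U, (WithLp.sndL 2 𝕜 X Y).compLp U, ⟨?_, ?_⟩, ?_⟩
  · refine Lp.norm_le_norm_of_ae_le ?_
    filter_upwards [hr] with t ht
    rw [ht]
    exact (hsq _).1
  · refine Lp.norm_le_norm_of_ae_le ?_
    filter_upwards [hw] with t ht
    rw [ht]
    exact (hsq _).2
  · filter_upwards [hr, hw] with t h1 h2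
    rw [h1, h2]
    rfl

variable {𝕜 X Y Z D : Type*} [RCLike 𝕜] {T : ℝ}
  [NormedAddCommGroup X] [InnerProductSpace 𝕜 X] [CompleteSpace X] [NormedSpace ℝ X]
  [IsScalarTower ℝ 𝕜 X]
  [NormedAddCommGroup Y] [InnerProductSpace 𝕜 Y] [CompleteSpace Y]
  [NormedAddCommGroup Z] [InnerProductSpace 𝕜 Z] [CompleteSpace Z] [NormedSpace ℝ Z]
  [IsScalarTower ℝ 𝕜 Z]
  [AddCommGroup D] [Module 𝕜 D]

/-- Existence for a backward evolution equation in a product of Hilbert spaces, the second of which is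
mapped to a larger space by `V`. -/
theorem exists_backward_evolution_prod (hT : 0 < T) (i₁ a₁ : D →ₗ[𝕜] X) (i₂ a₂ : D →ₗ[𝕜] Y)
    (V : Y →L[𝕜] Z) (hV : ∀ y, ‖V y‖ ≤ ‖y‖)
    (ha : ∀ d, ‖i₂ d‖ ^ 2 - ‖V (i₂ d)‖ ^ 2 ≤
      RCLike.re (inner 𝕜 (i₁ d) (a₁ d) + inner 𝕜 (i₂ d) (a₂ d)))
    (F₁ : TimeL2 T X) (F₂ : TimeL2 T Y) (u₁ : X) (u₂ : Z) :
    ∃ (r : TimeL2 T X) (w : TimeL2 T Y),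
      (‖r‖ ≤ 2 * (1 + T) * (‖F₁‖ + ‖F₂‖ + (‖u₁‖ + ‖u₂‖)) ∧
        ‖w‖ ≤ 2 * (1 + T) * (‖F₁‖ + ‖F₂‖ + (‖u₁‖ + ‖u₂‖))) ∧
      ∀ d, ∀ᵐ t ∂(timeMeasure T),
        inner 𝕜 (i₁ d) (r t) + inner 𝕜 (V (i₂ d)) (V (w t)) =
          (inner 𝕜 (i₁ d) u₁ + inner 𝕜 (V (i₂ d)) u₂) +
          ∫ s in t..T, ((inner 𝕜 (i₁ d) (F₁ s) + inner 𝕜 (i₂ d) (F₂ s)) -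
            (inner 𝕜 (a₁ d) (r s) + inner 𝕜 (a₂ d) (w s))) := by
  obtain ⟨F, hFn, hFae⟩ := exists_pairCurve 𝕜 F₁ F₂
  have hun : ‖WithLp.toLp 2 (u₁, u₂)‖ ≤ ‖u₁‖ + ‖u₂‖ := by
    refine abs_le_of_sq_le_sq' ?_ (by positivity) |>.2
    rw [WithLp.prod_norm_sq_eq_of_L2]
    change ‖u₁‖ ^ 2 + ‖u₂‖ ^ 2 ≤ _
    nlinarith [norm_nonneg u₁, norm_nonneg u₂]
  let i : D →ₗ[𝕜] WithLp 2 (X × Y) := (WithLp.linearEquiv 2 𝕜 _).symm.toLinearMap ∘ₗ i₁.prod i₂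
  let a : D →ₗ[𝕜] WithLp 2 (X × Y) := (WithLp.linearEquiv 2 𝕜 _).symm.toLinearMap ∘ₗ a₁.prod a₂
  -- The energy space is X × Y, while values in time are measured in X × Z, where the second
  -- component is seen through V.
  let j : D →ₗ[𝕜] WithLp 2 (X × Z) :=
    (WithLp.linearEquiv 2 𝕜 _).symm.toLinearMap ∘ₗ i₁.prod (V.toLinearMap ∘ₗ i₂)
  let K : WithLp 2 (X × Y) →L[𝕜] WithLp 2 (X × Z) :=
    (WithLp.prodContinuousLinearEquiv 2 𝕜 _ _).symm.toContinuousLinearMap ∘L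
      (WithLp.fstL 2 𝕜 _ _).prod (V ∘L WithLp.sndL 2 𝕜 _ _)
  have hi : ∀ d, ‖i d‖ ^ 2 = ‖i₁ d‖ ^ 2 + ‖i₂ d‖ ^ 2 := fun d => WithLp.prod_norm_sq_eq_of_L2 _
  have hj : ∀ d, ‖j d‖ ^ 2 = ‖i₁ d‖ ^ 2 + ‖V (i₂ d)‖ ^ 2 := fun d => WithLp.prod_norm_sq_eq_of_L2 _
  have hij : ∀ d, ‖j d‖ ≤ ‖i d‖ := fun d => by
    refine abs_le_of_sq_le_sq' ?_ (norm_nonneg _) |>.2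
    rw [hi, hj]
    gcongr
    exact hV _
  have ha' : ∀ d, ‖i d‖ ^ 2 - ‖j d‖ ^ 2 ≤ RCLike.re (inner 𝕜 (i d) (a d)) := fun d => by
    rw [hi, hj, WithLp.prod_inner_apply]
    refine le_trans (le_of_eq ?_) (ha d)
    ring
  obtain ⟨U, hU, hUe⟩ := exists_backward_evolution hT i a j K (fun d => rfl) hij ha' F
    (WithLp.toLp 2 (u₁, u₂))
  have hU' : ‖U‖ ≤ 2 * (1 + T) * (‖F₁‖ + ‖F₂‖ + (‖u₁‖ + ‖u₂‖)) := hU.trans (by gcongr)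
  obtain ⟨r, w, ⟨hr, hw⟩, hrw⟩ := exists_curve_components 𝕜 U
  refine ⟨r, w, ⟨hr.trans hU', hw.trans hU'⟩, fun d => ?_⟩
  have hmem := ae_restrict_mem (μ := volume) (measurableSet_Ioo (a := (0 : ℝ)) (b := T))
  filter_upwards [hUe d, hrw, hmem] with t ht h1 h3
  rw [h1, WithLp.prod_inner_apply, WithLp.prod_inner_apply] at ht
  refine ht.trans ?_
  congr 1
  rw [intervalIntegral.integral_of_le h3.2.le, intervalIntegral.integral_of_le h3.2.le,
    integral_Ioc_eq_integral_Ioo, integral_Ioc_eq_integral_Ioo]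
  refine integral_congr_ae (ae_mono (Measure.restrict_mono (Ioo_subset_Ioo_left h3.1.le) le_rfl) ?_)
  filter_upwards [hFae, hrw] with s e1 e2
  rw [e1, e2, WithLp.prod_inner_apply, WithLp.prod_inner_apply]
  rfl

end Product

/-! ### The coupled form on pairs of test functions -/

section TestPairs

variable {𝕜 : Type*} [RCLike 𝕜] {T : ℝ}

variable (𝕜) in
/-- Pairs of smooth functions on the line, the first one with equal values at `0` and `1`, the second
one vanishing at `0` and `1`. -/
def testPairs : Submodule 𝕜 ((ℝ → 𝕜) × (ℝ → 𝕜)) where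
  carrier := {d | (ContDiff ℝ ∞ d.1 ∧ d.1 0 = d.1 1) ∧ ContDiff ℝ ∞ d.2 ∧ d.2 0 = 0 ∧ d.2 1 = 0}
  add_mem' := by
    rintro a b ⟨⟨h1, h2⟩, h3, h4, h5⟩ ⟨⟨h1', h2'⟩, h3', h4', h5'⟩
    exact ⟨⟨h1.add h1', by simp [h2, h2']⟩, h3.add h3', by simp [h4, h4'], by simp [h5, h5']⟩
  zero_mem' := ⟨⟨contDiff_const, rfl⟩, contDiff_const, rfl, rfl⟩
  smul_mem' := by
    rintro c a ⟨⟨h1, h2⟩, h3, h4, h5⟩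
    exact ⟨⟨h1.const_smul c, by simp [h2]⟩, h3.const_smul c, by simp [h4], by simp [h5]⟩

theorem ContDiff.continuous_deriv_infty {φ : ℝ → 𝕜} (h : ContDiff ℝ ∞ φ) : Continuous (deriv φ) :=
  h.continuous_deriv (by exact_mod_cast le_top)

theorem toL2_deriv_add {φ ψ : ℝ → 𝕜} (h : ContDiff ℝ ∞ φ) (h' : ContDiff ℝ ∞ ψ) :
    toL2 (deriv (φ + ψ)) = toL2 (deriv φ) + toL2 (deriv ψ) := by
  rw [← toL2_add h.continuous_deriv_infty h'.continuous_deriv_infty]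
  congr 1
  ext x
  exact deriv_add (h.differentiable (by simp) x) (h'.differentiable (by simp) x)

theorem toL2_deriv_smul (c : 𝕜) {φ : ℝ → 𝕜} (h : ContDiff ℝ ∞ φ) :
    toL2 (deriv (c • φ)) = c • toL2 (deriv φ) := by
  rw [← toL2_smul c h.continuous_deriv_infty]
  congr 1
  ext x
  exact deriv_const_smul c (h.differentiable (by simp) x)

/-- The `L²` class of the first component. -/
def testFst : testPairs 𝕜 →ₗ[𝕜] SpaceL2 𝕜 where
  toFun d := toL2 d.1.1
  map_add' a b := toL2_add a.2.1.1.continuous b.2.1.1.continuous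
  map_smul' c a := toL2_smul c a.2.1.1.continuous

/-- The `L²` class of the derivative of the first component. -/
def testFstDeriv : testPairs 𝕜 →ₗ[𝕜] SpaceL2 𝕜 where
  toFun d := toL2 (deriv d.1.1)
  map_add' a b := toL2_deriv_add a.2.1.1 b.2.1.1
  map_smul' c a := toL2_deriv_smul c a.2.1.1

/-- The second component, as an element of `H¹₀(0,1)`. -/
def testSnd : testPairs 𝕜 →ₗ[𝕜] H10 𝕜 where
  toFun d := ⟨WithLp.toLp 2 (toL2 d.1.2, toL2 (deriv d.1.2)),
    mem_H10_of_contDiff d.2.2.1 d.2.2.2.1 d.2.2.2.2⟩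
  map_add' a b := by
    refine Subtype.ext ?_
    change WithLp.toLp 2 (toL2 (a.1.2 + b.1.2), toL2 (deriv (a.1.2 + b.1.2))) = _
    rw [toL2_add a.2.2.1.continuous b.2.2.1.continuous, toL2_deriv_add a.2.2.1 b.2.2.1]
    rfl
  map_smul' c a := by
    refine Subtype.ext ?_
    change WithLp.toLp 2 (toL2 (c • a.1.2), toL2 (deriv (c • a.1.2))) = _
    rw [toL2_smul c a.2.2.1.continuous, toL2_deriv_smul c a.2.2.1]
    rfl

/-- The element of `H¹₀(0,1)` representing the functional `z ↦ ⟪z, a⟫ + ⟪z', b⟫`. -/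
def h10Riesz : WithLp 2 (SpaceL2 𝕜 × SpaceL2 𝕜) →L[𝕜] H10 𝕜 := (H10 𝕜).orthogonalProjectionOnto

/-- Projecting onto the closed subspace `H10` preserves inner products with its elements. Sources g
and divergence sources -G_x thus become elements of H¹₀. -/
theorem inner_h10Riesz (z : H10 𝕜) (y : WithLp 2 (SpaceL2 𝕜 × SpaceL2 𝕜)) :
    inner 𝕜 z (h10Riesz y) = inner 𝕜 (h10Val z) y.fst + inner 𝕜 (h10Deriv z) y.snd := by
  exact (Submodule.inner_orthogonalProjectionOnto_eq_of_mem_left z y).trans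
    (WithLp.prod_inner_apply _ _)

theorem norm_h10Riesz_le (y : WithLp 2 (SpaceL2 𝕜 × SpaceL2 𝕜)) : ‖h10Riesz y‖ ≤ ‖y‖ :=
  (H10 𝕜).norm_orthogonalProjectionOnto_apply_le y

/-- The real part of the integrand is half the derivative of |φ|², whose end point values agree. -/
theorem re_inner_toL2_deriv {φ : ℝ → 𝕜} (h : ContDiff ℝ ∞ φ) (h01 : φ 0 = φ 1) :
    RCLike.re (inner 𝕜 (toL2 φ) (toL2 (deriv φ))) = 0 := by
  have hd : ∀ x, HasDerivAt φ (deriv φ x) x := fun x => (h.differentiable (by simp) x).hasDerivAt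
  have hs : ∀ x, HasDerivAt (fun x => star (φ x)) (star (deriv φ x)) x := fun x => (hd x).star
  have h1 := intervalIntegral.integral_deriv_mul_eq_sub (a := 0) (b := 1) (u := fun x => star (φ x))
    (v := φ) (u' := fun x => star (deriv φ x)) (v' := deriv φ) (fun x _ => hs x) (fun x _ => hd x)
    ((continuous_star.comp h.continuous_deriv_infty).intervalIntegrable _ _)
    (h.continuous_deriv_infty.intervalIntegrable _ _)
  have c1 : Continuous fun x => star (deriv φ x) * φ x :=
    (continuous_star.comp h.continuous_deriv_infty).mul h.continuous
  have c2 : Continuous fun x => star (φ x) * deriv φ x :=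
    (continuous_star.comp h.continuous).mul h.continuous_deriv_infty
  rw [h01, sub_self, intervalIntegral.integral_add (c1.intervalIntegrable _ _)
    (c2.intervalIntegrable _ _),
    ← inner_toL2_toL2 h.continuous_deriv_infty h.continuous,
    ← inner_toL2_toL2 h.continuous h.continuous_deriv_infty] at h1
  have h2 := congrArg RCLike.re h1
  rw [map_add, map_zero, inner_re_symm] at h2
  linarith

/-- The transport component of the coupled form; `e` is the coefficient of the first order terms. -/
def testForm₁ (e : ℝ) : testPairs 𝕜 →ₗ[𝕜] SpaceL2 𝕜 :=
  (e : 𝕜) • (testFstDeriv + h10DerivL.toLinearMap ∘ₗ testSnd)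

/-- The diffusion component of the coupled form; `e` is the coefficient of the first order terms. -/
def testForm₂ (e : ℝ) : testPairs 𝕜 →ₗ[𝕜] H10 𝕜 :=
  h10Riesz.toLinearMap ∘ₗ (WithLp.linearEquiv 2 𝕜 _).symm.toLinearMap ∘ₗ
    LinearMap.prod 0 (h10DerivL.toLinearMap ∘ₗ testSnd -
      (e : 𝕜) • (testFst + h10ValL.toLinearMap ∘ₗ testSnd))

theorem inner_testForm₁ (e : ℝ) (d : testPairs 𝕜) (r : SpaceL2 𝕜) :
    inner 𝕜 (testForm₁ e d) r =
      (e : 𝕜) * (inner 𝕜 (toL2 (deriv d.1.1)) r + inner 𝕜 (toL2 (deriv d.1.2)) r) := by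
  change inner 𝕜 ((e : 𝕜) • (toL2 (deriv d.1.1) + toL2 (deriv d.1.2))) r = _
  rw [inner_smul_left, RCLike.conj_ofReal, inner_add_left]

theorem inner_testForm₂ (e : ℝ) (d : testPairs 𝕜) (w : H10 𝕜) :
    inner 𝕜 (testForm₂ e d) w = inner 𝕜 (toL2 (deriv d.1.2)) (h10Deriv w) -
        (e : 𝕜) * (inner 𝕜 (toL2 d.1.1) (h10Deriv w) + inner 𝕜 (toL2 d.1.2) (h10Deriv w)) := by
  change inner 𝕜 (h10Riesz (WithLp.toLp 2 (0, toL2 (deriv d.1.2) -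
      (e : 𝕜) • (toL2 d.1.1 + toL2 d.1.2)))) w = _
  rw [← inner_conj_symm, inner_h10Riesz]
  change starRingEnd 𝕜 (inner 𝕜 (h10Val w) 0 + inner 𝕜 (h10Deriv w) (toL2 (deriv d.1.2) -
    (e : 𝕜) • (toL2 d.1.1 + toL2 d.1.2))) = _
  rw [inner_zero_right, zero_add, inner_conj_symm, inner_sub_left, inner_smul_left,
    RCLike.conj_ofReal, inner_add_left]

/-- The diagonal first order terms vanish by `re_inner_toL2_deriv`, and the two coupling terms have
equal real parts and opposite signs. Only the squared norm of the derivative of the second component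
survives, for either sign of e, so one estimate serves the forward and the adjoint systems. -/
theorem re_inner_testForm (e : ℝ) (d : testPairs 𝕜) :
    ‖testSnd d‖ ^ 2 - ‖h10ValL (testSnd d)‖ ^ 2 ≤
      RCLike.re (inner 𝕜 (testFst d) (testForm₁ e d) + inner 𝕜 (testSnd d) (testForm₂ e d)) := by
  rw [map_add, inner_re_symm, inner_testForm₁, inner_re_symm (testSnd d), inner_testForm₂, norm_sq_h10]
  change ‖toL2 d.1.2‖ ^ 2 + ‖toL2 (deriv d.1.2)‖ ^ 2 - ‖toL2 d.1.2‖ ^ 2 ≤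
    RCLike.re ((e : 𝕜) * (inner 𝕜 (toL2 (deriv d.1.1)) (toL2 d.1.1) +
    inner 𝕜 (toL2 (deriv d.1.2)) (toL2 d.1.1))) +
    RCLike.re (inner 𝕜 (toL2 (deriv d.1.2)) (toL2 (deriv d.1.2)) -
      (e : 𝕜) * (inner 𝕜 (toL2 d.1.1) (toL2 (deriv d.1.2)) +
        inner 𝕜 (toL2 d.1.2) (toL2 (deriv d.1.2))))
  have h1 := re_inner_toL2_deriv d.2.1.1 d.2.1.2
  have h2 := re_inner_toL2_deriv d.2.2.1 (d.2.2.2.1.trans d.2.2.2.2.symm)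
  rw [inner_re_symm] at h1
  simp only [map_add, map_sub, RCLike.re_ofReal_mul, h1, h2, inner_self_eq_norm_sq]
  rw [inner_re_symm (𝕜 := 𝕜) (toL2 d.1.1)]
  linarith

/-- Existence of weak solutions of the coupled backward system with final data. -/
theorem exists_backward_inner (hT : 0 < T) (e : ℝ) (f g G : TimeL2 T (SpaceL2 𝕜))
    (r₀ u₀ : SpaceL2 𝕜) :
    ∃ (r : TimeL2 T (SpaceL2 𝕜)) (w : TimeL2 T (H10 𝕜)),
      (‖r‖ ≤ 2 * (1 + T) * (‖f‖ + (‖g‖ + ‖G‖) + (‖r₀‖ + ‖u₀‖)) ∧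
        ‖w‖ ≤ 2 * (1 + T) * (‖f‖ + (‖g‖ + ‖G‖) + (‖r₀‖ + ‖u₀‖))) ∧
      ∀ d : testPairs 𝕜, ∀ᵐ t ∂(timeMeasure T),
        inner 𝕜 (toL2 d.1.1) (r t) + inner 𝕜 (toL2 d.1.2) (h10Val (w t)) =
          (inner 𝕜 (toL2 d.1.1) r₀ + inner 𝕜 (toL2 d.1.2) u₀) +
          ∫ s in t..T, ((inner 𝕜 (toL2 d.1.1) (f s) + (inner 𝕜 (toL2 d.1.2) (g s) +
            inner 𝕜 (toL2 (deriv d.1.2)) (G s))) -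
            ((e : 𝕜) * (inner 𝕜 (toL2 (deriv d.1.1)) (r s) + inner 𝕜 (toL2 (deriv d.1.2)) (r s)) +
            (inner 𝕜 (toL2 (deriv d.1.2)) (h10Deriv (w s)) -
              (e : 𝕜) * (inner 𝕜 (toL2 d.1.1) (h10Deriv (w s)) +
                inner 𝕜 (toL2 d.1.2) (h10Deriv (w s)))))) := by
  obtain ⟨q, hqn, hqae⟩ := exists_pairCurve 𝕜 g G
  have hq := (h10Riesz (𝕜 := 𝕜)).coeFn_compLp q
  have hqn' : ‖(h10Riesz (𝕜 := 𝕜)).compLp q‖ ≤ ‖g‖ + ‖G‖ := by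
    refine le_trans (Lp.norm_le_norm_of_ae_le ?_) hqn
    filter_upwards [hq] with t ht
    rw [ht]
    exact norm_h10Riesz_le _
  have key := exists_backward_evolution_prod (𝕜 := 𝕜) (X := SpaceL2 𝕜) (Y := H10 𝕜)
    (Z := SpaceL2 𝕜) (D := testPairs 𝕜) hT testFst (testForm₁ e) testSnd (testForm₂ e) h10ValL
    norm_h10Val_le (re_inner_testForm e) f ((h10Riesz (𝕜 := 𝕜)).compLp q) r₀ u₀
  obtain ⟨r, w, ⟨hr, hw⟩, hrw⟩ := key
  refine ⟨r, w, ⟨hr.trans (by gcongr), hw.trans (by gcongr)⟩, fun d => ?_⟩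
  have hmem := ae_restrict_mem (μ := volume) (measurableSet_Ioo (a := (0 : ℝ)) (b := T))
  filter_upwards [hrw d, hmem] with t ht h3
  refine ht.trans ?_
  congr 1
  rw [intervalIntegral.integral_of_le h3.2.le, intervalIntegral.integral_of_le h3.2.le,
    integral_Ioc_eq_integral_Ioo, integral_Ioc_eq_integral_Ioo]
  refine integral_congr_ae (ae_mono (Measure.restrict_mono (Ioo_subset_Ioo_left h3.1.le) le_rfl) ?_)
  filter_upwards [hq, hqae] with s e1 e2
  rw [inner_testForm₁, inner_testForm₂, e1, e2, inner_h10Riesz]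
  rfl

end TestPairs

/-! ### Weak solutions of the coupled systems -/

section Coupled

variable {𝕜 : Type*} [RCLike 𝕜] {T : ℝ}

theorem toL2_zero_fun : toL2 (fun _ : ℝ => (0 : 𝕜)) = 0 := by
  have h0 := toL2_smul (0 : 𝕜) (φ := fun _ : ℝ => (0 : 𝕜)) continuous_const
  rw [zero_smul, zero_smul] at h0
  exact h0

theorem inner_toL2_star {ξ : ℝ → 𝕜} (h : Continuous ξ) (a : SpaceL2 𝕜) :
    inner 𝕜 (toL2 fun x => star (ξ x)) a = pairing a (toL2 ξ) := by
  rw [inner_eq_pairing, ← star_toL2 h, star_star, pairing_comm]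

theorem deriv_star_comp {ξ : ℝ → 𝕜} : deriv (fun x => star (ξ x)) = fun x => star (deriv ξ x) := by
  ext x
  exact deriv.star

theorem integral_congr_of_ae {m m' : ℝ → 𝕜} (h : ∀ᵐ s ∂(timeMeasure T), m s = m' s) {a b : ℝ}
    (ha : 0 ≤ a) (hab : a ≤ b) (hb : b ≤ T) : ∫ s in a..b, m s = ∫ s in a..b, m' s := by
  rw [intervalIntegral.integral_of_le hab, intervalIntegral.integral_of_le hab,
    integral_Ioc_eq_integral_Ioo, integral_Ioc_eq_integral_Ioo]
  exact integral_congr_ae (ae_mono (Measure.restrict_mono (Ioo_subset_Ioo ha hb) le_rfl) h)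

/-- Existence of weak solutions of the coupled backward system with final data, tested by means of
the bilinear pairing. -/
theorem exists_backward (hT : 0 < T) (e : ℝ) (f g G : TimeL2 T (SpaceL2 𝕜))
    (r₀ u₀ : SpaceL2 𝕜) :
    ∃ (r : TimeL2 T (SpaceL2 𝕜)) (w : TimeL2 T (H10 𝕜)),
      (‖r‖ ≤ 2 * (1 + T) * (‖f‖ + (‖g‖ + ‖G‖) + (‖r₀‖ + ‖u₀‖)) ∧
        ‖w‖ ≤ 2 * (1 + T) * (‖f‖ + (‖g‖ + ‖G‖) + (‖r₀‖ + ‖u₀‖))) ∧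
      (∀ ξ : ℝ → 𝕜, ContDiff ℝ ∞ ξ → ξ 0 = ξ 1 → ∀ᵐ t ∂(timeMeasure T),
        pairing (r t) (toL2 ξ) = pairing r₀ (toL2 ξ) +
          ∫ s in t..T, (pairing (f s) (toL2 ξ) + (e : 𝕜) * pairing (h10Deriv (w s)) (toL2 ξ) -
            (e : 𝕜) * pairing (r s) (toL2 (deriv ξ)))) ∧
      (∀ η : ℝ → 𝕜, ContDiff ℝ ∞ η → η 0 = 0 → η 1 = 0 → ∀ᵐ t ∂(timeMeasure T),
        pairing (h10Val (w t)) (toL2 η) = pairing u₀ (toL2 η) +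
          ∫ s in t..T, (pairing (g s) (toL2 η) + (e : 𝕜) * pairing (h10Deriv (w s)) (toL2 η) +
            pairing (G s) (toL2 (deriv η)) - (e : 𝕜) * pairing (r s) (toL2 (deriv η)) -
            pairing (h10Deriv (w s)) (toL2 (deriv η)))) := by
  obtain ⟨r, w, hb, h⟩ := exists_backward_inner hT e f g G r₀ u₀
  have hs : ∀ ξ : ℝ → 𝕜, ContDiff ℝ ∞ ξ → ContDiff ℝ ∞ fun x => star (ξ x) := fun ξ hξ =>
    (starL' ℝ : 𝕜 ≃L[ℝ] 𝕜).contDiff.comp hξ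
  have h0 : toL2 (deriv fun _ : ℝ => (0 : 𝕜)) = 0 := by
    simp only [deriv_const']
    exact toL2_zero_fun
  refine ⟨r, w, hb, fun ξ hξ h01 => ?_, fun η hη hη0 hη1 => ?_⟩
  -- Conjugating the test function turns the inner product into the pairing, and the zero second
  -- component isolates the transport equation.
  · have h1 := h ⟨(fun x => star (ξ x), fun _ => 0),
      ⟨hs ξ hξ, by simp only [h01]⟩, contDiff_const, rfl, rfl⟩
    filter_upwards [h1] with t ht
    simp only [h0, toL2_zero_fun, deriv_star_comp, inner_toL2_star hξ.continuous,
      inner_toL2_star hξ.continuous_deriv_infty, inner_zero_left, add_zero, zero_sub] at ht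
    rw [ht]
    congr 1
    refine intervalIntegral.integral_congr fun s _ => ?_
    ring
  · have h1 := h ⟨(fun _ => 0, fun x => star (η x)),
      ⟨contDiff_const, rfl⟩, hs η hη, by simp [hη0], by simp [hη1]⟩
    filter_upwards [h1] with t ht
    simp only [h0, toL2_zero_fun, deriv_star_comp, inner_toL2_star hη.continuous,
      inner_toL2_star hη.continuous_deriv_infty, inner_zero_left, zero_add] at ht
    rw [ht]
    congr 1
    refine intervalIntegral.integral_congr fun s _ => ?_
    ring

theorem measurePreserving_reflect (T : ℝ) :
    MeasurePreserving (fun t => T - t) (timeMeasure T) (timeMeasure T) := by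
  have h := (volume.measurePreserving_sub_left T).restrict_preimage
    (measurableSet_Ioo (a := (0 : ℝ)) (b := T))
  have e : (fun t => T - t) ⁻¹' Ioo 0 T = Ioo 0 T := by
    ext t
    simp only [mem_preimage, mem_Ioo]
    constructor <;> rintro ⟨h1, h2⟩ <;> constructor <;> linarith
  rwa [e] at h

theorem ae_reflect {p : ℝ → Prop} (h : ∀ᵐ t ∂(timeMeasure T), p t) :
    ∀ᵐ t ∂(timeMeasure T), p (T - t) :=
  (measurePreserving_reflect T).quasiMeasurePreserving.ae h

/-- Time reversal. -/
def reflect {E : Type*} [NormedAddCommGroup E] (a : TimeL2 T E) : TimeL2 T E :=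
  Lp.compMeasurePreserving (fun t => T - t) (measurePreserving_reflect T) a

theorem reflect_ae {E : Type*} [NormedAddCommGroup E] (a : TimeL2 T E) :
    ∀ᵐ t ∂(timeMeasure T), reflect a t = a (T - t) :=
  Lp.coeFn_compMeasurePreserving a (measurePreserving_reflect T)

theorem norm_reflect {E : Type*} [NormedAddCommGroup E] (a : TimeL2 T E) : ‖reflect a‖ = ‖a‖ :=
  Lp.norm_compMeasurePreserving a (measurePreserving_reflect T)

theorem ae_eq_integral_reflect {x m m' : ℝ → 𝕜} {c : 𝕜}
    (h : ∀ᵐ t ∂(timeMeasure T), x t = c + ∫ s in t..T, m s)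
    (hm : ∀ᵐ s ∂(timeMeasure T), m (T - s) = m' s) :
    ∀ᵐ t ∂(timeMeasure T), x (T - t) = c + ∫ s in (0 : ℝ)..t, m' s := by
  filter_upwards [ae_reflect h, ae_restrict_mem measurableSet_Ioo] with t ht h2
  rw [ht, ← integral_congr_of_ae hm le_rfl h2.1.le h2.2.le, intervalIntegral.integral_comp_sub_left,
    sub_zero]

/-- Existence of weak solutions of the coupled forward system, with a source in divergence form. -/
theorem exists_forward (hT : 0 < T) (G : TimeL2 T (SpaceL2 𝕜)) (r₀ u₀ : SpaceL2 𝕜) :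
    ∃ (r : TimeL2 T (SpaceL2 𝕜)) (w : TimeL2 T (H10 𝕜)),
      (‖r‖ ≤ 2 * (1 + T) * (‖G‖ + (‖r₀‖ + ‖u₀‖)) ∧ ‖w‖ ≤ 2 * (1 + T) * (‖G‖ + (‖r₀‖ + ‖u₀‖))) ∧
      WeakTransport r (-derivCurve w) (fun ξ => pairing r₀ (toL2 ξ)) ∧
      WeakFlux w 0 (G + r + valCurve w - derivCurve w) (fun η => pairing u₀ (toL2 η)) := by
  -- Reversing time changes the sign of the first order terms relative to the time derivative, so
  -- the forward system is the reflected backward one with e = -1.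
  obtain ⟨r, w, ⟨hr, hw⟩, h1, h2⟩ := exists_backward hT (-1) 0 0 (reflect G) r₀ u₀
  simp only [norm_zero, zero_add, norm_reflect] at hr hw
  have hz := ae_reflect (Lp.coeFn_zero (SpaceL2 𝕜) 2 (timeMeasure T))
  have hz' := Lp.coeFn_zero (SpaceL2 𝕜) 2 (timeMeasure T)
  refine ⟨reflect r, reflect w, ⟨by rwa [norm_reflect], by rwa [norm_reflect]⟩,
    fun ξ hξ h01 => ?_, fun η hη hη0 hη1 => ?_⟩
  · filter_upwards [reflect_ae r, ae_eq_integral_reflect (h1 ξ hξ h01)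
      (m' := fun s => pairing (reflect r s) (toL2 (deriv ξ)) +
        pairing ((-derivCurve (reflect w)) s) (toL2 ξ)) (by
      filter_upwards [reflect_ae r, reflect_ae w, derivCurve_ae (reflect w),
        Lp.coeFn_neg (derivCurve (reflect w)), hz] with s e1 e2 e3 e4 e5
      rw [e4, Pi.neg_apply, e3, e2, e1, e5]
      simp only [Pi.zero_apply, map_zero, map_neg, zero_apply,
        neg_apply, map_one]
      ring)] with t e1 e2
    rw [e1, e2]
  · filter_upwards [reflect_ae w, ae_eq_integral_reflect (h2 η hη hη0 hη1)
      (m' := fun s => pairing ((0 : TimeL2 T (SpaceL2 𝕜)) s) (toL2 η) +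
        pairing ((G + reflect r + valCurve (reflect w) - derivCurve (reflect w)) s)
          (toL2 (deriv η))) (by
      filter_upwards [reflect_ae r, reflect_ae w, derivCurve_ae (reflect w), valCurve_ae (reflect w),
        Lp.coeFn_sub (G + reflect r + valCurve (reflect w)) (derivCurve (reflect w)),
        Lp.coeFn_add (G + reflect r) (valCurve (reflect w)), Lp.coeFn_add G (reflect r),
        ae_reflect (reflect_ae G), hz, hz']
        with s e1 e2 e3 e4 e5 e6 e7 e8 e9 e10
      -- The term w_x tested with η is integrated by parts to -w tested with η', which makes w part
      -- of the flux.
      rw [e5, Pi.sub_apply, e6, Pi.add_apply, e7, Pi.add_apply, e1, e3, e4, e2, e8, e9, e10,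
        sub_sub_cancel, pairing_h10Deriv (w (T - s)) hη]
      simp only [Pi.zero_apply, map_zero, map_neg, map_add, map_sub, zero_apply,
        add_apply, sub_apply, map_one]
      ring)] with t e1 e2
    rw [e1, e2]

end Coupled

/-! ### The adjoint system as transport and diffusion -/

section Adjoint

variable {𝕜 : Type*} [RCLike 𝕜] {T : ℝ}

/-- The coupling is read as data: σ_t + σ_x = -(f + v_x) is transport with a source, and v_t = -(g +
v_x) - (σ + v_x)_x has a source and a flux in L². The modal results then apply to each equation
separately. -/
theorem isAdjointWeakSolution_iff {f g σ : TimeL2 T (SpaceL2 𝕜)} {v : TimeL2 T (H10 𝕜)} :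
    IsAdjointWeakSolution f g σ v ↔
      (∀ ξ : ℝ → 𝕜, ContDiff ℝ ∞ ξ → ξ 0 = ξ 1 → ∀ᵐ t ∂(timeMeasure T),
        pairing (σ t) (toL2 ξ) =
          ∫ s in t..T, -(pairing (σ s) (toL2 (deriv ξ)) +
            pairing ((-(f + derivCurve v)) s) (toL2 ξ))) ∧
      (∀ η : ℝ → 𝕜, ContDiff ℝ ∞ η → η 0 = 0 → η 1 = 0 → ∀ᵐ t ∂(timeMeasure T),
        pairing (h10Val (v t)) (toL2 η) =
          ∫ s in t..T, -(pairing ((-(g + derivCurve v)) s) (toL2 η) +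
            pairing ((σ + derivCurve v) s) (toL2 (deriv η)))) := by
  have hIoo : ∀ {m m' : ℝ → 𝕜}, (∀ᵐ s ∂(timeMeasure T), m s = m' s) → ∀ t ∈ Ioo 0 T,
      ∫ s in Ioo t T, m s = ∫ s in t..T, m' s := fun h t ht => by
    rw [← integral_Ioc_eq_integral_Ioo, ← intervalIntegral.integral_of_le ht.2.le]
    exact integral_congr_of_ae h ht.1.le ht.2.le le_rfl
  refine and_congr (forall_congr' fun ξ => forall_congr' fun hξ => forall_congr' fun _ => ?_)
    (forall_congr' fun η => forall_congr' fun hη => forall_congr' fun _ => forall_congr' fun _ => ?_)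
  · have hm := hIoo (m := fun s => ∫ x in Ioo (0 : ℝ) 1,
        (f s x * ξ x + h10Deriv (v s) x * ξ x - σ s x * deriv ξ x))
      (m' := fun s => -(pairing (σ s) (toL2 (deriv ξ)) +
            pairing ((-(f + derivCurve v)) s) (toL2 ξ))) (by
      filter_upwards [derivCurve_ae v, Lp.coeFn_neg (f + derivCurve v), Lp.coeFn_add f (derivCurve v)]
        with s e1 e2 e3
      have c := hξ.continuous
      have c' := hξ.continuous_deriv_infty
      have i1 := integrable_mul_of_continuous (f s) c
      have i2 := integrable_mul_of_continuous (h10Deriv (v s)) c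
      have i12 : Integrable (fun x => f s x * ξ x + h10Deriv (v s) x * ξ x) spaceMeasure := i1.add i2
      rw [e2, Pi.neg_apply, e3, Pi.add_apply, e1,
        integral_sub i12 (integrable_mul_of_continuous (σ s) c'), integral_add i1 i2,
        ← pairing_toL2 _ c, ← pairing_toL2 _ c, ← pairing_toL2 _ c']
      simp only [map_neg, map_add, neg_apply, add_apply]
      ring)
    refine Filter.eventually_congr ?_
    filter_upwards [ae_restrict_mem measurableSet_Ioo] with t ht
    rw [hm t ht, pairing_toL2 _ hξ.continuous]
  · have hm := hIoo (m := fun s => ∫ x in Ioo (0 : ℝ) 1,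
        (g s x * η x + h10Deriv (v s) x * η x - σ s x * deriv η x - h10Deriv (v s) x * deriv η x))
      (m' := fun s => -(pairing ((-(g + derivCurve v)) s) (toL2 η) +
            pairing ((σ + derivCurve v) s) (toL2 (deriv η)))) (by
      filter_upwards [derivCurve_ae v, Lp.coeFn_neg (g + derivCurve v),
        Lp.coeFn_add g (derivCurve v), Lp.coeFn_add σ (derivCurve v)] with s e1 e2 e3 e4
      have c := hη.continuous
      have c' := hη.continuous_deriv_infty
      have i1 := integrable_mul_of_continuous (g s) c
      have i2 := integrable_mul_of_continuous (h10Deriv (v s)) c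
      have i3 := integrable_mul_of_continuous (σ s) c'
      have i4 := integrable_mul_of_continuous (h10Deriv (v s)) c'
      have i12 : Integrable (fun x => g s x * η x + h10Deriv (v s) x * η x) spaceMeasure := i1.add i2
      have i123 : Integrable (fun x => g s x * η x + h10Deriv (v s) x * η x - σ s x * deriv η x)
        spaceMeasure := i12.sub i3
      rw [e2, Pi.neg_apply, e3, Pi.add_apply, e4, Pi.add_apply, e1, integral_sub i123 i4,
        integral_sub i12 i3, integral_add i1 i2, ← pairing_toL2 _ c, ← pairing_toL2 _ c,
        ← pairing_toL2 _ c', ← pairing_toL2 _ c']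
      simp only [map_neg, map_add, neg_apply, add_apply]
      ring)
    refine Filter.eventually_congr ?_
    filter_upwards [ae_restrict_mem measurableSet_Ioo] with t ht
    rw [hm t ht, pairing_toL2 _ hη.continuous]

theorem exists_isAdjointWeakSolution (hT : 0 < T) (f g : TimeL2 T (SpaceL2 𝕜)) :
    ∃ (σ : TimeL2 T (SpaceL2 𝕜)) (v : TimeL2 T (H10 𝕜)), IsAdjointWeakSolution f g σ v := by
  obtain ⟨r, w, -, h1, h2⟩ := exists_backward hT 1 f g 0 0 0
  refine ⟨r, w, isAdjointWeakSolution_iff.2 ⟨fun ξ hξ h01 => ?_, fun η hη hη0 hη1 => ?_⟩⟩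
  · filter_upwards [h1 ξ hξ h01, ae_restrict_mem measurableSet_Ioo] with t ht h3
    rw [ht, map_zero, zero_apply, zero_add]
    refine integral_congr_of_ae ?_ h3.1.le h3.2.le le_rfl
    filter_upwards [derivCurve_ae w, Lp.coeFn_neg (f + derivCurve w), Lp.coeFn_add f (derivCurve w)]
      with s e1 e2 e3
    rw [e2, Pi.neg_apply, e3, Pi.add_apply, e1]
    simp only [map_neg, map_add, neg_apply, add_apply,
      map_one]
    ring
  · filter_upwards [h2 η hη hη0 hη1, ae_restrict_mem measurableSet_Ioo] with t ht h3
    rw [ht, map_zero, zero_apply, zero_add]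
    refine integral_congr_of_ae ?_ h3.1.le h3.2.le le_rfl
    filter_upwards [derivCurve_ae w, Lp.coeFn_neg (g + derivCurve w),
      Lp.coeFn_add g (derivCurve w), Lp.coeFn_add r (derivCurve w),
      Lp.coeFn_zero (SpaceL2 𝕜) 2 (timeMeasure T)] with s e1 e2 e3 e4 e5
    rw [e2, Pi.neg_apply, e3, Pi.add_apply, e4, Pi.add_apply, e1, e5]
    simp only [map_neg, map_add, neg_apply, add_apply,
      Pi.zero_apply, map_zero, zero_apply, map_one]
    ring

theorem ae_eq_add_integral_of_final {x m : ℝ → 𝕜} (hT : 0 < T) (hm : IntegrableOn m (Ioo 0 T))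
    (h : ∀ᵐ t ∂(timeMeasure T), x t = ∫ s in t..T, -m s) :
    ∀ᵐ t ∂(timeMeasure T), x t = (-∫ s in (0 : ℝ)..T, m s) + ∫ s in (0 : ℝ)..t, m s := by
  have hii : ∀ y ∈ Icc 0 T, IntervalIntegrable m volume 0 y := fun y hy =>
    (intervalIntegrable_iff_integrableOn_Ioo_of_le hy.1).2
      (hm.mono_set (Ioo_subset_Ioo_right hy.2))
  filter_upwards [h, ae_restrict_mem measurableSet_Ioo] with t ht h2
  rw [ht, intervalIntegral.integral_neg, ← intervalIntegral.integral_interval_sub_left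
    (hii T ⟨hT.le, le_rfl⟩) (hii t (Ioo_subset_Icc_self h2))]
  ring

theorem eq_of_pairing_hilbertBasis {ι : Type*} (b : HilbertBasis ι 𝕜 (SpaceL2 𝕜))
    (hb : ∀ i, star (b i) = b i) {x y : SpaceL2 𝕜} (h : ∀ i, pairing x (b i) = pairing y (b i)) :
    x = y := by
  refine b.repr.injective (lp.ext (funext fun i => ?_))
  rw [b.repr_apply_apply, b.repr_apply_apply, inner_eq_pairing, inner_eq_pairing, hb, pairing_comm,
    h, pairing_comm]

/-- Zero final data make the value at time 0 equal to minus the integral over (0,T). At t = T the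
two integrals cancel, so all Hartley coefficients of the representative vanish there. -/
theorem IsAdjointWeakSolution.weakTransport (hT : 0 < T) {f g σ : TimeL2 T (SpaceL2 𝕜)}
    {v : TimeL2 T (H10 𝕜)} (h : IsAdjointWeakSolution f g σ v) :
    ∃ c, WeakTransport σ (-(f + derivCurve v)) c ∧
      ∀ S : TimeC T (SpaceL2 𝕜), IsContRep S σ → S ⟨T, hT.le, le_rfl⟩ = 0 := by
  let m : (ℝ → 𝕜) → ℝ → 𝕜 := fun ξ s => pairing (σ s) (toL2 (deriv ξ)) +
    pairing ((-(f + derivCurve v)) s) (toL2 ξ)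
  have hm : ∀ ξ, IntegrableOn (m ξ) (Ioo 0 T) := fun ξ =>
    (integrable_pairing_const _ _).add (integrable_pairing_const _ _)
  have key := fun ξ hξ h01 =>
    ae_eq_add_integral_of_final hT (hm ξ) ((isAdjointWeakSolution_iff.1 h).1 ξ hξ h01)
  refine ⟨fun ξ => -∫ s in (0 : ℝ)..T, m ξ s, fun ξ hξ h01 => key ξ hξ h01, fun S hS => ?_⟩
  refine eq_of_pairing_hilbertBasis hartleyBasis star_hartleyBasis fun k => ?_
  have h1 := key (fun x => (hartley k x : 𝕜)) (contDiff_ofReal_comp (contDiff_hartley k))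
    (by simp only [hartley_zero_eq_one k])
  have h2 := hS.pairing_eq hT (hm _) h1 (t := T) ⟨hT.le, le_rfl⟩
  rw [hartleyBasis_apply, map_zero, zero_apply]
  exact h2.trans (neg_add_cancel _)

theorem IsAdjointWeakSolution.weakFlux (hT : 0 < T) {f g σ : TimeL2 T (SpaceL2 𝕜)}
    {v : TimeL2 T (H10 𝕜)} (h : IsAdjointWeakSolution f g σ v) :
    ∃ c, WeakFlux v (-(g + derivCurve v)) (σ + derivCurve v) c ∧
      ∀ V : TimeC T (SpaceL2 𝕜), IsContRep V (fun t => h10Val (v t)) →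
        V ⟨T, hT.le, le_rfl⟩ = 0 := by
  let m : (ℝ → 𝕜) → ℝ → 𝕜 := fun η s => pairing ((-(g + derivCurve v)) s) (toL2 η) +
    pairing ((σ + derivCurve v) s) (toL2 (deriv η))
  have hm : ∀ ξ, IntegrableOn (m ξ) (Ioo 0 T) := fun ξ =>
    (integrable_pairing_const _ _).add (integrable_pairing_const _ _)
  have key := fun η hη h0 h1 =>
    ae_eq_add_integral_of_final hT (hm η) ((isAdjointWeakSolution_iff.1 h).2 η hη h0 h1)
  refine ⟨fun η => -∫ s in (0 : ℝ)..T, m η s, fun η hη h0 h1 => key η hη h0 h1, fun V hV => ?_⟩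
  refine eq_of_pairing_hilbertBasis sineBasis star_sineBasis fun k => ?_
  have h1 := key (fun x => (sineFn k x : 𝕜)) (contDiff_ofReal_comp (contDiff_sineFn k))
    (by simp [sineFn_zero]) (by simp [sineFn_one])
  have h2 := hV.pairing_eq hT (hm _) h1 (t := T) ⟨hT.le, le_rfl⟩
  rw [sineBasis_apply, map_zero, zero_apply]
  exact h2.trans (neg_add_cancel _)

theorem WeakTransport.initial_eq (hT : 0 < T) {w l : TimeL2 T (SpaceL2 𝕜)} {r₀ : SpaceL2 𝕜}
    (h : WeakTransport w l fun ξ => pairing r₀ (toL2 ξ)) {W : TimeC T (SpaceL2 𝕜)}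
    (hW : IsContRep W w) : W ⟨0, le_rfl, hT.le⟩ = r₀ := by
  refine eq_of_pairing_hilbertBasis hartleyBasis star_hartleyBasis fun k => ?_
  have h2 := hW.pairing_eq hT (integrableOn_transportMode w l k) (h.mode k) (t := 0) ⟨le_rfl, hT.le⟩
  rw [h2, intervalIntegral.integral_same, add_zero, hartleyBasis_apply]
  rfl

theorem WeakFlux.initial_eq (hT : 0 < T) {w : TimeL2 T (H10 𝕜)} {l k : TimeL2 T (SpaceL2 𝕜)}
    {u₀ : SpaceL2 𝕜} (h : WeakFlux w l k fun η => pairing u₀ (toL2 η)) {W : TimeC T (SpaceL2 𝕜)}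
    (hW : IsContRep W fun t => h10Val (w t)) : W ⟨0, le_rfl, hT.le⟩ = u₀ := by
  refine eq_of_pairing_hilbertBasis sineBasis star_sineBasis fun k' => ?_
  have hW' : IsContRep W (valCurve w) := hW.congr (by
    filter_upwards [valCurve_ae w] with t ht
    rw [ht])
  have h2 := hW'.pairing_eq hT (integrableOn_fluxMode l k k') (h.mode k') (t := 0) ⟨le_rfl, hT.le⟩
  rw [h2, intervalIntegral.integral_same, add_zero, sineBasis_apply]
  rfl

end Adjoint

/-! ### Lifting the boundary datum by transport -/

section Lift

variable {𝕜 : Type*} [RCLike 𝕜] {T : ℝ}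

/-- Extension by zero from `(0,T)` to the line. -/
def zeroExt (p : TimeL2 T 𝕜) : Lp 𝕜 2 (volume : Measure ℝ) :=
  ((memLp_indicator_iff_restrict measurableSet_Ioo).2 (Lp.memLp p)).toLp ((Ioo 0 T).indicator p)

theorem zeroExt_ae (p : TimeL2 T 𝕜) : zeroExt p =ᵐ[volume] (Ioo 0 T).indicator p :=
  MemLp.coeFn_toLp _

theorem zeroExt_ae_of {p : TimeL2 T 𝕜} {φ : ℝ → 𝕜} (h : p =ᵐ[timeMeasure T] φ) :
    zeroExt p =ᵐ[volume] (Ioo 0 T).indicator φ :=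
  (zeroExt_ae p).trans ((ae_eq_restrict_iff_indicator_ae_eq measurableSet_Ioo).1 h)

theorem zeroExt_add (p q : TimeL2 T 𝕜) : zeroExt (p + q) = zeroExt p + zeroExt q := by
  refine Lp.ext ?_
  filter_upwards [zeroExt_ae_of (Lp.coeFn_add p q), zeroExt_ae p, zeroExt_ae q,
    Lp.coeFn_add (zeroExt p) (zeroExt q)] with x h1 h2 h3 h4
  rw [h4, Pi.add_apply, h1, h2, h3, indicator_add']
  rfl

theorem zeroExt_smul (c : 𝕜) (p : TimeL2 T 𝕜) : zeroExt (c • p) = c • zeroExt p := by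
  refine Lp.ext ?_
  filter_upwards [zeroExt_ae_of (Lp.coeFn_smul c p), zeroExt_ae p,
    Lp.coeFn_smul c (zeroExt p)] with x h1 h2 h3
  rw [h3, Pi.smul_apply, h1, h2]
  simp only [indicator, Pi.smul_apply]
  split_ifs <;> simp

theorem norm_zeroExt (p : TimeL2 T 𝕜) : ‖zeroExt p‖ = ‖p‖ := by
  rw [zeroExt, Lp.norm_toLp, eLpNorm_indicator_eq_eLpNorm_restrict measurableSet_Ioo, Lp.norm_def]

/-- The function `x ↦ P (s - x)` on `(0,1)`. -/
def slice (s : ℝ) : Lp 𝕜 2 (volume : Measure ℝ) →L[𝕜] SpaceL2 𝕜 :=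
  (LpToLpRestrictCLM ℝ 𝕜 𝕜 volume 2 (Ioo 0 1)) ∘L
    (Lp.compMeasurePreservingₗᵢ 𝕜 (fun x => s - x)
      (volume.measurePreserving_sub_left s)).toContinuousLinearMap

theorem slice_ae (s : ℝ) {P : Lp 𝕜 2 (volume : Measure ℝ)} {φ : ℝ → 𝕜} (h : P =ᵐ[volume] φ) :
    slice s P =ᵐ[spaceMeasure] fun x => φ (s - x) := by
  have h1 := LpToLpRestrictCLM_coeFn 𝕜 (Ioo (0 : ℝ) 1)
    (Lp.compMeasurePreserving (fun x => s - x) (volume.measurePreserving_sub_left s) P)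
  have h2 := ae_restrict_of_ae (s := Ioo (0 : ℝ) 1)
    (Lp.coeFn_compMeasurePreserving P (volume.measurePreserving_sub_left s))
  have h3 := ae_restrict_of_ae (s := Ioo (0 : ℝ) 1)
    ((volume.measurePreserving_sub_left s).quasiMeasurePreserving.ae h)
  filter_upwards [h1, h2, h3] with x e1 e2 e3
  exact e1.trans (e2.trans e3)

theorem norm_slice_le (s : ℝ) (P : Lp 𝕜 2 (volume : Measure ℝ)) : ‖slice s P‖ ≤ ‖P‖ := by
  have h : ‖slice s P‖ ≤
      ‖Lp.compMeasurePreserving (fun x => s - x) (volume.measurePreserving_sub_left s) P‖ :=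
    norm_Lp_toLp_restrict_le _ _
  rwa [Lp.norm_compMeasurePreserving] at h

/-- Translations are continuous in L². Hence the lift is continuous in time although p is merely
square integrable. -/
theorem continuous_slice (P : Lp 𝕜 2 (volume : Measure ℝ)) : Continuous fun s => slice s P := by
  have hc : Continuous fun s : ℝ => (⟨fun x => s - x, by fun_prop⟩ : C(ℝ, ℝ)) :=
    ContinuousMap.continuous_of_continuous_uncurry _ (by
      simp only [Function.uncurry_def, ContinuousMap.coe_mk]
      fun_prop)
  have h := Continuous.compMeasurePreservingLp (f := fun _ : ℝ => P) (p := 2) continuous_const hc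
    (fun s => volume.measurePreserving_sub_left s) (by simp)
  exact (LpToLpRestrictCLM ℝ 𝕜 𝕜 volume 2 (Ioo 0 1)).continuous.comp h

/-- The solution at time `t` of the transport equation on the unit interval, with jump `p` of the
boundary values and zero initial value. -/
def liftFun (p : TimeL2 T 𝕜) (t : ℝ) : SpaceL2 𝕜 :=
  ∑ j ∈ Finset.range (⌈T⌉₊ + 1), slice (t - j) (zeroExt p)

theorem continuous_liftFun (p : TimeL2 T 𝕜) : Continuous (liftFun p) :=
  continuous_finsetSum _ fun j _ => (continuous_slice (zeroExt p)).comp (by fun_prop)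

theorem norm_liftFun_le (p : TimeL2 T 𝕜) (t : ℝ) : ‖liftFun p t‖ ≤ (⌈T⌉₊ + 1) * ‖p‖ := by
  have h : ∀ j ∈ Finset.range (⌈T⌉₊ + 1), ‖slice (t - j) (zeroExt p)‖ ≤ ‖p‖ := fun j _ => by
    rw [← norm_zeroExt p]
    exact norm_slice_le _ _
  calc ‖liftFun p t‖ ≤ ∑ j ∈ Finset.range (⌈T⌉₊ + 1), ‖p‖ := norm_sum_le_of_le _ h
    _ = (⌈T⌉₊ + 1) * ‖p‖ := by
      rw [Finset.sum_const, Finset.card_range, nsmul_eq_mul]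
      push_cast
      rfl

/-- At t = 0 the arguments -j - x are negative, where the extension of p vanishes. -/
theorem liftFun_zero (p : TimeL2 T 𝕜) : liftFun p 0 = 0 := by
  refine Finset.sum_eq_zero fun j _ => Lp.ext ?_
  filter_upwards [slice_ae (0 - j) (zeroExt_ae p), Lp.coeFn_zero 𝕜 2 spaceMeasure,
    ae_restrict_mem measurableSet_Ioo] with x h1 h2 h3
  rw [h1, h2, indicator_of_notMem, Pi.zero_apply]
  have : (0 : ℝ) ≤ j := j.cast_nonneg
  exact fun h => by linarith [h.1, h3.1]

/-- The curve `liftFun p` as an element of `L²(0,T;L²(0,1))`, depending linearly on `p`. -/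
def lift : TimeL2 T 𝕜 →L[𝕜] TimeL2 T (SpaceL2 𝕜) :=
  LinearMap.mkContinuous
    { toFun := fun p => toTimeL2 T (liftFun p)
      map_add' := fun p q => by
        rw [← toTimeL2_add (continuous_liftFun p) (continuous_liftFun q)]
        congr 1
        ext1 t
        simp only [liftFun, zeroExt_add, map_add, Pi.add_apply, Finset.sum_add_distrib]
      map_smul' := fun c p => by
        rw [RingHom.id_apply, ← toTimeL2_smul c (continuous_liftFun p)]
        congr 1
        ext1 t
        simp only [liftFun, zeroExt_smul, map_smul, Pi.smul_apply, Finset.smul_sum] }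
    (measureUnivNNReal (timeMeasure T) ^ (2 : ENNReal).toReal⁻¹ * (⌈T⌉₊ + 1)) (fun p => by
      rw [mul_assoc]
      refine Lp.norm_le_of_ae_bound (by positivity) ?_
      filter_upwards [toTimeL2_ae (continuous_liftFun p)] with t ht
      exact (congrArg norm ht).trans_le (norm_liftFun_le p t))

theorem lift_ae (p : TimeL2 T 𝕜) : lift p =ᵐ[timeMeasure T] liftFun p :=
  toTimeL2_ae (continuous_liftFun p)

/-- The continuous representative of `lift p`. -/
def liftCurve (p : TimeL2 T 𝕜) : TimeC T (SpaceL2 𝕜) :=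
  ⟨fun t => liftFun p t, (continuous_liftFun p).comp continuous_subtype_val⟩

theorem isContRep_liftCurve (p : TimeL2 T 𝕜) : IsContRep (liftCurve p) (lift p) := by
  filter_upwards [lift_ae p, ae_restrict_mem measurableSet_Ioo] with t h1 h2
  exact ⟨Ioo_subset_Icc_self h2, h1.symm⟩

theorem norm_liftCurve_le (p : TimeL2 T 𝕜) : ‖liftCurve p‖ ≤ (⌈T⌉₊ + 1) * ‖p‖ :=
  (ContinuousMap.norm_le _ (by positivity)).2 fun t => norm_liftFun_le p t

theorem integral_deriv_sub_mul {Φ ξ : ℝ → 𝕜} (hΦ : ContDiff ℝ ∞ Φ) (hξ : ContDiff ℝ ∞ ξ) (s : ℝ) :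
    ∫ x in (0 : ℝ)..1, deriv Φ (s - x) * ξ x =
      (∫ x in (0 : ℝ)..1, Φ (s - x) * deriv ξ x) + (Φ s * ξ 0 - Φ (s - 1) * ξ 1) := by
  have hd : ∀ x, HasDerivAt (fun x => -Φ (s - x)) (deriv Φ (s - x)) x := fun x => by
    have h1 : HasDerivAt Φ (deriv Φ (s - x)) (s - x) :=
      (hΦ.differentiable (by simp) (s - x)).hasDerivAt
    have h2 := (HasDerivAt.scomp x h1 ((hasDerivAt_id x).const_sub s)).fun_neg
    simp only [neg_smul, one_smul, neg_neg] at h2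
    exact h2
  have c1 : Continuous fun x => deriv Φ (s - x) :=
    hΦ.continuous_deriv_infty.comp (by fun_prop)
  have key := intervalIntegral.integral_deriv_mul_eq_sub (a := 0) (b := 1)
    (fun x _ => hd x) (fun x _ => (hξ.differentiable (by simp) x).hasDerivAt)
    (c1.intervalIntegrable _ _) (hξ.continuous_deriv_infty.intervalIntegrable _ _)
  have i1 : IntervalIntegrable (fun x => deriv Φ (s - x) * ξ x) volume 0 1 :=
    (c1.mul hξ.continuous).intervalIntegrable _ _
  have c2 : Continuous fun x => Φ (s - x) := hΦ.continuous.comp (by fun_prop)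
  have i2 : IntervalIntegrable (fun x => -Φ (s - x) * deriv ξ x) volume 0 1 :=
    (c2.neg.mul hξ.continuous_deriv_infty).intervalIntegrable _ _
  rw [intervalIntegral.integral_add i1 i2] at key
  simp only [neg_mul, intervalIntegral.integral_neg, sub_zero] at key
  linear_combination key

/-- The weak form of the transport equation for `Φ (t - x)`. -/
theorem integral_translate_mul {Φ ξ : ℝ → 𝕜} (hΦ : ContDiff ℝ ∞ Φ) (hξ : ContDiff ℝ ∞ ξ) (t : ℝ) :
    ∫ x in (0 : ℝ)..1, Φ (t - x) * ξ x = (∫ x in (0 : ℝ)..1, Φ (0 - x) * ξ x) +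
      ∫ s in (0 : ℝ)..t, ((∫ x in (0 : ℝ)..1, Φ (s - x) * deriv ξ x) +
        (Φ s * ξ 0 - Φ (s - 1) * ξ 1)) := by
  -- Integration by parts in x hides the boundary terms in ∫ Φ'(s - x) ξ(x) dx; after Fubini the
  -- integral in s is explicit.
  simp_rw [← integral_deriv_sub_mul hΦ hξ]
  have cf : Continuous (Function.uncurry fun s x : ℝ => deriv Φ (s - x) * ξ x) :=
    (hΦ.continuous_deriv_infty.comp (continuous_fst.sub continuous_snd)).mul
      (hξ.continuous.comp continuous_snd)
  rw [intervalIntegral_intervalIntegral_swap (F := fun s x : ℝ => deriv Φ (s - x) * ξ x) (by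
    exact (cf.continuousOn.integrableOn_compact (isCompact_uIcc.prod isCompact_uIcc)).mono_set
      (prod_mono uIoc_subset_uIcc uIoc_subset_uIcc))]
  have hd : ∀ x s, HasDerivAt (fun s => Φ (s - x)) (deriv Φ (s - x)) s := fun x s => by
    have h1 : HasDerivAt Φ (deriv Φ (s - x)) (s - x) :=
      (hΦ.differentiable (by simp) (s - x)).hasDerivAt
    have h2 := HasDerivAt.scomp s h1 ((hasDerivAt_id s).sub_const x)
    rw [one_smul] at h2
    exact h2
  have hin : ∀ x, ∫ s in (0 : ℝ)..t, deriv Φ (s - x) * ξ x = Φ (t - x) * ξ x - Φ (0 - x) * ξ x :=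
    fun x => by
    have c : Continuous fun s => deriv Φ (s - x) := hΦ.continuous_deriv_infty.comp (by fun_prop)
    rw [intervalIntegral.integral_mul_const, intervalIntegral.integral_eq_sub_of_hasDerivAt
      (fun s _ => hd x s) (c.intervalIntegrable _ _), sub_mul]
  simp_rw [hin]
  have c1 : Continuous fun x => Φ (t - x) * ξ x := (hΦ.continuous.comp (by fun_prop)).mul hξ.continuous
  have c2 : Continuous fun x => Φ (0 - x) * ξ x := (hΦ.continuous.comp (by fun_prop)).mul hξ.continuous
  rw [intervalIntegral.integral_sub (c1.intervalIntegrable _ _) (c2.intervalIntegrable _ _)]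
  ring

theorem pairing_toL2_toL2 {φ ψ : ℝ → 𝕜} (h : Continuous φ) (h' : Continuous ψ) :
    pairing (toL2 φ) (toL2 ψ) = ∫ x in (0 : ℝ)..1, φ x * ψ x := by
  rw [pairing_toL2 _ h', intervalIntegral.integral_of_le zero_le_one, integral_Ioc_eq_integral_Ioo]
  refine integral_congr_ae ?_
  filter_upwards [toL2_ae h] with x hx
  rw [hx]

/-- For smooth `p`, the weak form of the transport equation satisfied by `liftFun p`. -/
theorem pairing_liftFun {φ : ℝ → 𝕜} (hφ : ContDiff ℝ ∞ φ) (hs : tsupport φ ⊆ Ioo 0 T) {ξ : ℝ → 𝕜}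
    (hξ : ContDiff ℝ ∞ ξ) (h01 : ξ 0 = ξ 1) {t : ℝ} (ht : t ∈ Icc 0 T) :
    pairing (liftFun (toTimeL2 T φ) t) (toL2 ξ) =
      ∫ s in (0 : ℝ)..t, (pairing (liftFun (toTimeL2 T φ) s) (toL2 (deriv ξ)) + φ s * ξ 0) := by
  let N := ⌈T⌉₊ + 1
  let Φ : ℝ → 𝕜 := fun y => ∑ j ∈ Finset.range N, φ (y - j)
  have hΦ : ContDiff ℝ ∞ Φ := ContDiff.sum fun j _ => hφ.comp (by fun_prop)
  have hoff : ∀ x, x ∉ Ioo 0 T → φ x = 0 := fun x hx =>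
    image_eq_zero_of_notMem_tsupport fun h => hx (hs h)
  have hind : (Ioo 0 T).indicator φ = φ := by
    refine indicator_eq_self.2 fun x hx => ?_
    by_contra h
    exact hx (hoff x h)
  have hz : zeroExt (toTimeL2 T φ) =ᵐ[volume] φ := by
    have := zeroExt_ae_of (toTimeL2_ae (T := T) hφ.continuous)
    rwa [hind] at this
  have hlift : ∀ s, liftFun (toTimeL2 T φ) s = toL2 fun x => Φ (s - x) := fun s => by
    have c : ∀ j : ℕ, Continuous fun x => φ (s - j - x) := fun j =>
      hφ.continuous.comp (by fun_prop)
    have e : ∀ j : ℕ, slice (s - j) (zeroExt (toTimeL2 T φ)) = toL2 fun x => φ (s - j - x) :=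
      fun j => eq_toL2 (c j) (slice_ae (s - j) hz)
    have hsum : ∀ n : ℕ, ∑ j ∈ Finset.range n, toL2 (fun x => φ (s - j - x)) =
        toL2 fun x => ∑ j ∈ Finset.range n, φ (s - j - x) := fun n => by
      induction n with
      | zero => simp [toL2_zero_fun]
      | succ n ih =>
        rw [Finset.sum_range_succ, ih,
          ← toL2_add (continuous_finsetSum _ fun j _ => c j) (c n)]
        congr 1
        ext x
        simp [Finset.sum_range_succ]
    simp only [liftFun, e]
    rw [hsum]
    congr 1
    ext x
    refine Finset.sum_congr rfl fun j _ => ?_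
    rw [sub_right_comm]
  have hc : ∀ s, Continuous fun x => Φ (s - x) := fun s => hΦ.continuous.comp (by fun_prop)
  have h0 := integral_translate_mul hΦ hξ t
  rw [← pairing_toL2_toL2 (hc t) hξ.continuous, ← pairing_toL2_toL2 (hc 0) hξ.continuous,
    ← hlift, ← hlift, liftFun_zero, map_zero, zero_apply, zero_add] at h0
  rw [h0]
  refine intervalIntegral.integral_congr fun s hs' => ?_
  rw [uIcc_of_le ht.1] at hs'
  -- The jump between the two end points telescopes. The last translate vanishes because the number
  -- of terms exceeds T, so s - N is negative.
  have htel : Φ s - Φ (s - 1) = φ s := by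
    have h1 : Φ (s - 1) = ∑ j ∈ Finset.range N, φ (s - (j + 1 : ℕ)) := by
      refine Finset.sum_congr rfl fun j _ => ?_
      push_cast
      ring_nf
    have h2 := Finset.sum_range_sub' (fun j : ℕ => φ (s - j)) N
    rw [Finset.sum_sub_distrib, ← h1] at h2
    have h3 : φ (s - N) = 0 := hoff _ fun h => by
      have h4 := Nat.le_ceil T
      have h5 := h.1
      simp only [N, Nat.cast_add, Nat.cast_one] at h5
      linarith [hs'.2, ht.2]
    rw [h3] at h2
    simpa using h2
  simp only [← pairing_toL2_toL2 (hc s) hξ.continuous_deriv_infty, ← hlift]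
  rw [← h01, ← sub_mul, htel]

end Lift

/-! ### Existence and uniqueness of the trace at x = 1 -/

section Trace

variable {𝕜 : Type*} [RCLike 𝕜] {T : ℝ}

/-- Riesz representation with respect to the bilinear pairing of `L²(0,T)`. -/
theorem exists_integral_mul_eq (ℓ : TimeL2 T 𝕜 →L[𝕜] 𝕜) :
    ∃ τ : TimeL2 T 𝕜, ∀ p : TimeL2 T 𝕜, ∫ t in Ioo (0 : ℝ) T, τ t * p t = ℓ p := by
  let y := (InnerProductSpace.toDual 𝕜 (TimeL2 T 𝕜)).symm ℓ
  refine ⟨star y, fun p => ?_⟩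
  rw [← InnerProductSpace.toDual_symm_apply (𝕜 := 𝕜) (E := TimeL2 T 𝕜), L2.inner_def]
  refine integral_congr_ae ?_
  filter_upwards [Lp.coeFn_star y] with t ht
  rw [ht, Pi.star_apply, RCLike.inner_apply, mul_comm]
  rfl

theorem integral_trace_term (h σ : SpaceL2 𝕜) (a b : 𝕜) {χ : ℝ → 𝕜} (hχ : ContDiff ℝ ∞ χ) :
    ∫ x in Ioo (0 : ℝ) 1, (h x * (a * χ x) + σ x * (b * χ x + a * deriv χ x)) =
      a * pairing h (toL2 χ) + (b * pairing σ (toL2 χ) + a * pairing σ (toL2 (deriv χ))) := by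
  have c := hχ.continuous
  have c' := hχ.continuous_deriv_infty
  rw [pairing_toL2 _ c, pairing_toL2 _ c, pairing_toL2 _ c', ← integral_const_mul,
    ← integral_const_mul, ← integral_const_mul, ← integral_add
      ((integrable_mul_of_continuous σ c).const_mul b)
      ((integrable_mul_of_continuous σ c').const_mul a)]
  have i1 := (integrable_mul_of_continuous h c).const_mul a
  have i2 : Integrable (fun x => b * (σ x * χ x) + a * (σ x * deriv χ x)) spaceMeasure :=
    ((integrable_mul_of_continuous σ c).const_mul b).add
      ((integrable_mul_of_continuous σ c').const_mul a)
  rw [← integral_add i1 i2]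
  refine integral_congr_ae (Filter.Eventually.of_forall fun x => ?_)
  ring

theorem isContRep_of_continuous {E : Type*} [NormedAddCommGroup E] {c : ℝ → E}
    (hc : Continuous c) :
    IsContRep (⟨fun t => c t, hc.comp continuous_subtype_val⟩ : TimeC T E) (toTimeL2 T c) := by
  filter_upwards [toTimeL2_ae (T := T) hc, ae_restrict_mem measurableSet_Ioo] with t h1 h2
  exact ⟨Ioo_subset_Icc_self h2, h1.symm⟩

theorem pairing_toL2_deriv_add {χ ξ : ℝ → 𝕜} (hχ : ContDiff ℝ ∞ χ) (hξ : ContDiff ℝ ∞ ξ)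
    (h0 : χ 0 = 0) :
    pairing (toL2 χ) (toL2 (deriv ξ)) + pairing (toL2 (deriv χ)) (toL2 ξ) = χ 1 * ξ 1 := by
  have key := intervalIntegral.integral_deriv_mul_eq_sub (a := 0) (b := 1)
    (fun x _ => (hχ.differentiable (by simp) x).hasDerivAt)
    (fun x _ => (hξ.differentiable (by simp) x).hasDerivAt)
    (hχ.continuous_deriv_infty.intervalIntegrable _ _)
    (hξ.continuous_deriv_infty.intervalIntegrable _ _)
  have c1 : Continuous fun x => deriv χ x * ξ x := hχ.continuous_deriv_infty.mul hξ.continuous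
  have c2 : Continuous fun x => χ x * deriv ξ x := hχ.continuous.mul hξ.continuous_deriv_infty
  rw [intervalIntegral.integral_add (c1.intervalIntegrable _ _) (c2.intervalIntegrable _ _),
    ← pairing_toL2_toL2 hχ.continuous_deriv_infty hξ.continuous,
    ← pairing_toL2_toL2 hχ.continuous hξ.continuous_deriv_infty, h0, zero_mul, sub_zero] at key
  rw [add_comm, key]

/-- The periodic correction of the curve `θ(t) χ(x)` by the lift of its boundary values solves the
transport equation. -/
theorem weakTransport_smul_add_lift {θ χ : ℝ → 𝕜} (hθ : ContDiff ℝ ∞ θ)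
    (hθs : tsupport θ ⊆ Ioo 0 T) (hχ : ContDiff ℝ ∞ χ) (h0 : χ 0 = 0) :
    WeakTransport (toTimeL2 T ((fun t => θ t • toL2 χ) + liftFun (toTimeL2 T (χ 1 • θ))))
      (toTimeL2 T fun t => deriv θ t • toL2 χ + θ t • toL2 (deriv χ)) fun ξ => pairing 0 (toL2 ξ) := by
  intro ξ hξ h01
  have hθ0 : θ 0 = 0 := image_eq_zero_of_notMem_tsupport fun h => lt_irrefl _ (hθs h).1
  have hs : tsupport (χ 1 • θ) ⊆ Ioo 0 T := (closure_mono (by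
    exact Function.support_const_smul_subset (χ 1) θ)).trans hθs
  have hp : ContDiff ℝ ∞ (χ 1 • θ) := hθ.const_smul (χ 1)
  have hc : Continuous ((fun t => θ t • toL2 χ) + liftFun (toTimeL2 T (χ 1 • θ))) :=
    (hθ.continuous.smul continuous_const).add (continuous_liftFun _)
  have hc' : Continuous fun t => deriv θ t • toL2 χ + θ t • toL2 (deriv χ) :=
    (hθ.continuous_deriv_infty.smul continuous_const).add (hθ.continuous.smul continuous_const)
  filter_upwards [toTimeL2_ae (T := T) hc, ae_restrict_mem measurableSet_Ioo] with t h1 h2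
  -- The curve θχ has boundary values 0 and θ(t)χ(1); the lift of χ(1)θ has exactly the compensating
  -- jump, so the sum can be tested with periodic ξ.
  rw [h1, map_zero, zero_apply, zero_add, Pi.add_apply, map_add, add_apply,
    pairing_liftFun hp hs hξ h01 (Ioo_subset_Icc_self h2), map_smul, smul_apply,
    smul_eq_mul]
  have hft : θ t = ∫ s in (0 : ℝ)..t, deriv θ s := by
    rw [intervalIntegral.integral_deriv_eq_sub (fun s _ => hθ.differentiable (by simp) s)
      (hθ.continuous_deriv_infty.intervalIntegrable _ _), hθ0, sub_zero]
  have cl : Continuous fun s => pairing (liftFun (toTimeL2 T (χ 1 • θ)) s) (toL2 (deriv ξ)) +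
      (χ 1 • θ) s * ξ 0 :=
    (((pairing (𝕜 := 𝕜)).flip (toL2 (deriv ξ))).continuous.comp (continuous_liftFun _)).add
      ((hθ.continuous.const_smul (χ 1)).mul continuous_const)
  have cd : Continuous fun s => deriv θ s * pairing (toL2 χ) (toL2 ξ) :=
    hθ.continuous_deriv_infty.mul continuous_const
  rw [hft, ← intervalIntegral.integral_mul_const, ← intervalIntegral.integral_add
    (cd.intervalIntegrable _ _) (cl.intervalIntegrable _ _)]
  refine integral_congr_of_ae ?_ le_rfl h2.1.le h2.2.le
  filter_upwards [toTimeL2_ae (T := T) hc, toTimeL2_ae (T := T) hc'] with s e1 e2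
  rw [e1, e2, Pi.add_apply]
  simp only [map_add, map_smul, add_apply, smul_apply, smul_eq_mul, Pi.smul_apply]
  rw [h01]
  linear_combination -θ s * pairing_toL2_deriv_add hχ hξ h0

theorem timePairing_toTimeL2 {c : ℝ → SpaceL2 𝕜} (hc : Continuous c) (a : TimeL2 T (SpaceL2 𝕜)) :
    timePairing (toTimeL2 T c) a = ∫ t in Ioo (0 : ℝ) T, pairing (a t) (c t) := by
  rw [timePairing_apply]
  refine integral_congr_ae ?_
  filter_upwards [toTimeL2_ae (T := T) hc] with t ht
  rw [ht, pairing_comm]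

/-- Formally, integrating d/dt ∫ L σ with L = `lift p` gives 0 = ∫ p σ(·,1) + ∫∫ L h, since L(0) =
0, σ(T) = 0 and σ is periodic; this dictates the condition on τ. The proof applies the product rule
to σ and the periodic curve θχ + L with p = χ(1)θ. -/
theorem isTraceAtOne_of_weakTransport (hT : 0 < T) {σ h : TimeL2 T (SpaceL2 𝕜)}
    {c : (ℝ → 𝕜) → 𝕜} (hσ : WeakTransport σ h c) {S : TimeC T (SpaceL2 𝕜)} (hS : IsContRep S σ)
    (hST : S ⟨T, hT.le, le_rfl⟩ = 0) {τ : TimeL2 T 𝕜}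
    (hτ : ∀ p : TimeL2 T 𝕜, ∫ t in Ioo (0 : ℝ) T, τ t * p t = -timePairing (lift p) h) :
    IsTraceAtOne σ τ := by
  refine ⟨h, fun θ χ hθ _ hθs hχ hχs => ?_⟩
  have h0 : χ 0 = 0 := image_eq_zero_of_notMem_tsupport fun h => lt_irrefl (0 : ℝ) (hχs h)
  have hθ0 : θ 0 = 0 := image_eq_zero_of_notMem_tsupport fun h => lt_irrefl _ (hθs h).1
  have c1 : Continuous fun t => θ t • toL2 χ := hθ.continuous.smul continuous_const
  have c2 : Continuous fun t => deriv θ t • toL2 χ + θ t • toL2 (deriv χ) :=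
    (hθ.continuous_deriv_infty.smul continuous_const).add (hθ.continuous.smul continuous_const)
  have key := (weakTransport_smul_add_lift hθ hθs hχ h0).pairing_sub hT hσ
    (isContRep_of_continuous (c1.add (continuous_liftFun _))) hS
  have hW0 : ((fun t => θ t • toL2 χ) + liftFun (toTimeL2 T (χ 1 • θ))) 0 = 0 := by
    simp [hθ0, liftFun_zero]
  simp only [ContinuousMap.coe_mk] at key
  rw [hST, hW0, map_zero, map_zero, zero_apply, sub_zero, toTimeL2_add c1 (continuous_liftFun _),
    map_add, add_apply] at key
  have hp : ∫ t in Ioo (0 : ℝ) T, τ t * (θ t * χ 1) =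
      -timePairing (lift (toTimeL2 T (χ 1 • θ))) h := by
    rw [← hτ]
    refine integral_congr_ae ?_
    filter_upwards [toTimeL2_ae (T := T) (hθ.continuous.const_smul (χ 1))] with t ht
    rw [show toTimeL2 T (χ 1 • θ) t = _ from ht, Pi.smul_apply, smul_eq_mul, mul_comm (θ t)]
  rw [hp]
  simp_rw [integral_trace_term _ _ _ _ hχ]
  change 0 = _ + (_ + timePairing (lift (toTimeL2 T (χ 1 • θ))) h) at key
  rw [timePairing_toTimeL2 c1, timePairing_toTimeL2 c2] at key
  have i1 : IntegrableOn (fun t => pairing (h t) (θ t • toL2 χ)) (Ioo 0 T) :=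
    (integrable_pairing h (toTimeL2 T fun t => θ t • toL2 χ)).congr (by
      filter_upwards [toTimeL2_ae (T := T) c1] with t ht
      rw [ht])
  have i2 : IntegrableOn (fun t => pairing (σ t) (deriv θ t • toL2 χ + θ t • toL2 (deriv χ)))
      (Ioo 0 T) :=
    (integrable_pairing σ (toTimeL2 T fun t => deriv θ t • toL2 χ + θ t • toL2 (deriv χ))).congr (by
      filter_upwards [toTimeL2_ae (T := T) c2] with t ht
      rw [ht])
  have hadd := integral_add i1 i2
  simp only [map_add, map_smul, smul_eq_mul] at hadd key
  rw [hadd]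
  linear_combination -key

/-- The two traces may come with different h and h'. Test functions χ_n equal to 1 at x = 1 and
tending to 0 in L² make the contribution of h - h' disappear in the limit. -/
theorem IsTraceAtOne.unique {σ : TimeL2 T (SpaceL2 𝕜)} {τ τ' : TimeL2 T 𝕜}
    (hτ : IsTraceAtOne σ τ) (hτ' : IsTraceAtOne σ τ') : τ = τ' := by
  obtain ⟨h, hh⟩ := hτ
  obtain ⟨h', hh'⟩ := hτ'
  -- The transition takes place on an interval of length 1/(n+2) ending at 1; the shift by 2 keeps
  -- the support away from x = 0 already for n = 0.
  let χ : ℕ → ℝ → 𝕜 := fun n x => ((Real.smoothTransition ((n + 2) * (x - 1) + 1) : ℝ) : 𝕜)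
  have hχ : ∀ n, ContDiff ℝ ∞ (χ n) := fun n =>
    contDiff_ofReal_comp (Real.smoothTransition.contDiff.comp (by fun_prop))
  have hχ1 : ∀ n, χ n 1 = 1 := fun n => by simp [χ]
  have hχ0 : ∀ n : ℕ, ∀ x : ℝ, x ≤ 1 - 1 / (n + 2) → χ n x = 0 := fun n x hx => by
    have hn : (0 : ℝ) < n + 2 := by positivity
    have : (n + 2) * (x - 1) + 1 ≤ 0 := by
      have h1 : (n + 2 : ℝ) * (x - 1) ≤ (n + 2) * (-(1 / (n + 2))) := by
        gcongr
        linarith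
      rw [mul_neg, mul_one_div_cancel hn.ne'] at h1
      linarith
    simp only [χ, Real.smoothTransition.zero_of_nonpos this, RCLike.ofReal_zero]
  have hχs : ∀ n, tsupport (χ n) ⊆ Ioi 0 := fun n x hx => by
    have hsub : tsupport (χ n) ⊆ Ici (1 - 1 / (n + 2 : ℝ)) := by
      refine closure_minimal (fun y hy => ?_) isClosed_Ici
      by_contra hlt
      exact hy (hχ0 n y (not_le.1 hlt).le)
    have h1 := hsub hx
    have h2 : (1 : ℝ) / (n + 2) < 1 := by
      rw [div_lt_one (by positivity)]
      linarith [n.cast_nonneg (α := ℝ)]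
    simp only [mem_Ici, mem_Ioi] at h1 ⊢
    linarith
  have hlim : Filter.Tendsto (fun n => toL2 (χ n)) Filter.atTop (nhds 0) := by
    rw [← toL2_zero_fun (𝕜 := 𝕜)]
    refine tendsto_toL2 (fun n => (hχ n).continuous) continuous_const (C := 1) ?_ ?_
    · intro n x _
      simp only [χ, RCLike.norm_ofReal, abs_of_nonneg (Real.smoothTransition.nonneg _)]
      exact Real.smoothTransition.le_one _
    · intro x hx
      refine tendsto_const_nhds.congr' ?_
      obtain ⟨N, hN⟩ := exists_nat_gt (1 / (1 - x))
      filter_upwards [Filter.eventually_ge_atTop N] with n hn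
      refine (hχ0 n x ?_).symm
      have h1 : 0 < 1 - x := by linarith [hx.2]
      have h2 : 1 / (1 - x) < n + 2 := by
        have : (N : ℝ) ≤ n := by exact_mod_cast hn
        linarith
      have h3 : 1 / (n + 2 : ℝ) < 1 - x := by
        rw [div_lt_iff₀ (by positivity)]
        rw [div_lt_iff₀ h1] at h2
        linarith
      linarith
  rw [← sub_eq_zero]
  refine Lp.ext ?_
  have hDi : IntegrableOn (fun t => τ t - τ' t) (Ioo 0 T) :=
    (integrable_timeL2 τ).sub (integrable_timeL2 τ')
  have hD : ∀ᵐ t ∂volume, t ∈ Ioo 0 T → τ t - τ' t = 0 := by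
    refine isOpen_Ioo.ae_eq_zero_of_integral_contDiff_smul_eq_zero hDi.locallyIntegrableOn
      fun q hq hqc hqs => ?_
    let θ : ℝ → 𝕜 := fun t => (q t : 𝕜)
    have hθ : ContDiff ℝ ∞ θ := contDiff_ofReal_comp hq
    have hsupp : Function.support θ ⊆ Function.support q := fun t ht h => ht (by simp [θ, h])
    have hθs : tsupport θ ⊆ Ioo 0 T := (closure_mono hsupp).trans hqs
    have hθc : HasCompactSupport θ := hqc.mono hsupp
    obtain ⟨C, hC⟩ := hθ.continuous.bounded_above_of_compact_support hθc
    -- The σ terms are the same in both trace identities and cancel.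
    have hid : ∀ n, ∫ t in Ioo (0 : ℝ) T, θ t * (τ t - τ' t) =
        timePairing (h - h') (toTimeL2 T fun t => θ t • toL2 (χ n)) := fun n => by
      have c1 : Continuous fun t => θ t • toL2 (χ n) := hθ.continuous.smul continuous_const
      have c3 : Continuous fun t => θ t • toL2 (deriv (χ n)) := hθ.continuous.smul continuous_const
      have c2 : Continuous fun t => deriv θ t • toL2 (χ n) :=
        hθ.continuous_deriv_infty.smul continuous_const
      have hi : ∀ (a : TimeL2 T (SpaceL2 𝕜)) (e : ℝ → SpaceL2 𝕜), Continuous e →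
          IntegrableOn (fun t => pairing (a t) (e t)) (Ioo 0 T) := fun a e he =>
        (integrable_pairing a (toTimeL2 T e)).congr (by
          filter_upwards [toTimeL2_ae (T := T) he] with t ht
          rw [ht])
      have i0 : ∀ a : TimeL2 T 𝕜, IntegrableOn (fun t => a t * (θ t * χ n 1)) (Ioo 0 T) := fun a => by
        simp only [hχ1, mul_one]
        refine (integrable_timeL2 a).mul_bdd (c := C) hθ.continuous.aestronglyMeasurable
          (Filter.Eventually.of_forall hC)
      have e1 := hh θ (χ n) hθ hθc hθs (hχ n) (hχs n)
      have e2 := hh' θ (χ n) hθ hθc hθs (hχ n) (hχs n)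
      simp_rw [integral_trace_term _ _ _ _ (hχ n)] at e1 e2
      have i23 : IntegrableOn (fun t => deriv θ t * pairing (σ t) (toL2 (χ n)) +
          θ t * pairing (σ t) (toL2 (deriv (χ n)))) (Ioo 0 T) := by
        refine ((hi σ _ c2).add (hi σ _ c3)).congr (Filter.Eventually.of_forall fun t => ?_)
        simp only [Pi.add_apply, map_smul, smul_eq_mul]
      have i1 : ∀ a : TimeL2 T (SpaceL2 𝕜),
          IntegrableOn (fun t => θ t * pairing (a t) (toL2 (χ n))) (Ioo 0 T) := fun a => by
        simpa only [map_smul, smul_eq_mul] using hi a _ c1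
      rw [integral_add (i1 h) i23] at e1
      rw [integral_add (i1 h') i23] at e2
      have e3 := integral_sub (i0 τ) (i0 τ')
      rw [map_sub, sub_apply, timePairing_comm, timePairing_comm h', timePairing_toTimeL2 c1,
        timePairing_toTimeL2 c1]
      simp only [map_smul, smul_eq_mul]
      rw [← e1, ← e2] at e3
      rw [add_sub_add_right_eq_sub] at e3
      rw [← e3]
      refine integral_congr_ae (Filter.Eventually.of_forall fun t => ?_)
      simp only [hχ1]
      ring
    have hn : ∀ n, ‖∫ t in Ioo (0 : ℝ) T, θ t * (τ t - τ' t)‖ ≤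
        ‖timePairing (h - h')‖ * ((measureUnivNNReal (timeMeasure T) ^ (2 : ENNReal).toReal⁻¹) *
          (C * ‖toL2 (χ n)‖)) := fun n => by
      rw [hid n]
      refine (ContinuousLinearMap.le_opNorm _ _).trans ?_
      gcongr
      have hC0 : 0 ≤ C := (norm_nonneg _).trans (hC 0)
      refine Lp.norm_le_of_ae_bound (by positivity) ?_
      have c1 : Continuous fun t => θ t • toL2 (χ n) := hθ.continuous.smul continuous_const
      filter_upwards [toTimeL2_ae (T := T) c1] with t ht
      rw [show (toTimeL2 T fun t => θ t • toL2 (χ n)) t = _ from ht, norm_smul]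
      gcongr
      exact hC t
    have hzero : ∫ t in Ioo (0 : ℝ) T, θ t * (τ t - τ' t) = 0 := by
      have hr := (((hlim.norm).const_mul C).const_mul
        ((measureUnivNNReal (timeMeasure T) : ℝ) ^ (2 : ENNReal).toReal⁻¹)).const_mul
        ‖timePairing (h - h')‖
      rw [norm_zero, mul_zero, mul_zero, mul_zero] at hr
      exact norm_le_zero_iff.1 (ge_of_tendsto' hr hn)
    rw [← hzero, ← setIntegral_eq_integral_of_forall_compl_eq_zero (s := Ioo 0 T)]
    · refine integral_congr_ae (Filter.Eventually.of_forall fun t => ?_)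
      simp only [θ, RCLike.real_smul_eq_coe_mul]
    · intro t ht
      rw [image_eq_zero_of_notMem_tsupport fun h => ht (hqs h), zero_smul]
  rw [← ae_restrict_iff' measurableSet_Ioo] at hD
  filter_upwards [hD, Lp.coeFn_sub τ τ', Lp.coeFn_zero 𝕜 2 (timeMeasure T)] with t h1 h2 h3
  rw [h2, h3, Pi.sub_apply, h1, Pi.zero_apply]

end Trace

/-! ### Solutions in the sense of transposition -/

section Transposition

variable {𝕜 : Type*} [RCLike 𝕜] {T : ℝ}

/-- The bilinear pairing `∫ a b` of `L²(0,T)`. -/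
def scalarPairing : TimeL2 T 𝕜 →L[𝕜] TimeL2 T 𝕜 →L[𝕜] 𝕜 :=
  (ContinuousLinearMap.mul 𝕜 𝕜).lpPairing (timeMeasure T) 2 2

theorem scalarPairing_apply (a b : TimeL2 T 𝕜) :
    scalarPairing a b = ∫ t in Ioo (0 : ℝ) T, a t * b t :=
  ContinuousLinearMap.lpPairing_eq_integral _ _ _

theorem isTranspositionSolution_iff (hT : 0 < T) {ρ₀ u₀ : SpaceL2 𝕜} {p : TimeL2 T 𝕜}
    {U : TimeL2 T (SpaceL2 𝕜) × TimeL2 T (SpaceL2 𝕜)} :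
    IsTranspositionSolution hT ρ₀ u₀ p U ↔
      ∀ (f g σ : TimeL2 T (SpaceL2 𝕜)) (v : TimeL2 T (H10 𝕜)) (S V : TimeC T (SpaceL2 𝕜))
        (τ : TimeL2 T 𝕜), IsAdjointWeakSolution f g σ v → IsContRep S σ →
        IsContRep V (fun t => h10Val (v t)) → IsTraceAtOne σ τ →
        timePairing U.1 f + timePairing U.2 g =
          pairing ρ₀ (S ⟨0, le_rfl, hT.le⟩) + pairing u₀ (V ⟨0, le_rfl, hT.le⟩) +
            scalarPairing τ p := by
  simp only [IsTranspositionSolution, timePairing_apply, pairing_apply, scalarPairing_apply]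

theorem IsTranspositionSolution.add {hT : 0 < T} {ρ₀ u₀ ρ₀' u₀' : SpaceL2 𝕜} {p p' : TimeL2 T 𝕜}
    {U U' : TimeL2 T (SpaceL2 𝕜) × TimeL2 T (SpaceL2 𝕜)}
    (h : IsTranspositionSolution hT ρ₀ u₀ p U) (h' : IsTranspositionSolution hT ρ₀' u₀' p' U') :
    IsTranspositionSolution hT (ρ₀ + ρ₀') (u₀ + u₀') (p + p') (U + U') := by
  rw [isTranspositionSolution_iff] at h h' ⊢
  intro f g σ v S V τ h1 h2 h3 h4
  have e := h f g σ v S V τ h1 h2 h3 h4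
  have e' := h' f g σ v S V τ h1 h2 h3 h4
  simp only [Prod.fst_add, Prod.snd_add, map_add, add_apply]
  linear_combination e + e'

theorem IsTranspositionSolution.smul {hT : 0 < T} {ρ₀ u₀ : SpaceL2 𝕜} {p : TimeL2 T 𝕜}
    {U : TimeL2 T (SpaceL2 𝕜) × TimeL2 T (SpaceL2 𝕜)}
    (h : IsTranspositionSolution hT ρ₀ u₀ p U) (c : 𝕜) :
    IsTranspositionSolution hT (c • ρ₀) (c • u₀) (c • p) (c • U) := by
  rw [isTranspositionSolution_iff] at h ⊢
  intro f g σ v S V τ h1 h2 h3 h4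
  have e := h f g σ v S V τ h1 h2 h3 h4
  simp only [Prod.smul_fst, Prod.smul_snd, map_smul, smul_apply, smul_eq_mul]
  linear_combination c * e

/-- The weak solution of the adjoint system exists, with continuous representatives and trace. -/
theorem exists_adjoint_with_trace (hT : 0 < T) (f g : TimeL2 T (SpaceL2 𝕜)) :
    ∃ (σ : TimeL2 T (SpaceL2 𝕜)) (v : TimeL2 T (H10 𝕜)) (S V : TimeC T (SpaceL2 𝕜))
      (τ : TimeL2 T 𝕜), IsAdjointWeakSolution f g σ v ∧ IsContRep S σ ∧
        IsContRep V (fun t => h10Val (v t)) ∧ IsTraceAtOne σ τ := by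
  obtain ⟨σ, v, h⟩ := exists_isAdjointWeakSolution hT f g
  obtain ⟨c, hσ, hσT⟩ := h.weakTransport hT
  obtain ⟨d, hv, -⟩ := h.weakFlux hT
  obtain ⟨S, hS, -⟩ := hσ.exists_contRep hT
  obtain ⟨V, hV, -⟩ := hv.exists_contRep hT
  obtain ⟨τ, hτ⟩ := exists_integral_mul_eq
    (-(((timePairing (𝕜 := 𝕜) (T := T)).flip (-(f + derivCurve v))) ∘L lift))
  exact ⟨σ, v, S, V, τ, h, hS, hV, isTraceAtOne_of_weakTransport hT hσ hS (hσT S hS) hτ⟩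

/-- For all f and g there is an adjoint solution with representatives and trace. The two identities
it gives have the same right-hand side, so the difference pairs to zero with everything. -/
theorem IsTranspositionSolution.unique {hT : 0 < T} {ρ₀ u₀ : SpaceL2 𝕜} {p : TimeL2 T 𝕜}
    {U U' : TimeL2 T (SpaceL2 𝕜) × TimeL2 T (SpaceL2 𝕜)}
    (h : IsTranspositionSolution hT ρ₀ u₀ p U) (h' : IsTranspositionSolution hT ρ₀ u₀ p U') :
    U = U' := by
  rw [isTranspositionSolution_iff] at h h'
  have key : ∀ f g, timePairing (U.1 - U'.1) f + timePairing (U.2 - U'.2) g = 0 := fun f g => by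
    obtain ⟨σ, v, S, V, τ, h1, h2, h3, h4⟩ := exists_adjoint_with_trace hT f g
    have e := h f g σ v S V τ h1 h2 h3 h4
    have e' := h' f g σ v S V τ h1 h2 h3 h4
    simp only [map_sub, sub_apply]
    linear_combination e - e'
  refine Prod.ext (sub_eq_zero.1 (eq_zero_of_timePairing fun f => ?_))
    (sub_eq_zero.1 (eq_zero_of_timePairing fun g => ?_))
  · simpa using key f 0
  · simpa using key 0 g

/-- A weak solution with homogeneous boundary values plus the lift of the boundary datum is a solution
in the sense of transposition. -/
theorem isTranspositionSolution_of_weak (hT : 0 < T) {ρ₀ u₀ : SpaceL2 𝕜} {p : TimeL2 T 𝕜}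
    {r : TimeL2 T (SpaceL2 𝕜)} {w : TimeL2 T (H10 𝕜)}
    (hr : WeakTransport r (-derivCurve w) fun ξ => pairing ρ₀ (toL2 ξ))
    (hw : WeakFlux w 0 (lift p + r + valCurve w - derivCurve w) fun η => pairing u₀ (toL2 η)) :
    IsTranspositionSolution hT ρ₀ u₀ p (r + lift p, valCurve w) := by
  rw [isTranspositionSolution_iff]
  intro f g σ v S V τ h hS hV hτ
  obtain ⟨c, hσ, hσT⟩ := h.weakTransport hT
  obtain ⟨d, hv, hvT⟩ := h.weakFlux hT
  obtain ⟨R, hR, -⟩ := hr.exists_contRep hT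
  obtain ⟨W, hW, -⟩ := hw.exists_contRep hT
  obtain ⟨τ', hτ'⟩ := exists_integral_mul_eq
    (-(((timePairing (𝕜 := 𝕜) (T := T)).flip (-(f + derivCurve v))) ∘L lift))
  -- The given trace is arbitrary, and uniqueness identifies it with the one constructed by duality,
  -- whose pairing with p is known.
  have hττ' : τ = τ' := hτ.unique (isTraceAtOne_of_weakTransport hT hσ hS (hσT S hS) hτ')
  have e1 := hr.pairing_sub hT hσ hR hS
  have e2 := hw.pairing_sub hT hv hW hV
  have e3 : scalarPairing τ p = -timePairing (lift p) (-(f + derivCurve v)) := by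
    rw [scalarPairing_apply, hττ', hτ']
    rfl
  rw [hσT S hS, hr.initial_eq hT hR] at e1
  rw [hvT V hV, hw.initial_eq hT hW] at e2
  -- In the sum of the two product rules all products of r, w or w_x with σ or v_x cancel. The
  -- remaining term ∫∫ L v_x, together with ∫∫ L f from the lift in the first component, is the
  -- trace term.
  simp only [map_add, map_sub, map_neg, map_zero, add_apply, sub_apply, neg_apply, zero_apply,
    timePairing_comm (derivCurve w) σ] at e1 e2 e3 ⊢
  linear_combination e1 + e2 - e3

/-- Existence of regular solutions in the sense of transposition, with bounds. -/
theorem exists_regular_solution (hT : 0 < T) : ∃ C : ℝ, 0 < C ∧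
    ∀ (ρ₀ u₀ : SpaceL2 𝕜) (p : TimeL2 T 𝕜),
      ∃ U : TimeL2 T (SpaceL2 𝕜) × TimeL2 T (SpaceL2 𝕜), IsTranspositionSolution hT ρ₀ u₀ p U ∧
        ‖U‖ ≤ C * (‖ρ₀‖ + ‖u₀‖ + ‖p‖) ∧
        ∃ (R W : TimeC T (SpaceL2 𝕜)) (w : TimeL2 T (H10 𝕜)),
          IsContRep R U.1 ∧ IsContRep W U.2 ∧
          (∀ᵐ t ∂(timeMeasure T), h10Val (w t) = U.2 t) ∧
          ‖R‖ + (‖W‖ + ‖w‖) ≤ C * (‖ρ₀‖ + ‖u₀‖ + ‖p‖) := by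
  -- K and N bound the lift in L²(0,T;L²) and in the supremum norm, A bounds the weak solution (r,
  -- w), and B₁, B₂ are the square roots of the bounds for the continuous representatives.
  let K : ℝ := ‖(lift : TimeL2 T 𝕜 →L[𝕜] TimeL2 T (SpaceL2 𝕜))‖
  let N : ℝ := ⌈T⌉₊ + 1
  let A : ℝ := 2 * (1 + T) * (K + 1)
  let B₁ : ℝ := √(2 * (T⁻¹ + 1) * (A ^ 2 + A ^ 2))
  let B₂ : ℝ := √((2 * T⁻¹ + 4) * (A ^ 2 + (K + 3 * A) ^ 2))
  have hK : 0 ≤ K := norm_nonneg _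
  have hN : 0 ≤ N := by positivity
  have hA : 0 ≤ A := by positivity
  have hB₁ : 0 ≤ B₁ := Real.sqrt_nonneg _
  have hB₂ : 0 ≤ B₂ := Real.sqrt_nonneg _
  refine ⟨B₁ + N + B₂ + A + K + 1, by positivity, fun ρ₀ u₀ p => ?_⟩
  set M := ‖ρ₀‖ + ‖u₀‖ + ‖p‖ with hM
  have hM0 : 0 ≤ M := by positivity
  have hpM : ‖p‖ ≤ M := by rw [hM]; linarith [norm_nonneg ρ₀, norm_nonneg u₀]
  have hG : ‖lift p‖ ≤ K * ‖p‖ := ContinuousLinearMap.le_opNorm _ _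
  have hGM : ‖lift p‖ ≤ K * M := hG.trans (by gcongr)
  obtain ⟨r, w, ⟨hrn, hwn⟩, hr, hw⟩ := exists_forward hT (lift p) ρ₀ u₀
  have hAM : 2 * (1 + T) * (‖lift p‖ + (‖ρ₀‖ + ‖u₀‖)) ≤ A * M := by
    rw [mul_assoc (2 * (1 + T))]
    gcongr
    rw [add_mul, one_mul]
    exact add_le_add hGM (by rw [hM]; linarith [norm_nonneg p])
  have hrM := hrn.trans hAM
  have hwM := hwn.trans hAM
  obtain ⟨R, hR, hRn⟩ := hr.exists_contRep hT
  obtain ⟨W, hW, hWn⟩ := hw.exists_contRep hT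
  have hdw : ‖-derivCurve w‖ ≤ A * M := by
    rw [norm_neg]
    exact (norm_derivCurve_le w).trans hwM
  have hkM : ‖lift p + r + valCurve w - derivCurve w‖ ≤ (K + 3 * A) * M := by
    have n1 := norm_sub_le (lift p + r + valCurve w) (derivCurve w)
    have n2 := norm_add_le (lift p + r) (valCurve w)
    have n3 := norm_add_le (lift p) r
    have n4 := norm_valCurve_le w
    have n5 := norm_derivCurve_le w
    linarith
  have hRM : ‖R‖ ≤ B₁ * M := by
    refine abs_le_of_sq_le_sq' (hRn.trans ?_) (by positivity) |>.2
    rw [mul_pow, Real.sq_sqrt (by positivity), mul_assoc _ _ (M ^ 2), add_mul, ← mul_pow]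
    gcongr
  have hWM : ‖W‖ ≤ B₂ * M := by
    refine abs_le_of_sq_le_sq' (hWn.trans ?_) (by positivity) |>.2
    rw [mul_pow, Real.sq_sqrt (by positivity), mul_assoc _ _ (M ^ 2), add_mul (A ^ 2), ← mul_pow,
      ← mul_pow, norm_zero]
    simp only [ne_eq, OfNat.ofNat_ne_zero, not_false_eq_true, zero_pow, add_zero]
    gcongr
  have hLM : ‖liftCurve p‖ ≤ N * M := (norm_liftCurve_le p).trans (by gcongr)
  refine ⟨(r + lift p, valCurve w), isTranspositionSolution_of_weak hT hr hw, ?_,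
    R + liftCurve p, W, w, ?_, ?_, ?_, ?_⟩
  · have n1 := norm_add_le r (lift p)
    have n2 := norm_valCurve_le w
    have p1 : 0 ≤ B₁ * M := by positivity
    have p2 : 0 ≤ B₂ * M := by positivity
    have p3 : 0 ≤ N * M := by positivity
    have p4 : 0 ≤ K * M := by positivity
    refine max_le ?_ ?_
    · change ‖r + lift p‖ ≤ _
      linarith
    · change ‖valCurve w‖ ≤ _
      linarith
  · filter_upwards [hR, isContRep_liftCurve p, Lp.coeFn_add r (lift p)] with t ⟨ht, h1⟩ ⟨_, h2⟩ h3
    refine ⟨ht, ?_⟩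
    rw [h3, ContinuousMap.add_apply, h1, h2]
    rfl
  · refine hW.congr ?_
    filter_upwards [valCurve_ae w] with t ht
    rw [ht]
  · filter_upwards [valCurve_ae w] with t ht
    rw [ht]
  · have n1 := norm_add_le R (liftCurve p)
    have p4 : 0 ≤ K * M := by positivity
    linarith

end Transposition

end

theorem theorem2p3 {𝕜 : Type*} [RCLike 𝕜] {T : ℝ} (hT : 0 < T) :
    (∀ (ρ₀ u₀ : SpaceL2 𝕜) (p : TimeL2 T 𝕜),
      ∃! U : TimeL2 T (SpaceL2 𝕜) × TimeL2 T (SpaceL2 𝕜),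
        IsTranspositionSolution hT ρ₀ u₀ p U) ∧
    (∃ L : ((SpaceL2 𝕜 × SpaceL2 𝕜) × TimeL2 T 𝕜) →L[𝕜]
        (TimeL2 T (SpaceL2 𝕜) × TimeL2 T (SpaceL2 𝕜)),
      ∀ (ρ₀ u₀ : SpaceL2 𝕜) (p : TimeL2 T 𝕜),
        IsTranspositionSolution hT ρ₀ u₀ p (L ((ρ₀, u₀), p))) ∧
    (∃ C : ℝ, 0 < C ∧
      ∀ (ρ₀ u₀ : SpaceL2 𝕜) (p : TimeL2 T 𝕜)
        (U : TimeL2 T (SpaceL2 𝕜) × TimeL2 T (SpaceL2 𝕜)),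
        IsTranspositionSolution hT ρ₀ u₀ p U →
        ∃ (R W : TimeC T (SpaceL2 𝕜)) (w : TimeL2 T (H10 𝕜)),
          IsContRep R U.1 ∧ IsContRep W U.2 ∧
          (∀ᵐ t ∂(timeMeasure T), h10Val (w t) = U.2 t) ∧
          ‖R‖ + (‖W‖ + ‖w‖) ≤ C * (‖ρ₀‖ + ‖u₀‖ + ‖p‖)) := by
  obtain ⟨C, hC, hex⟩ := exists_regular_solution (𝕜 := 𝕜) hT
  choose F hF hFn hFr using hex
  refine ⟨fun ρ₀ u₀ p => ⟨F ρ₀ u₀ p, hF ρ₀ u₀ p, fun U hU => hU.unique (hF ρ₀ u₀ p)⟩, ?_,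
    C, hC, fun ρ₀ u₀ p U hU => ?_⟩
  -- Sums and multiples of solutions are solutions for the combined data, so uniqueness makes the
  -- chosen solutions depend linearly on the data.
  · let L₀ : ((SpaceL2 𝕜 × SpaceL2 𝕜) × TimeL2 T 𝕜) →ₗ[𝕜]
        (TimeL2 T (SpaceL2 𝕜) × TimeL2 T (SpaceL2 𝕜)) :=
      { toFun := fun d => F d.1.1 d.1.2 d.2
        map_add' := fun d d' => (hF _ _ _).unique ((hF _ _ _).add (hF _ _ _))
        map_smul' := fun c d => (hF _ _ _).unique ((hF _ _ _).smul c) }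
    -- The product carries the maximum norm, which bounds each of the three data norms.
    refine ⟨L₀.mkContinuous (C * 3) fun d => ?_, fun ρ₀ u₀ p => hF ρ₀ u₀ p⟩
    refine (hFn _ _ _).trans ?_
    rw [mul_assoc]
    gcongr
    have h1 : ‖d.1‖ ≤ ‖d‖ := norm_fst_le d
    have h2 : ‖d.2‖ ≤ ‖d‖ := norm_snd_le d
    have h3 : ‖d.1.1‖ ≤ ‖d.1‖ := norm_fst_le d.1
    have h4 : ‖d.1.2‖ ≤ ‖d.1‖ := norm_snd_le d.1
    linarith
  -- By uniqueness an arbitrary solution is the constructed one and inherits its regularity and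
  -- bound.
  · obtain rfl := hU.unique (hF ρ₀ u₀ p)
    exact hFr ρ₀ u₀ p
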